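/- Let $\lambda,\mu>0$ and $\theta,\alpha,\hat\lambda,\hat\mu,\hat\theta,\hat\alpha\in\mathbb R$ be constants with $\lambda\theta>2\mu$. For real $\epsilon$ and a delay $\Delta\ge 0$ consider the asymmetric queueing system, for $t\ge 0$ and with continuous initial functions on $[-\Delta,0]$, \begin{align*} \dot q_1(t)&=(\lambda+\epsilon\hat\lambda)\,\frac{e^{-(\theta+\epsilon\hat\theta)q_1(t-\Delta)+(\alpha+\epsilon\hat\alpha)}}{e^{-(\theta+\epsilon\hat\theta)q_1(t-\Delta)+(\alpha+\epsilon\hat\alpha)}+e^{-\theta q_2(t-\Delta)+\alpha}}-(\mu+\epsilon\hat\mu)\,q_1(t),\\ \dot q_2(t)&=\lambda\,\frac{e^{-\theta q_2(t-\Delta)+\alpha}}{e^{-(\theta+\epsilon\hat\theta)q_1(t-\Delta)+(\alpha+\epsilon\hat\alpha)}+e^{-\theta q_2(t-\Delta)+\alpha}}-\mu\,q_2(t). \end{align*} Put $$\omega_{\mathrm{cr}}=\tfrac12\sqrt{\lambda^2\theta^2-4\mu^2},\qquad \Delta_{\mathrm{cr}}=\frac{\arccos\left(\frac{-2\mu}{\lambda\theta}\right)}{\omega_{\mathrm{cr}}}.$$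 Then there are $\epsilon_0>0$ and a function $\epsilon\mapsto\Delta_{\mathrm{mod}}(\epsilon)>0$ on $(-\epsilon_0,\epsilon_0)$ with $$\Delta_{\mathrm{mod}}=\Delta_{\mathrm{cr}}-\epsilon\left(\frac{\mu+\Delta_{\mathrm{cr}}(\mu^2+\omega_{\mathrm{cr}}^2)}{2\lambda\omega_{\mathrm{cr}}^2}\hat\lambda-\frac{1+\mu\Delta_{\mathrm{cr}}}{2\omega_{\mathrm{cr}}^2}\hat\mu+\frac{\mu+\Delta_{\mathrm{cr}}(\mu^2+\omega_{\mathrm{cr}}^2)}{2\theta\omega_{\mathrm{cr}}^2}\hat\theta\right)+O(\epsilon^2)$$ (the error is at most $C\epsilon^2$ for all $|\epsilon|<\epsilon_0$, where $C$ may depend on the constants of the model), such that the stability of the system changes at $\Delta=\Delta_{\mathrm{mod}}$: for every $|\epsilon|<\epsilon_0$ the system has exactly one equilibrium (which does not depend on $\Delta$), and this equilibrium is locally asymptotically stable whenever $0\le\Delta<\Delta_{\mathrm{mod}}(\epsilon)$ and is not Lyapunov stable whenever $\Delta>\Delta_{\mathrm{mod}}(\epsilon)$. In particular $\hat\alpha$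 does not enter $\Delta_{\mathrm{mod}}$ at first order in $\epsilon$. Here closeness to the equilibrium is measured in the sup norm of the initial function on $[-\Delta,0]$: the equilibrium $p$ is Lyapunov stable if for every $\eta>0$ there is $\delta>0$ such that every solution that is $\delta$-close to $p$ on $[-\Delta,0]$ is $\eta$-close to $p$ for all $t\ge0$, and locally asymptotically stable if moreover, for some $\delta>0$, all such solutions converge to $p$ as $t\to\infty$. -/

import Mathlib

open Set Filter Topology

noncomputable section

/-- The constants of the two-queue model: arrival rate, service rate, sensitivity and preference
parameter, each with the coefficient (`Hat`) of its perturbation in the first queue. -/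
structure QueueParams where
  lam : ℝ
  mu : ℝ
  theta : ℝ
  alpha : ℝ
  lamHat : ℝ
  muHat : ℝ
  thetaHat : ℝ
  alphaHat : ℝ

namespace QueueParams

/-- Multinomial logit weight of the first queue, whose (delayed) length is `x`. -/
def weight₁ (P : QueueParams) (ε x : ℝ) : ℝ :=
  Real.exp (-(P.theta + ε * P.thetaHat) * x + (P.alpha + ε * P.alphaHat))

/-- Multinomial logit weight of the second queue, whose (delayed) length is `x`. -/
def weight₂ (P : QueueParams) (x : ℝ) : ℝ :=
  Real.exp (-P.theta * x + P.alpha)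

/-- Right-hand side of the asymmetric queueing system: `x` is the current state `(q₁(t), q₂(t))`
and `y` is the delayed state `(q₁(t - Δ), q₂(t - Δ))`. -/
def drift (P : QueueParams) (ε : ℝ) (x y : ℝ × ℝ) : ℝ × ℝ :=
  ((P.lam + ε * P.lamHat) * (P.weight₁ ε y.1 / (P.weight₁ ε y.1 + P.weight₂ y.2))
      - (P.mu + ε * P.muHat) * x.1,
    P.lam * (P.weight₂ y.2 / (P.weight₁ ε y.1 + P.weight₂ y.2)) - P.mu * x.2)

/-- `q` solves the asymmetric system with delay `Δ` on `[0, ∞)`, starting from a continuous initial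
function on `[-Δ, 0]`. Values of `q` before `-Δ` are irrelevant. -/
def IsSolution (P : QueueParams) (ε Δ : ℝ) (q : ℝ → ℝ × ℝ) : Prop :=
  ContinuousOn q (Ici (-Δ)) ∧
    ∀ t, 0 ≤ t → HasDerivWithinAt q (P.drift ε (q t) (q (t - Δ))) (Ici 0) t

/-- `p` is an equilibrium: the constant function `p` solves the system (for any delay). -/
def IsEquilibrium (P : QueueParams) (ε : ℝ) (p : ℝ × ℝ) : Prop :=
  P.drift ε p p = 0

/-- Lyapunov stability of `p` for the system with delay `Δ`: solutions whose initial function is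
uniformly close to `p` on `[-Δ, 0]` remain close to `p`. -/
def IsStable (P : QueueParams) (ε Δ : ℝ) (p : ℝ × ℝ) : Prop :=
  ∀ η > 0, ∃ δ > 0, ∀ q : ℝ → ℝ × ℝ, P.IsSolution ε Δ q →
    (∀ s ∈ Icc (-Δ) 0, dist (q s) p < δ) → ∀ t, 0 ≤ t → dist (q t) p < η

/-- (Local) asymptotic stability: Lyapunov stability, and solutions whose initial function is
uniformly close to `p` on `[-Δ, 0]` converge to `p`. -/
def IsAsymptoticallyStable (P : QueueParams) (ε Δ : ℝ) (p : ℝ × ℝ) : Prop :=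
  P.IsStable ε Δ p ∧
    ∃ δ > 0, ∀ q : ℝ → ℝ × ℝ, P.IsSolution ε Δ q →
      (∀ s ∈ Icc (-Δ) 0, dist (q s) p < δ) → Tendsto q atTop (𝓝 p)

/-- Critical frequency of the symmetric system. -/
def omegaCr (P : QueueParams) : ℝ :=
  1 / 2 * Real.sqrt (P.lam ^ 2 * P.theta ^ 2 - 4 * P.mu ^ 2)

/-- Critical delay of the symmetric system. -/
def deltaCr (P : QueueParams) : ℝ :=
  Real.arccos (-2 * P.mu / (P.lam * P.theta)) / P.omegaCr

/-- The first-order coefficient: the critical delay is `Δ_cr - ε * deltaCoeff + O(ε²)`. -/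
def deltaCoeff (P : QueueParams) : ℝ :=
  (P.mu + P.deltaCr * (P.mu ^ 2 + P.omegaCr ^ 2)) / (2 * P.lam * P.omegaCr ^ 2) * P.lamHat
    - (1 + P.mu * P.deltaCr) / (2 * P.omegaCr ^ 2) * P.muHat
    + (P.mu + P.deltaCr * (P.mu ^ 2 + P.omegaCr ^ 2)) / (2 * P.theta * P.omegaCr ^ 2) * P.thetaHat

end QueueParams

end

/-!
Around an equilibrium the queueing system is a scalar feedback loop. The deviation `x` from the
equilibrium enters the logit choice only through `v = -θ₁ x₁ + θ₂ x₂`, both queues are first-order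
lags driven by the same nonlinearity `g (v (t - Δ))`, and the linearization has the characteristic
function `1 + exp (-z Δ) A(z)` with `A(z) = a / (z + m₁) + b / (z + m₂)`. The theorem follows from
three facts about such loops.

*Stability* (`Loop.stability`). The output satisfies a convolution equation `v + κ ∗ v = f` whose
right-hand side consists of the initial data and a quadratic remainder. If `1 + exp (-i y Δ') A(i y)`
has no zero for `0 ≤ Δ' ≤ Δ`, then `1 + κ ∗` is invertible on `L²` by Plancherel, and its inverse is
causal. Causality is carried by a continuity method from the trivial loop to the given one, first
in the gain without delay and then in the delay (`exists_causal_inverse`). Hence the `L²` norm of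
`v` up to time `T` is bounded by the data up to time `T`. A continuation argument then gives
Lyapunov stability, and square integrability of `v` gives convergence.

*Instability* (`Loop.instability`). Let `z` be a root with positive real part. If a trajectory from a
constant history of size `d` stayed below a small level `η`, Plancherel on a vertical line
`Re = β < Re z` without roots would bound the weighted `L²` norm of `v` by a multiple of `d`. The
Laplace transform of the equation at `z` does not contain `v`, so it equates a nonzero multiple of
`d` with a remainder of size `O(η d)`, which is impossible for small `η`.

*Location of the roots* (`charFn_imag_ne_zero`, `exists_root`). `|A(i y)| = 1` holds exactly at
`y = ± ω` for an explicit `ω`, so a root on the imaginary axis requires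
`Δ ≥ critDelay = arccos (-Re A(i ω)) / ω`. For larger delays, the curve `|exp (-z Δ) A(z)| = 1` is a
graph over `y ∈ [0, ω]` in the right half-plane, because `|A|` decreases along horizontal rays, and
the intermediate value theorem for the phase along this curve gives a root with positive real part.

`critDelay` is a `C²` function of `ε` and of the slope `k` of the logistic curve at the equilibrium.
The logistic slope is maximal at the symmetric equilibrium, so `k = 1 / 4 + O(ε²)`. The first-order
term is therefore the derivative in `ε` at the constant slope `1 / 4`, and `alphaHat`, which acts
through the equilibrium only, does not enter it.
-/

noncomputable section

namespace DelayFeedback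

open MeasureTheory FourierTransform

/-! ### Fourier multipliers and causality on `L²` -/

section Multipliers

open scoped ContDiff Convolution

/-- Self-adjointness of the Fourier transform, tested against a Schwartz function. -/
theorem integral_fourier_mul_schwartz {f : ℝ → ℂ} (hf : Integrable f) (h : SchwartzMap ℝ ℂ) :
    ∫ ξ, h ξ * 𝓕 f ξ = ∫ x, (𝓕 h) x * f x := by
  have := VectorFourier.integral_fourierIntegral_smul_eq_flip (e := Real.fourierChar)
    (L := innerₗ ℝ) (μ := volume) (ν := volume) Real.continuous_fourierChar
    (by fun_prop) hf h.integrable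
  simp only [smul_eq_mul, flip_innerₗ] at this
  calc ∫ ξ, h ξ * 𝓕 f ξ = ∫ ξ, 𝓕 f ξ * h ξ := by simp_rw [mul_comm]
    _ = ∫ x, f x * (𝓕 h) x := this
    _ = _ := by simp_rw [mul_comm]

/-- If the integral Fourier transform of an integrable `f` lies in `L²`, then `f` is its inverse
Plancherel transform: both define the same tempered distribution. -/
theorem ae_eq_fourierInv_of_fourier_ae_eq {f : ℝ → ℂ} (hf : Integrable f)
    (F : Lp ℂ 2 (volume : Measure ℝ)) (hF : 𝓕 f =ᵐ[volume] F) :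
    f =ᵐ[volume] (𝓕⁻ F : Lp ℂ 2 (volume : Measure ℝ)) := by
  refine ae_eq_of_integral_contDiff_smul_eq hf.locallyIntegrable
    ((Lp.memLp _).locallyIntegrable (by norm_num)) fun g hg hgc => ?_
  have hg₁ : HasCompactSupport (Complex.ofRealCLM ∘ g) := hgc.comp_left rfl
  have hg₂ : ContDiff ℝ ∞ (Complex.ofRealCLM ∘ g) := by fun_prop
  set G := hg₁.toSchwartzMap hg₂ with hG
  have hGg : ∀ x, G x = (g x : ℂ) := fun x => rfl
  have h1 : ∫ x, g x • f x = ∫ x, G x * f x := by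
    simp [hGg]
  have h2 : ∫ x, g x • (𝓕⁻ F : Lp ℂ 2 (volume : Measure ℝ)) x
      = Lp.toTemperedDistribution (𝓕⁻ F) G := by
    simp [hGg]
  rw [h1, h2, ← Lp.fourierInv_toTemperedDistribution_eq,
    TemperedDistribution.fourierInv_apply, Lp.toTemperedDistribution_apply]
  have h3 := integral_fourier_mul_schwartz hf (𝓕⁻ G)
  rw [fourier_fourierInv_eq] at h3
  rw [← h3]
  refine integral_congr_ae ?_
  filter_upwards [hF] with x hx
  simp [hx]

/-- On `L¹ ∩ L²` the Plancherel transform is the integral Fourier transform. -/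
theorem fourier_toLp_ae_eq {f : ℝ → ℂ} (hf : Integrable f) (hf2 : MemLp f 2) :
    (𝓕 (hf2.toLp f) : Lp ℂ 2 (volume : Measure ℝ)) =ᵐ[volume] 𝓕 f := by
  have hc : Continuous (𝓕 f) := VectorFourier.fourierIntegral_continuous
    Real.continuous_fourierChar (by fun_prop) hf
  refine ae_eq_of_integral_contDiff_smul_eq
    ((Lp.memLp _).locallyIntegrable (by norm_num)) hc.locallyIntegrable fun g hg hgc => ?_
  have hg₁ : HasCompactSupport (Complex.ofRealCLM ∘ g) := hgc.comp_left rfl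
  have hg₂ : ContDiff ℝ ∞ (Complex.ofRealCLM ∘ g) := by fun_prop
  set G := hg₁.toSchwartzMap hg₂ with hG
  have hGg : ∀ x, G x = (g x : ℂ) := fun x => rfl
  have h1 : ∫ x, g x • 𝓕 f x = ∫ x, G x * 𝓕 f x := by
    simp [hGg]
  have h2 : ∫ x, g x • (𝓕 (hf2.toLp f) : Lp ℂ 2 (volume : Measure ℝ)) x
      = Lp.toTemperedDistribution (𝓕 (hf2.toLp f)) G := by
    simp [hGg]
  rw [h1, h2, ← Lp.fourier_toTemperedDistribution_eq,
    TemperedDistribution.fourier_apply, Lp.toTemperedDistribution_apply,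
    integral_fourier_mul_schwartz hf]
  refine integral_congr_ae ?_
  filter_upwards [hf2.coeFn_toLp] with x hx
  simp [hx]

/-- The Hilbert space of complex square integrable functions of time. -/
abbrev L2 := Lp ℂ 2 (volume : Measure ℝ)

theorem memLp_mul_bcf (m : BoundedContinuousFunction ℝ ℂ) {f : ℝ → ℂ} (hf : MemLp f 2) :
    MemLp (fun x => m x * f x) 2 :=
  hf.of_le_mul (c := ‖m‖) (m.continuous.aestronglyMeasurable.mul hf.1)
    (Eventually.of_forall fun x => by
      rw [norm_mul]; gcongr; exact m.norm_coe_le_norm x)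

/-- The Fourier multiplier with symbol `m`, acting on `L²`. -/
def multiplier (m : BoundedContinuousFunction ℝ ℂ) (f : L2) : L2 :=
  𝓕⁻ ((memLp_mul_bcf m (Lp.memLp (𝓕 f))).toLp _)

theorem fourier_multiplier (m : BoundedContinuousFunction ℝ ℂ) (f : L2) :
    (𝓕 (multiplier m f) : L2) =ᵐ[volume] fun x => m x * (𝓕 f : L2) x := by
  rw [multiplier, fourier_fourierInv_eq]
  exact MemLp.coeFn_toLp _

theorem L2.ext_fourier {f g : L2} (h : (𝓕 f : L2) =ᵐ[volume] (𝓕 g : L2)) : f = g := by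
  have := Lp.ext h
  rw [← fourierInv_fourier_eq (F := L2) f, this, fourierInv_fourier_eq]

theorem norm_multiplier_le (m : BoundedContinuousFunction ℝ ℂ) (f : L2) :
    ‖multiplier m f‖ ≤ ‖m‖ * ‖f‖ := by
  rw [← Lp.norm_fourier_eq, ← Lp.norm_fourier_eq f]
  refine Lp.norm_le_mul_norm_of_ae_le_mul ?_
  filter_upwards [fourier_multiplier m f] with x hx
  rw [hx, norm_mul]; gcongr; exact m.norm_coe_le_norm x

theorem multiplier_mul (m n : BoundedContinuousFunction ℝ ℂ) (f : L2) :
    multiplier (m * n) f = multiplier m (multiplier n f) := by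
  apply L2.ext_fourier
  filter_upwards [fourier_multiplier (m * n) f, fourier_multiplier m (multiplier n f),
    fourier_multiplier n f] with x h1 h2 h3
  rw [h1, h2, h3, BoundedContinuousFunction.mul_apply, mul_assoc]

theorem multiplier_one (f : L2) : multiplier 1 f = f := by
  apply L2.ext_fourier
  filter_upwards [fourier_multiplier 1 f] with x h1
  simp [h1]

theorem multiplier_add (m n : BoundedContinuousFunction ℝ ℂ) (f : L2) :
    multiplier (m + n) f = multiplier m f + multiplier n f := by
  apply L2.ext_fourier
  rw [FourierTransform.fourier_add]
  filter_upwards [fourier_multiplier (m + n) f, fourier_multiplier m f, fourier_multiplier n f,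
    Lp.coeFn_add (𝓕 (multiplier m f) : L2) (𝓕 (multiplier n f))] with x h1 h2 h3 h4
  rw [h1, h4, Pi.add_apply, h2, h3, BoundedContinuousFunction.add_apply, add_mul]

theorem multiplier_sub (m n : BoundedContinuousFunction ℝ ℂ) (f : L2) :
    multiplier (m - n) f = multiplier m f - multiplier n f := by
  rw [eq_sub_iff_add_eq, ← multiplier_add, sub_add_cancel]

theorem multiplier_map_add (m : BoundedContinuousFunction ℝ ℂ) (f g : L2) :
    multiplier m (f + g) = multiplier m f + multiplier m g := by
  apply L2.ext_fourier
  rw [FourierTransform.fourier_add]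
  filter_upwards [fourier_multiplier m (f + g), fourier_multiplier m f, fourier_multiplier m g,
    Lp.coeFn_add (𝓕 (multiplier m f) : L2) (𝓕 (multiplier m g)),
    Lp.coeFn_add (𝓕 f : L2) (𝓕 g)] with x h1 h2 h3 h4 h5
  rw [FourierTransform.fourier_add] at h1
  rw [h1, h4, Pi.add_apply, h2, h3, h5, Pi.add_apply, mul_add]

theorem multiplier_map_sub (m : BoundedContinuousFunction ℝ ℂ) (f g : L2) :
    multiplier m (f - g) = multiplier m f - multiplier m g := by
  rw [eq_sub_iff_add_eq, ← multiplier_map_add, sub_add_cancel]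

/-- Convolution of complex functions on the line with respect to Lebesgue measure. -/
def conv (κ w : ℝ → ℂ) : ℝ → ℂ :=
  convolution κ w (ContinuousLinearMap.mul ℂ ℂ) volume

theorem conv_apply (κ w : ℝ → ℂ) (t : ℝ) : conv κ w t = ∫ s, κ s * w (t - s) := rfl

theorem conv_apply' (κ w : ℝ → ℂ) (t : ℝ) : conv κ w t = ∫ s, κ (t - s) * w s := by
  rw [conv, convolution_eq_swap]; rfl

theorem integrable_conv {κ w : ℝ → ℂ} (hκ : Integrable κ) (hw : Integrable w) :
    Integrable (conv κ w) := Integrable.integrable_convolution _ hκ hw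

theorem fourier_conv {κ w : ℝ → ℂ} (hκ : Integrable κ) (hw : Integrable w) (y : ℝ) :
    𝓕 (conv κ w) y = 𝓕 κ y * 𝓕 w y := Real.fourier_mul_convolution_eq hκ hw y

/-- Convolution with an integrable kernel is the Fourier multiplier whose symbol is the transform
of the kernel. -/
theorem conv_ae_eq_multiplier {m : BoundedContinuousFunction ℝ ℂ} {κ w : ℝ → ℂ}
    (hκ : Integrable κ) (hm : ∀ y, 𝓕 κ y = m y) (hw : Integrable w) (hw2 : MemLp w 2) :
    conv κ w =ᵐ[volume] multiplier m (hw2.toLp w) := by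
  have := ae_eq_fourierInv_of_fourier_ae_eq (integrable_conv hκ hw)
    (𝓕 (multiplier m (hw2.toLp w))) ?_
  · rwa [fourierInv_fourier_eq] at this
  · filter_upwards [fourier_multiplier m (hw2.toLp w), fourier_toLp_ae_eq hw hw2] with y h1 h2
    rw [h1, h2, fourier_conv hκ hw, hm]

theorem memLp_conv {m : BoundedContinuousFunction ℝ ℂ} {κ w : ℝ → ℂ}
    (hκ : Integrable κ) (hm : ∀ y, 𝓕 κ y = m y) (hw : Integrable w) (hw2 : MemLp w 2) :
    MemLp (conv κ w) 2 :=
  (memLp_congr_ae (conv_ae_eq_multiplier hκ hm hw hw2)).2 (Lp.memLp _)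

theorem eLpNorm_conv_le {m : BoundedContinuousFunction ℝ ℂ} {κ w : ℝ → ℂ}
    (hκ : Integrable κ) (hm : ∀ y, 𝓕 κ y = m y) (hw : Integrable w) (hw2 : MemLp w 2) :
    (eLpNorm (conv κ w) 2 volume).toReal ≤ ‖m‖ * (eLpNorm w 2 volume).toReal := by
  have := norm_multiplier_le m (hw2.toLp w)
  rwa [Lp.norm_def, ← eLpNorm_congr_ae (conv_ae_eq_multiplier hκ hm hw hw2), Lp.norm_toLp] at this

/-- If the symbol `1 + m` has a bounded inverse `n`, then `w ↦ w + κ ∗ w` is bounded below on `L²`. -/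
theorem eLpNorm_le_of_symbol {m n : BoundedContinuousFunction ℝ ℂ} {κ w : ℝ → ℂ}
    (hκ : Integrable κ) (hm : ∀ y, 𝓕 κ y = m y) (hmn : (1 + m) * n = 1)
    (hw : Integrable w) (hw2 : MemLp w 2) :
    (eLpNorm w 2 volume).toReal ≤ ‖n‖ * (eLpNorm (w + conv κ w) 2 volume).toReal := by
  have h1 := norm_multiplier_le n (multiplier (1 + m) (hw2.toLp w))
  rw [← multiplier_mul, mul_comm n, hmn, multiplier_one, Lp.norm_toLp, Lp.norm_def] at h1
  refine h1.trans_eq ?_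
  congr 2
  refine eLpNorm_congr_ae ?_
  rw [multiplier_add, multiplier_one]
  filter_upwards [Lp.coeFn_add (hw2.toLp w) (multiplier m (hw2.toLp w)), hw2.coeFn_toLp,
    conv_ae_eq_multiplier hκ hm hw hw2] with x h1 h2 h3
  rw [h1, Pi.add_apply, Pi.add_apply, h2, h3]

/-- `f` vanishes almost everywhere on `(-∞, a)`. -/
def VanishesBelow (a : ℝ) (f : L2) : Prop := ∀ᵐ x, x < a → f x = 0

/-- The multiplier with symbol `m` is causal: the output before time `a` depends on the input
before time `a` only. -/
def Causal (m : BoundedContinuousFunction ℝ ℂ) : Prop :=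
  ∀ (a : ℝ) (f : L2), VanishesBelow a f → VanishesBelow a (multiplier m f)

/-- The functions that vanish below `a` form a closed subset of `L²`. -/
theorem VanishesBelow.of_approx {a : ℝ} {f : L2}
    (h : ∀ ε > 0, ∃ g : L2, VanishesBelow a g ∧ ‖f - g‖ < ε) : VanishesBelow a f := by
  have key : eLpNorm f 2 (volume.restrict (Iio a)) = 0 := by
    by_contra hne
    have hfin : eLpNorm f 2 (volume.restrict (Iio a)) ≠ ⊤ := (Lp.memLp f).restrict _ |>.2.ne
    obtain ⟨g, hg, hfg⟩ := h _ (ENNReal.toReal_pos hne hfin)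
    refine absurd hfg (not_lt.2 ?_)
    rw [Lp.norm_def]
    have hae : (f : ℝ → ℂ) =ᵐ[volume.restrict (Iio a)] ((f - g : L2) : ℝ → ℂ) := by
      rw [EventuallyEq, ae_restrict_iff' measurableSet_Iio]
      filter_upwards [hg, Lp.coeFn_sub f g] with x h1 h2 hx
      rw [h2, Pi.sub_apply, h1 hx, sub_zero]
    rw [eLpNorm_congr_ae hae]
    exact ENNReal.toReal_mono (Lp.memLp (f - g)).2.ne
      (eLpNorm_mono_measure _ Measure.restrict_le_self)
  rw [eLpNorm_eq_zero_iff ((Lp.memLp f).restrict _).1 (by norm_num), EventuallyEq,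
    ae_restrict_iff' measurableSet_Iio] at key
  exact key

theorem VanishesBelow.add {a : ℝ} {f g : L2} (hf : VanishesBelow a f) (hg : VanishesBelow a g) :
    VanishesBelow a (f + g) := by
  filter_upwards [hf, hg, Lp.coeFn_add f g] with x h1 h2 h3 hx
  rw [h3, Pi.add_apply, h1 hx, h2 hx, add_zero]

theorem VanishesBelow.sub {a : ℝ} {f g : L2} (hf : VanishesBelow a f) (hg : VanishesBelow a g) :
    VanishesBelow a (f - g) := by
  filter_upwards [hf, hg, Lp.coeFn_sub f g] with x h1 h2 h3 hx
  rw [h3, Pi.sub_apply, h1 hx, h2 hx, sub_zero]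

theorem causal_one : Causal 1 := fun a f hf => by rwa [multiplier_one]

theorem Causal.mul {m n : BoundedContinuousFunction ℝ ℂ} (hm : Causal m) (hn : Causal n) :
    Causal (m * n) := fun a f hf => by
  rw [multiplier_mul]; exact hm a _ (hn a f hf)

theorem Causal.add {m n : BoundedContinuousFunction ℝ ℂ} (hm : Causal m) (hn : Causal n) :
    Causal (m + n) := fun a f hf => by
  rw [multiplier_add]; exact (hm a f hf).add (hn a f hf)

theorem Causal.sub {m n : BoundedContinuousFunction ℝ ℂ} (hm : Causal m) (hn : Causal n) :
    Causal (m - n) := fun a f hf => by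
  rw [multiplier_sub]; exact (hm a f hf).sub (hn a f hf)

theorem Causal.pow {m : BoundedContinuousFunction ℝ ℂ} (hm : Causal m) (k : ℕ) :
    Causal (m ^ k) := by
  induction k with
  | zero => simpa using causal_one
  | succ k ih => rw [pow_succ]; exact ih.mul hm

theorem Causal.of_tendsto {u : ℕ → BoundedContinuousFunction ℝ ℂ}
    {m : BoundedContinuousFunction ℝ ℂ} (hu : ∀ k, Causal (u k))
    (h : Tendsto u atTop (𝓝 m)) : Causal m := fun a f hf => by
  refine VanishesBelow.of_approx fun ε hε => ?_
  have h2 : Tendsto (fun k => ‖m - u k‖ * ‖f‖) atTop (𝓝 0) := by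
    have : Tendsto (fun k => ‖m - u k‖) atTop (𝓝 0) := by
      simpa using (tendsto_const_nhds (x := m).sub h).norm
    simpa using this.mul_const ‖f‖
  obtain ⟨k, hk⟩ := (h2.eventually (gt_mem_nhds hε)).exists
  refine ⟨multiplier (u k) f, hu k a f hf, ?_⟩
  rw [← multiplier_sub]
  exact (norm_multiplier_le _ _).trans_lt hk

/-- Causality of the inverse is stable under small perturbations of the symbol, by the Neumann
series `n' = n ∑ ((m - m') n) ^ k`. -/
theorem Causal.inv_of_near {m n m' n' : BoundedContinuousFunction ℝ ℂ} (hm : Causal m)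
    (hm' : Causal m') (hn : Causal n) (hmn : m * n = 1) (hmn' : m' * n' = 1)
    (hd : ‖m - m'‖ * ‖n‖ < 1) : Causal n' := by
  set X := (m - m') * n with hX
  have hXc : Causal X := (hm.sub hm').mul hn
  have hX1 : ‖X‖ < 1 := (norm_mul_le _ _).trans_lt hd
  have hS : Causal (∑' k, X ^ k) := by
    have hs := (summable_geometric_of_norm_lt_one hX1).hasSum.tendsto_sum_nat
    refine Causal.of_tendsto (fun k => ?_) hs
    induction k with
    | zero => simpa using causal_one.sub causal_one
    | succ k ih => rw [Finset.sum_range_succ]; exact ih.add (hXc.pow k)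
  have h1 : m' * n = 1 - X := by rw [hX, sub_mul, hmn]; ring
  have h2 : n' = n * ∑' k, X ^ k := by
    have h3 : (1 - X) * ∑' k, X ^ k = 1 := mul_neg_geom_series X hX1
    calc n' = n' * ((1 - X) * ∑' k, X ^ k) := by rw [h3, mul_one]
      _ = (m' * n') * (n * ∑' k, X ^ k) := by rw [← h1]; ring
      _ = _ := by rw [hmn', one_mul]
  rw [h2]
  exact hn.mul hS

/-- Continuity method: along a path of causal symbols whose inverses are uniformly bounded,
causality of the inverse propagates from one end to the other. -/
theorem causal_inverse_of_path {m n : ℝ → BoundedContinuousFunction ℝ ℂ} {a b δ : ℝ} (hδ : 0 < δ)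
    (hab : a ≤ b) (hm : ∀ s, Causal (m s)) (hmn : ∀ s ∈ Icc a b, m s * n s = 1)
    (hd : ∀ s ∈ Icc a b, ∀ s' ∈ Icc a b, |s - s'| ≤ δ → ‖m s - m s'‖ * ‖n s‖ < 1)
    (ha : Causal (n a)) : Causal (n b) := by
  have key : ∀ k : ℕ, ∀ s ∈ Icc a b, s ≤ a + k * δ → Causal (n s) := by
    intro k
    induction k with
    | zero =>
      intro s hs h
      have : s = a := le_antisymm (by simpa using h) hs.1
      rwa [this]
    | succ k ih =>
      intro s hs h
      have hs' : max a (s - δ) ∈ Icc a b := ⟨le_max_left _ _, max_le hab (by linarith [hs.2])⟩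
      push_cast at h
      refine Causal.inv_of_near (hm _) (hm s) (ih _ hs' ?_) (hmn _ hs') (hmn s hs)
        (hd _ hs' s hs ?_)
      · refine max_le ?_ (by linarith)
        have : (0:ℝ) ≤ k * δ := by positivity
        linarith
      · rw [abs_le]
        constructor
        · linarith [le_max_right a (s - δ)]
        · linarith [max_le hs.1 (by linarith : s - δ ≤ s)]
  obtain ⟨k, hk⟩ := exists_nat_gt ((b - a) / δ)
  refine key k b ⟨hab, le_rfl⟩ ?_
  rw [div_lt_iff₀ hδ] at hk
  linarith

theorem conv_eq_zero_of_lt {κ w : ℝ → ℂ} {a b t : ℝ} (hκ : ∀ s < a, κ s = 0)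
    (hw : ∀ s < b, w s = 0) (ht : t < a + b) : conv κ w t = 0 := by
  rw [conv_apply]
  refine integral_eq_zero_of_ae (Eventually.of_forall fun s => ?_)
  rcases lt_or_ge s a with h | h
  · simp [hκ s h]
  · simp [hw (t - s) (by linarith)]

/-- A kernel supported on `[0, ∞)` gives a causal multiplier. The input is approximated in `L²` by
continuous functions of compact support, for which the convolution is an integral. -/
theorem causal_of_kernel {m : BoundedContinuousFunction ℝ ℂ} {κ : ℝ → ℂ}
    (hκ : Integrable κ) (hκ0 : ∀ s < 0, κ s = 0) (hm : ∀ y, 𝓕 κ y = m y) : Causal m := by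
  intro a f hf
  refine VanishesBelow.of_approx fun ε hε => ?_
  obtain ⟨η, hη, hηε⟩ : ∃ η > 0, ‖m‖ * η < ε := by
    refine ⟨ε / (‖m‖ + 1), by positivity, ?_⟩
    rw [mul_div_assoc', div_lt_iff₀ (by positivity)]
    nlinarith [norm_nonneg m]
  obtain ⟨g, hgc, hfg, hg, hg2⟩ := (Lp.memLp f).exists_hasCompactSupport_eLpNorm_sub_le
    (by norm_num) (ε := ENNReal.ofReal η) (by simpa using hη)
  have hgi : Integrable g := hg.integrable_of_hasCompactSupport hgc
  set w := (Ici a).indicator g with hw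
  have hwi : Integrable w := hgi.indicator measurableSet_Ici
  have hw2 : MemLp w 2 := hg2.indicator measurableSet_Ici
  refine ⟨multiplier m (hw2.toLp w), ?_, ?_⟩
  · filter_upwards [conv_ae_eq_multiplier hκ hm hwi hw2] with t ht hta
    rw [← ht]
    refine conv_eq_zero_of_lt (a := 0) (b := a) hκ0 (fun s hs => ?_) (by linarith)
    simp [hw, hs]
  · rw [← multiplier_map_sub]
    refine (norm_multiplier_le _ _).trans_lt (lt_of_le_of_lt ?_ hηε)
    gcongr
    rw [Lp.norm_def]
    refine ENNReal.toReal_le_of_le_ofReal hη.le (le_trans ?_ hfg)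
    refine eLpNorm_mono_ae ?_
    filter_upwards [Lp.coeFn_sub f (hw2.toLp w), hw2.coeFn_toLp, hf] with x h1 h2 h3
    rw [h1, Pi.sub_apply, h2, Pi.sub_apply, hw]
    rcases lt_or_ge x a with h | h
    · simp [h, h3 h]
    · simp [indicator_of_mem (mem_Ici.2 h)]

/-- When the inverse of `1 + m` is causal, a function supported on `(-∞, T)` is controlled by the
values of `w + κ ∗ w` on `(-∞, T)` alone. -/
theorem eLpNorm_le_of_causal {m n : BoundedContinuousFunction ℝ ℂ} {κ w : ℝ → ℂ} {T : ℝ}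
    (hκ : Integrable κ) (hm : ∀ y, 𝓕 κ y = m y) (hmn : (1 + m) * n = 1) (hn : Causal n)
    (hw : Integrable w) (hw2 : MemLp w 2) (hwT : ∀ t, T ≤ t → w t = 0) :
    (eLpNorm w 2 volume).toReal
      ≤ ‖n‖ * (eLpNorm ((Iio T).indicator (w + conv κ w)) 2 volume).toReal := by
  have hu2 : MemLp (w + conv κ w) 2 := hw2.add (memLp_conv hκ hm hw hw2)
  have hc2 : MemLp ((Iio T).indicator (w + conv κ w)) 2 := hu2.indicator measurableSet_Iio
  have hr2 : MemLp ((Ici T).indicator (w + conv κ w)) 2 := hu2.indicator measurableSet_Ici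
  set c := hc2.toLp _ with hc
  set r := hr2.toLp _ with hr
  have hU : multiplier (1 + m) (hw2.toLp w) = c + r := by
    apply Lp.ext
    rw [multiplier_add, multiplier_one]
    filter_upwards [Lp.coeFn_add (hw2.toLp w) (multiplier m (hw2.toLp w)), hw2.coeFn_toLp,
      conv_ae_eq_multiplier hκ hm hw hw2, Lp.coeFn_add c r, hc2.coeFn_toLp, hr2.coeFn_toLp]
      with x h1 h2 h3 h4 h5 h6
    rw [h1, h4, Pi.add_apply, Pi.add_apply, h2, ← h3, hc, hr, h5, h6]
    rcases lt_or_ge x T with h | h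
    · simp [h]
    · simp [h]
  have hrT : VanishesBelow T r := by
    filter_upwards [hr2.coeFn_toLp] with x h1 hx
    simp [hr, h1, hx]
  have hwv : hw2.toLp w = multiplier n c + multiplier n r := by
    rw [← multiplier_map_add, ← hU, ← multiplier_mul, mul_comm, hmn, multiplier_one]
  have h1 : ‖hw2.toLp w‖ ≤ ‖multiplier n c‖ := by
    refine Lp.norm_le_norm_of_ae_le ?_
    filter_upwards [hn T r hrT, hw2.coeFn_toLp,
      Lp.coeFn_add (multiplier n c) (multiplier n r)] with x h1 h2 h3
    rcases lt_or_ge x T with h | h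
    · rw [hwv, h3, Pi.add_apply, h1 h, add_zero]
    · simp [h2, hwT x h]
  have h2 := h1.trans (norm_multiplier_le n c)
  rwa [Lp.norm_toLp, hc, Lp.norm_toLp] at h2

end Multipliers

/-! ### Exponential kernels and the characteristic function -/

/-- The exponential kernel `t ↦ exp (-c (t - Δ))`, switched on at time `Δ`. -/
def expKer (c : ℂ) (Δ : ℝ) : ℝ → ℂ :=
  (Ici Δ).indicator fun t => Complex.exp (-c * (t - Δ))

theorem expKer_of_le {c : ℂ} {Δ t : ℝ} (h : Δ ≤ t) :
    expKer c Δ t = Complex.exp (-c * (t - Δ)) := indicator_of_mem (mem_Ici.2 h) _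

theorem expKer_of_lt {c : ℂ} {Δ t : ℝ} (h : t < Δ) : expKer c Δ t = 0 :=
  indicator_of_notMem (by simpa using h) _

theorem norm_expKer_of_le {c : ℂ} {Δ t : ℝ} (h : Δ ≤ t) :
    ‖expKer c Δ t‖ = Real.exp (-c.re * (t - Δ)) := by
  rw [expKer_of_le h, Complex.norm_exp]
  simp

theorem measurable_expKer (c : ℂ) (Δ : ℝ) : Measurable (expKer c Δ) :=
  Measurable.indicator (by fun_prop) measurableSet_Ici

theorem weight_mul_expKer (z c : ℂ) (Δ t : ℝ) :
    Complex.exp (-z * t) * expKer c Δ t = Complex.exp (-z * Δ) * expKer (c + z) Δ t := by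
  rcases le_or_gt Δ t with h | h
  · rw [expKer_of_le h, expKer_of_le h, ← Complex.exp_add, ← Complex.exp_add]
    ring_nf
  · simp [expKer_of_lt h]

theorem expKer_eq (c : ℂ) (Δ : ℝ) :
    expKer c Δ = (Ici Δ).indicator fun t => Complex.exp (c * Δ) * Complex.exp (-c * t) := by
  ext t
  rw [expKer]
  congr 1
  ext t
  rw [← Complex.exp_add]; ring_nf

theorem integrable_expKer {c : ℂ} (hc : 0 < c.re) (Δ : ℝ) : Integrable (expKer c Δ) := by
  rw [expKer_eq, integrable_indicator_iff measurableSet_Ici, integrableOn_Ici_iff_integrableOn_Ioi]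
  exact (integrableOn_exp_mul_complex_Ioi (by simpa using hc) Δ).const_mul _

theorem integral_expKer {c : ℂ} (hc : 0 < c.re) (Δ : ℝ) : ∫ t, expKer c Δ t = 1 / c := by
  rw [expKer_eq, integral_indicator measurableSet_Ici, integral_Ici_eq_integral_Ioi,
    integral_const_mul, integral_exp_mul_complex_Ioi (by simpa using hc)]
  rw [neg_div_neg_eq, mul_div_assoc', ← Complex.exp_add]
  simp

theorem norm_expKer_le_one {c : ℂ} (hc : 0 < c.re) (Δ t : ℝ) : ‖expKer c Δ t‖ ≤ 1 := by
  rcases le_or_gt Δ t with h | h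
  · rw [norm_expKer_of_le h, Real.exp_le_one_iff]
    nlinarith
  · simp [expKer_of_lt h]

theorem memLp_of_integrable_of_bound {f : ℝ → ℂ} (hf : Integrable f) {C : ℝ}
    (hC : ∀ t, ‖f t‖ ≤ C) : MemLp f 2 := by
  rw [memLp_two_iff_integrable_sq_norm hf.1]
  refine (hf.norm.const_mul C).mono' (hf.1.norm.pow 2) (Eventually.of_forall fun t => ?_)
  rw [Real.norm_of_nonneg (by positivity), sq]
  gcongr
  exact hC t

theorem memLp_expKer {c : ℂ} (hc : 0 < c.re) (Δ : ℝ) : MemLp (expKer c Δ) 2 :=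
  memLp_of_integrable_of_bound (integrable_expKer hc Δ) (norm_expKer_le_one hc Δ)

theorem fourier_expKer {c : ℂ} (hc : 0 < c.re) (Δ y : ℝ) :
    𝓕 (expKer c Δ) y = Complex.exp (-(2 * Real.pi * y * Complex.I) * Δ)
      / (c + 2 * Real.pi * y * Complex.I) := by
  rw [Real.fourier_real_eq_integral_exp_smul]
  have : ∀ v : ℝ, Complex.exp (↑(-2 * Real.pi * v * y) * Complex.I) • expKer c Δ v
      = Complex.exp (-(2 * Real.pi * y * Complex.I) * Δ)
        * expKer (c + 2 * Real.pi * y * Complex.I) Δ v := by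
    intro v
    rw [← weight_mul_expKer, smul_eq_mul]
    congr 2
    push_cast; ring
  simp_rw [this]
  rw [integral_const_mul, integral_expKer (by simpa using hc)]
  ring

theorem denom_bounds (c : ℂ) (y : ℝ) :
    c.re ≤ ‖c + 2 * Real.pi * y * Complex.I‖ := by
  refine le_trans ?_ (Complex.re_le_norm _)
  simp

theorem norm_unit_exp (x Δ : ℝ) : ‖Complex.exp (-(2 * Real.pi * x * Complex.I) * Δ)‖ = 1 := by
  rw [Complex.norm_exp]
  simp

/-- The Fourier transform of `expKer c Δ`, as a bounded continuous function of the frequency. -/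
def sym (c : ℂ) (hc : 0 < c.re) (Δ : ℝ) : BoundedContinuousFunction ℝ ℂ :=
  BoundedContinuousFunction.ofNormedAddCommGroup
    (fun y : ℝ => Complex.exp (-(2 * Real.pi * y * Complex.I) * Δ)
      / (c + 2 * Real.pi * y * Complex.I))
    (by
      refine Continuous.div (by fun_prop) (by fun_prop) fun y h => ?_
      have := denom_bounds c y
      rw [h, norm_zero] at this
      linarith) (1 / c.re)
    (fun y => by
      rw [norm_div, norm_unit_exp]
      gcongr
      exact denom_bounds c y)

theorem sym_apply {c : ℂ} (hc : 0 < c.re) (Δ y : ℝ) :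
    sym c hc Δ y = Complex.exp (-(2 * Real.pi * y * Complex.I) * Δ)
      / (c + 2 * Real.pi * y * Complex.I) := rfl

theorem norm_sym_le {c : ℂ} (hc : 0 < c.re) (Δ : ℝ) : ‖sym c hc Δ‖ ≤ 1 / c.re :=
  BoundedContinuousFunction.norm_ofNormedAddCommGroup_le _ (by positivity) _

theorem norm_sym_sub_le {c : ℂ} (hc : 0 < c.re) (hi : c.im = 0) (Δ Δ' : ℝ) :
    ‖sym c hc Δ - sym c hc Δ'‖ ≤ |Δ - Δ'| := by
  rw [BoundedContinuousFunction.norm_le (abs_nonneg _)]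
  intro y
  rw [BoundedContinuousFunction.sub_apply, sym_apply, sym_apply, ← sub_div, norm_div]
  have hd : 0 < ‖c + 2 * Real.pi * y * Complex.I‖ := hc.trans_le (denom_bounds c y)
  rw [div_le_iff₀ hd]
  have h1 : |2 * Real.pi * y| ≤ ‖c + 2 * Real.pi * y * Complex.I‖ := by
    refine le_trans (le_of_eq ?_) (Complex.abs_im_le_norm _)
    simp [hi]
  have h2 : ‖Complex.exp (-(2 * Real.pi * y * Complex.I) * Δ)
      - Complex.exp (-(2 * Real.pi * y * Complex.I) * Δ')‖ ≤ |2 * Real.pi * y| * |Δ - Δ'| := by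
    have h3 : Complex.exp (-(2 * Real.pi * y * Complex.I) * Δ)
      - Complex.exp (-(2 * Real.pi * y * Complex.I) * Δ')
      = Complex.exp (-(2 * Real.pi * y * Complex.I) * Δ')
        * (Complex.exp (Complex.I * ((-(2 * Real.pi * y) * (Δ - Δ') : ℝ) : ℂ)) - 1) := by
      rw [mul_sub, ← Complex.exp_add, mul_one]
      push_cast; ring_nf
    rw [h3, norm_mul, norm_unit_exp, one_mul]
    refine (Real.norm_exp_I_mul_ofReal_sub_one_le).trans (le_of_eq ?_)
    rw [Real.norm_eq_abs, abs_mul, abs_neg]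
  exact h2.trans (by rw [mul_comm]; gcongr)

theorem fourier_expKer_eq_sym {c : ℂ} (hc : 0 < c.re) (Δ y : ℝ) :
    𝓕 (expKer c Δ) y = sym c hc Δ y := fourier_expKer hc Δ y

theorem causal_sym {c : ℂ} (hc : 0 < c.re) {Δ : ℝ} (hΔ : 0 ≤ Δ) : Causal (sym c hc Δ) :=
  causal_of_kernel (integrable_expKer hc Δ) (fun _ hs => expKer_of_lt (hs.trans_le hΔ))
    (fourier_expKer_eq_sym hc Δ)

theorem Causal.smul {m : BoundedContinuousFunction ℝ ℂ} (hm : Causal m) (r : ℂ) :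
    Causal (r • m) := fun a f hf => by
  have : multiplier (r • m) f = r • multiplier m f := by
    apply L2.ext_fourier
    rw [FourierTransform.fourier_smul]
    filter_upwards [fourier_multiplier (r • m) f, fourier_multiplier m f,
      Lp.coeFn_smul r (𝓕 (multiplier m f) : L2)] with x h1 h2 h3
    rw [h1, h3, Pi.smul_apply, h2, BoundedContinuousFunction.smul_apply, smul_eq_mul, smul_eq_mul,
      mul_assoc]
  rw [this]
  filter_upwards [hm a f hf, Lp.coeFn_smul r (multiplier m f)] with x h1 h2 hx
  rw [h2, Pi.smul_apply, h1 hx, smul_zero]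

/-- A symbol bounded away from zero is invertible. -/
theorem exists_inverse_symbol {m : BoundedContinuousFunction ℝ ℂ} {M : ℝ} (hM : 0 ≤ M)
    (h : ∀ y, 1 ≤ M * ‖1 + m y‖) :
    ∃ n : BoundedContinuousFunction ℝ ℂ, (1 + m) * n = 1 ∧ ‖n‖ ≤ M := by
  have hne : ∀ y, 1 + m y ≠ 0 := fun y h0 => by
    have := h y
    rw [h0, norm_zero, mul_zero] at this
    linarith
  have hb : ∀ y, ‖(1 + m y)⁻¹‖ ≤ M := fun y => by
    rw [norm_inv, inv_le_comm₀ (norm_pos_iff.2 (hne y))]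
    · have := h y
      have hMp : 0 < M := by
        rcases hM.lt_or_eq with h1 | h1
        · exact h1
        · rw [← h1, zero_mul] at this; linarith
      rw [inv_le_iff_one_le_mul₀ hMp, mul_comm]; exact this
    · rcases hM.lt_or_eq with h1 | h1
      · exact h1
      · have := h y
        rw [← h1, zero_mul] at this; linarith
  refine ⟨BoundedContinuousFunction.ofNormedAddCommGroup (fun y => (1 + m y)⁻¹)
    (Continuous.inv₀ (by fun_prop) hne) M hb, ?_,
    BoundedContinuousFunction.norm_ofNormedAddCommGroup_le _ hM _⟩
  ext y
  simp [hne y]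

/-- A nonvanishing family of symbols over a compact parameter set, bounded below at high
frequencies, is bounded below uniformly. -/
theorem exists_uniform_lower_bound {K : Set ℝ} (hK : IsCompact K) {F : ℝ → ℝ → ℂ}
    (hF : Continuous (Function.uncurry F)) (hne : ∀ s ∈ K, ∀ y, F s y ≠ 0) {Y : ℝ}
    (hY : ∀ s ∈ K, ∀ y, Y ≤ |y| → 1 / 2 ≤ ‖F s y‖) :
    ∃ M > 0, ∀ s ∈ K, ∀ y, 1 ≤ M * ‖F s y‖ := by
  have hc : IsCompact (K ×ˢ Icc (-Y) Y) := hK.prod isCompact_Icc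
  obtain ⟨M, hM⟩ := hc.exists_bound_of_continuousOn (f := fun p => (Function.uncurry F p)⁻¹)
    (hF.continuousOn.inv₀ fun p hp => hne _ hp.1 _)
  refine ⟨max M 2, by positivity, fun s hs y => ?_⟩
  have hpos : 0 < ‖F s y‖ := norm_pos_iff.2 (hne s hs y)
  rcases le_or_gt Y |y| with h | h
  · have := hY s hs y h
    nlinarith [le_max_right M 2]
  · have := hM (s, y) ⟨hs, (abs_le.1 h.le)⟩
    simp only [Function.uncurry_apply_pair, norm_inv] at this
    rw [inv_le_iff_one_le_mul₀ hpos] at this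
    exact this.trans (by gcongr; exact le_max_left _ _)

/-- The transfer function `a / (z + m₁) + b / (z + m₂)` of two first-order lags in parallel. -/
def transfer (a b m₁ m₂ : ℝ) (z : ℂ) : ℂ := a / (z + m₁) + b / (z + m₂)

/-- The characteristic function of the delayed feedback loop: its zeros are the characteristic
exponents of the linearized system. -/
def charFn (a b m₁ m₂ Δ : ℝ) (z : ℂ) : ℂ := 1 + Complex.exp (-z * Δ) * transfer a b m₁ m₂ z

/-- The impulse response of `transfer`, delayed by `Δ`. -/
def twoKer (a b c₁ c₂ : ℂ) (Δ : ℝ) (t : ℝ) : ℂ := a * expKer c₁ Δ t + b * expKer c₂ Δ t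

/-- The Fourier transform of `twoKer`, as a bounded continuous function of the frequency. -/
def twoSym (a b : ℂ) {c₁ c₂ : ℂ} (h₁ : 0 < c₁.re) (h₂ : 0 < c₂.re) (Δ : ℝ) :
    BoundedContinuousFunction ℝ ℂ := a • sym c₁ h₁ Δ + b • sym c₂ h₂ Δ

theorem integrable_twoKer (a b : ℂ) {c₁ c₂ : ℂ} (h₁ : 0 < c₁.re) (h₂ : 0 < c₂.re) (Δ : ℝ) :
    Integrable (twoKer a b c₁ c₂ Δ) :=
  ((integrable_expKer h₁ Δ).const_mul a).add ((integrable_expKer h₂ Δ).const_mul b)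

theorem fourier_twoKer (a b : ℂ) {c₁ c₂ : ℂ} (h₁ : 0 < c₁.re) (h₂ : 0 < c₂.re) (Δ y : ℝ) :
    𝓕 (twoKer a b c₁ c₂ Δ) y = twoSym a b h₁ h₂ Δ y := by
  have h : twoKer a b c₁ c₂ Δ = a • expKer c₁ Δ + b • expKer c₂ Δ := rfl
  have e := congrFun (VectorFourier.fourierIntegral_add (e := Real.fourierChar) (L := innerₗ ℝ)
    Real.continuous_fourierChar (by fun_prop) ((integrable_expKer h₁ Δ).smul a)
    ((integrable_expKer h₂ Δ).smul b)) y
  rw [VectorFourier.fourierIntegral_const_smul, VectorFourier.fourierIntegral_const_smul] at e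
  rw [h, twoSym, BoundedContinuousFunction.add_apply, BoundedContinuousFunction.smul_apply,
    BoundedContinuousFunction.smul_apply, ← fourier_expKer_eq_sym h₁, ← fourier_expKer_eq_sym h₂]
  exact e

theorem twoSym_apply (a b : ℂ) {c₁ c₂ : ℂ} (h₁ : 0 < c₁.re) (h₂ : 0 < c₂.re) (Δ y : ℝ) :
    twoSym a b h₁ h₂ Δ y = Complex.exp (-(2 * Real.pi * y * Complex.I) * Δ) *
      (a / (c₁ + 2 * Real.pi * y * Complex.I) + b / (c₂ + 2 * Real.pi * y * Complex.I)) := by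
  simp only [twoSym, BoundedContinuousFunction.add_apply, BoundedContinuousFunction.smul_apply,
    sym_apply, smul_eq_mul]
  ring

theorem norm_twoSym_le_half {a b m₁ m₂ : ℝ} (ha : 0 ≤ a) (hb : 0 ≤ b)
    (h₁ : 0 < (m₁ : ℂ).re) (h₂ : 0 < (m₂ : ℂ).re) (Δ : ℝ) {y : ℝ} (hy : 2 * (a + b) + 1 ≤ |y|) :
    ‖twoSym a b h₁ h₂ Δ y‖ ≤ 1 / 2 := by
  rw [twoSym_apply, norm_mul, norm_unit_exp, one_mul]
  have hy0 : 0 < |y| := by linarith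
  have key : ∀ m : ℝ, |y| ≤ ‖(m : ℂ) + 2 * Real.pi * y * Complex.I‖ := fun m => by
    have h := Complex.abs_im_le_norm ((m : ℂ) + 2 * Real.pi * y * Complex.I)
    simp only [Complex.add_im, Complex.ofReal_im, Complex.mul_im, Complex.mul_re, Complex.I_re,
      Complex.I_im, Complex.ofReal_re, Complex.re_ofNat, Complex.im_ofNat] at h
    have h2 : |y| ≤ |2 * Real.pi * y| := by
      rw [abs_mul, abs_of_pos (by positivity : 0 < 2 * Real.pi)]
      nlinarith [Real.pi_gt_three]
    refine h2.trans (le_trans (le_of_eq ?_) h)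
    congr 1; ring
  have e1 : ‖(a : ℂ) / (m₁ + 2 * Real.pi * y * Complex.I)‖ ≤ a / |y| := by
    rw [norm_div, Complex.norm_of_nonneg ha]; gcongr; exact key m₁
  have e2 : ‖(b : ℂ) / (m₂ + 2 * Real.pi * y * Complex.I)‖ ≤ b / |y| := by
    rw [norm_div, Complex.norm_of_nonneg hb]; gcongr; exact key m₂
  refine (norm_add_le _ _).trans ((add_le_add e1 e2).trans ?_)
  rw [← add_div, div_le_iff₀ hy0]
  linarith

theorem half_le_norm_one_add {z : ℂ} (hz : ‖z‖ ≤ 1 / 2) : 1 / 2 ≤ ‖1 + z‖ := by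
  have := norm_sub_norm_le (1 : ℂ) (-z)
  rw [norm_one, norm_neg, sub_neg_eq_add] at this
  linarith

theorem one_add_twoSym (a b : ℝ) {m₁ m₂ : ℝ} (h₁ : 0 < (m₁ : ℂ).re) (h₂ : 0 < (m₂ : ℂ).re)
    (Δ y : ℝ) :
    1 + twoSym a b h₁ h₂ Δ y = charFn a b m₁ m₂ Δ (2 * Real.pi * y * Complex.I) := by
  rw [twoSym_apply, charFn, transfer, add_comm (m₁ : ℂ), add_comm (m₂ : ℂ)]

/-- If no shorter delay has a characteristic exponent on the imaginary axis, the closed loop with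
delay `Δ` has a causal inverse. The path of symbols joins the trivial loop to the given one: for
`s ∈ [-1, 0]` the delay is zero and the gain grows from `0` to `1`, and for `s ∈ [0, Δ]` the gain is
`1` and the delay is `s`. -/
theorem exists_causal_inverse {a b m₁ m₂ Δ : ℝ} (ha : 0 < a) (hb : 0 < b)
    (h₁ : 0 < (m₁ : ℂ).re) (h₂ : 0 < (m₂ : ℂ).re) (hΔ : 0 ≤ Δ)
    (h : ∀ Δ' ∈ Icc 0 Δ, ∀ ω : ℝ, charFn a b m₁ m₂ Δ' (ω * Complex.I) ≠ 0) :
    ∃ n, Causal n ∧ (1 + twoSym a b h₁ h₂ Δ) * n = 1 := by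
  set γ : ℝ → ℝ := fun s => max 0 (min 1 (1 + s)) with hγ
  set δ : ℝ → ℝ := fun s => max 0 s with hδ
  have hγ0 : ∀ s, 0 ≤ γ s := fun s => le_max_left _ _
  have hγ1 : ∀ s, γ s ≤ 1 := fun s => max_le zero_le_one (min_le_left _ _)
  have hδ0 : ∀ s, 0 ≤ δ s := fun s => le_max_left _ _
  have hγl : ∀ s s', |γ s - γ s'| ≤ |s - s'| := fun s s' => by
    refine (abs_max_sub_max_le_max _ _ _ _).trans (max_le (by simp) ?_)
    refine (abs_min_sub_min_le_max _ _ _ _).trans (max_le (by simp) (by simp))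
  have hδl : ∀ s s', |δ s - δ s'| ≤ |s - s'| := fun s s' => by
    refine (abs_max_sub_max_le_max _ _ _ _).trans (max_le (by simp) le_rfl)
  set m : ℝ → BoundedContinuousFunction ℝ ℂ :=
    fun s => (γ s : ℂ) • twoSym a b h₁ h₂ (δ s) with hm
  have hmc : ∀ s, Causal (m s) := fun s =>
    (((causal_sym h₁ (hδ0 s)).smul _).add ((causal_sym h₂ (hδ0 s)).smul _)).smul _
  -- lower bound for the symbol along the path
  obtain ⟨M, hM, hMb⟩ : ∃ M > 0, ∀ s ∈ Icc (-1) Δ, ∀ y, 1 ≤ M * ‖1 + m s y‖ := by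
    refine exists_uniform_lower_bound (K := Icc (-1) Δ) isCompact_Icc (F := fun s y => 1 + m s y)
      (Y := 2 * (a + b) + 1) ?_ ?_ ?_
    · have hden : ∀ (c : ℝ), 0 < (c : ℂ).re → ∀ y : ℝ,
          (c : ℂ) + 2 * Real.pi * y * Complex.I ≠ 0 := fun c hc y h0 => by
        have := denom_bounds c y
        rw [h0, norm_zero] at this
        linarith
      simp only [hm, BoundedContinuousFunction.smul_apply, twoSym_apply, Function.uncurry_def, hγ,
        hδ, smul_eq_mul]
      refine continuous_const.add (Continuous.mul (by fun_prop) (Continuous.mul (by fun_prop)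
        (Continuous.add (Continuous.div (by fun_prop) (by fun_prop) fun p => hden _ h₁ _)
          (Continuous.div (by fun_prop) (by fun_prop) fun p => hden _ h₂ _))))
    · intro s hs y
      rcases le_or_gt s 0 with h0 | h0
      · -- without delay the transfer function has positive real part
        have hδs : δ s = 0 := max_eq_left h0
        intro hz
        have hre := congrArg Complex.re hz
        have hpos : ∀ (r c : ℝ), 0 < r → 0 < (c : ℂ).re →
            0 ≤ ((r : ℂ) / (c + 2 * Real.pi * y * Complex.I)).re := fun r c hr hc => by
          rw [Complex.div_re]
          have : 0 ≤ c := by simpa using hc.le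
          simp only [Complex.ofReal_re, Complex.ofReal_im, zero_mul, zero_div, add_zero]
          refine div_nonneg (mul_nonneg hr.le ?_) (Complex.normSq_nonneg _)
          simpa using this
        simp only [hm, BoundedContinuousFunction.smul_apply, twoSym_apply, hδs, smul_eq_mul,
          Complex.ofReal_zero, mul_zero, Complex.exp_zero, one_mul, Complex.add_re,
          Complex.one_re, Complex.re_ofReal_mul, Complex.zero_re] at hre
        have := mul_nonneg (hγ0 s) (add_nonneg (hpos a m₁ ha h₁) (hpos b m₂ hb h₂))
        linarith
      · have hγs : γ s = 1 := by
          simp only [hγ]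
          rw [min_eq_left (by linarith), max_eq_right zero_le_one]
        have hδs : δ s = s := max_eq_right h0.le
        simp only [hm, hγs, hδs, Complex.ofReal_one, one_smul]
        rw [one_add_twoSym]
        have := h s ⟨h0.le, hs.2⟩ (2 * Real.pi * y)
        push_cast at this
        exact this
    · intro s _ y hy
      refine half_le_norm_one_add ?_
      simp only [hm, BoundedContinuousFunction.smul_apply, norm_smul]
      rw [Complex.norm_of_nonneg (hγ0 s)]
      exact (mul_le_of_le_one_left (norm_nonneg _) (hγ1 s)).trans
        (norm_twoSym_le_half ha.le hb.le h₁ h₂ _ hy)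
  have hex : ∀ s, ∃ n : BoundedContinuousFunction ℝ ℂ, s ∈ Icc (-1) Δ →
      (1 + m s) * n = 1 ∧ ‖n‖ ≤ M := fun s => by
    by_cases hs : s ∈ Icc (-1) Δ
    · obtain ⟨n, hn⟩ := exists_inverse_symbol hM.le (hMb s hs)
      exact ⟨n, fun _ => hn⟩
    · exact ⟨0, fun h' => absurd h' hs⟩
  choose n hn using hex
  -- the symbols depend on the path parameter in a Lipschitz way
  set C := a * (1 / (m₁ : ℂ).re) + b * (1 / (m₂ : ℂ).re) + (a + b) with hC
  have hCpos : 0 < C := by positivity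
  have hlip : ∀ s s', ‖m s - m s'‖ ≤ C * |s - s'| := fun s s' => by
    have e1 : m s - m s' = ((γ s - γ s' : ℝ) : ℂ) • twoSym a b h₁ h₂ (δ s)
        + (γ s' : ℂ) • ((a : ℂ) • (sym _ h₁ (δ s) - sym _ h₁ (δ s'))
          + (b : ℂ) • (sym _ h₂ (δ s) - sym _ h₂ (δ s'))) := by
      simp only [hm, twoSym]
      push_cast
      module
    have e2 : ‖twoSym a b h₁ h₂ (δ s)‖ ≤ a * (1 / (m₁ : ℂ).re) + b * (1 / (m₂ : ℂ).re) := by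
      refine (norm_add_le _ _).trans ?_
      rw [norm_smul, norm_smul, Complex.norm_of_nonneg ha.le, Complex.norm_of_nonneg hb.le]
      gcongr
      · exact norm_sym_le h₁ _
      · exact norm_sym_le h₂ _
    have e3 : ‖(a : ℂ) • (sym _ h₁ (δ s) - sym _ h₁ (δ s'))
          + (b : ℂ) • (sym _ h₂ (δ s) - sym _ h₂ (δ s'))‖ ≤ (a + b) * |s - s'| := by
      refine (norm_add_le _ _).trans ?_
      rw [norm_smul, norm_smul, Complex.norm_of_nonneg ha.le, Complex.norm_of_nonneg hb.le, add_mul]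
      gcongr
      · exact (norm_sym_sub_le h₁ (by simp) _ _).trans (hδl s s')
      · exact (norm_sym_sub_le h₂ (by simp) _ _).trans (hδl s s')
    rw [e1, hC, add_mul]
    refine (norm_add_le _ _).trans ?_
    rw [norm_smul, norm_smul, Complex.norm_of_nonneg (hγ0 s'), Complex.norm_real,
      Real.norm_eq_abs, mul_comm |γ s - γ s'|]
    refine add_le_add ?_ ?_
    · exact mul_le_mul e2 (hγl s s') (abs_nonneg _) ((norm_nonneg _).trans e2)
    · exact (mul_le_of_le_one_left (norm_nonneg _) (hγ1 s')).trans e3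
  have hΔ1 : (-1 : ℝ) ≤ Δ := by linarith
  have hfin := causal_inverse_of_path (m := fun s => 1 + m s) (n := n) (a := -1) (b := Δ)
    (δ := 1 / (2 * C * M)) (by positivity) hΔ1 (fun s => causal_one.add (hmc s))
    (fun s hs => (hn s hs).1) ?_ ?_
  · refine ⟨n Δ, hfin, ?_⟩
    have := (hn Δ ⟨hΔ1, le_rfl⟩).1
    have hγs : γ Δ = 1 := by
      simp only [hγ]
      rw [min_eq_left (by linarith), max_eq_right zero_le_one]
    have hδs : δ Δ = Δ := max_eq_right hΔ
    simpa only [hm, hγs, hδs, Complex.ofReal_one, one_smul] using this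
  · intro s hs s' hs' hss
    rw [add_sub_add_left_eq_sub]
    calc ‖m s - m s'‖ * ‖n s‖ ≤ (C * (1 / (2 * C * M))) * M := by
          gcongr
          · exact (hlip s s').trans (by gcongr)
          · exact (hn s hs).2
      _ = 1 / 2 := by field_simp
      _ < 1 := by norm_num
  · have h1 : m (-1) = 0 := by simp [hm, hγ]
    have := (hn (-1) ⟨le_rfl, hΔ1⟩).1
    rw [h1, add_zero, one_mul] at this
    rw [this]
    exact causal_one

/-! ### Convolution with exponential kernels -/

theorem integrable_conv_integrand {κ w : ℝ → ℂ} (hκ : Integrable κ)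
    (hw : AEStronglyMeasurable w) {C : ℝ} (hC : ∀ s, ‖w s‖ ≤ C) (t : ℝ) :
    Integrable fun s => κ s * w (t - s) :=
  hκ.mul_bdd (hw.comp_quasiMeasurePreserving (quasiMeasurePreserving_sub_left volume t))
    (Eventually.of_forall fun s => hC (t - s))

theorem conv_add_right {κ w w' : ℝ → ℂ} (hκ : Integrable κ) (hw : AEStronglyMeasurable w)
    {C : ℝ} (hC : ∀ s, ‖w s‖ ≤ C) (hw' : AEStronglyMeasurable w') {C' : ℝ}
    (hC' : ∀ s, ‖w' s‖ ≤ C') (t : ℝ) : conv κ (w + w') t = conv κ w t + conv κ w' t := by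
  simp only [conv_apply, Pi.add_apply, mul_add]
  exact integral_add (integrable_conv_integrand hκ hw hC t)
    (integrable_conv_integrand hκ hw' hC' t)

theorem conv_const_mul_right (κ w : ℝ → ℂ) (c : ℂ) (t : ℝ) :
    conv κ (fun s => c * w s) t = c * conv κ w t := by
  simp only [conv_apply]
  rw [← integral_const_mul]
  congr 1; ext s; ring

theorem conv_twoKer {a b c₁ c₂ : ℂ} (h₁ : 0 < c₁.re) (h₂ : 0 < c₂.re) (Δ : ℝ) {w : ℝ → ℂ}
    (hw : AEStronglyMeasurable w) {C : ℝ} (hC : ∀ s, ‖w s‖ ≤ C) (t : ℝ) :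
    conv (twoKer a b c₁ c₂ Δ) w t = a * conv (expKer c₁ Δ) w t + b * conv (expKer c₂ Δ) w t := by
  simp only [conv_apply, twoKer, add_mul, mul_assoc]
  rw [integral_add, integral_const_mul, integral_const_mul]
  · exact (integrable_conv_integrand (integrable_expKer h₁ Δ) hw hC t).const_mul a
  · exact (integrable_conv_integrand (integrable_expKer h₂ Δ) hw hC t).const_mul b

theorem weight_mul_conv (z : ℂ) (κ w : ℝ → ℂ) (t : ℝ) :
    Complex.exp (-z * t) * conv κ w t
      = conv (fun s => Complex.exp (-z * s) * κ s) (fun s => Complex.exp (-z * s) * w s) t := by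
  simp only [conv_apply]
  rw [← integral_const_mul]
  congr 1; ext s
  have : Complex.exp (-z * t) = Complex.exp (-z * s) * Complex.exp (-z * (t - s : ℝ)) := by
    rw [← Complex.exp_add]; push_cast; ring_nf
  rw [this]; ring

theorem weight_mul_twoKer (z a b c₁ c₂ : ℂ) (Δ : ℝ) :
    (fun t : ℝ => Complex.exp (-z * t) * twoKer a b c₁ c₂ Δ t)
      = twoKer (Complex.exp (-z * Δ) * a) (Complex.exp (-z * Δ) * b) (c₁ + z) (c₂ + z) Δ := by
  ext t
  rw [twoKer, twoKer, mul_add, mul_left_comm, weight_mul_expKer, mul_left_comm _ b,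
    weight_mul_expKer]
  ring

theorem integral_conv {κ w : ℝ → ℂ} (hκ : Integrable κ) (hw : Integrable w) :
    ∫ t, conv κ w t = (∫ t, κ t) * ∫ t, w t :=
  integral_convolution (ContinuousLinearMap.mul ℂ ℂ) hκ hw

theorem integral_twoKer (a b : ℂ) {c₁ c₂ : ℂ} (h₁ : 0 < c₁.re) (h₂ : 0 < c₂.re) (Δ : ℝ) :
    ∫ t, twoKer a b c₁ c₂ Δ t = a / c₁ + b / c₂ := by
  simp only [twoKer]
  rw [integral_add ((integrable_expKer h₁ Δ).const_mul a) ((integrable_expKer h₂ Δ).const_mul b),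
    integral_const_mul, integral_const_mul, integral_expKer h₁, integral_expKer h₂]
  ring

/-- Variation of constants for `x' = l φ(t - Δ) - m x`, with the integral written as a convolution
over the whole line. Only the values of the forcing on `[-Δ, t - Δ]` enter. -/
theorem variation_of_constants {x φ : ℝ → ℝ} {l m Δ t : ℝ} (ht : 0 ≤ t)
    (hx : ∀ s, 0 ≤ s → HasDerivWithinAt x (l * φ (s - Δ) - m * x s) (Ici 0) s)
    (hφ : ContinuousOn φ (Ici (-Δ))) {W : ℝ → ℂ}
    (hW : ∀ s ∈ Icc (-Δ) (t - Δ), W s = φ s) (hW0 : ∀ s < -Δ, W s = 0) :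
    (x t : ℂ) = x 0 * expKer m 0 t + l * conv (expKer m Δ) W t := by
  have hftc : ∫ s in (0:ℝ)..t, Real.exp (m * s) * (l * φ (s - Δ))
      = Real.exp (m * t) * x t - Real.exp (m * 0) * x 0 := by
    refine intervalIntegral.integral_eq_sub_of_hasDeriv_right_of_le ht
      (f := fun s => Real.exp (m * s) * x s) ?_ ?_ ?_
    · refine ContinuousOn.mul (by fun_prop) fun s hs => ?_
      exact ((hx s hs.1).continuousWithinAt).mono Icc_subset_Ici_self
    · intro s hs
      have h1 : HasDerivAt (fun s => Real.exp (m * s)) (Real.exp (m * s) * m) s := by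
        simpa using ((hasDerivAt_id s).const_mul m).exp
      have h2 := h1.hasDerivWithinAt.mul
        ((hx s hs.1.le).mono (Ioi_subset_Ici_self.trans (Ici_subset_Ici.2 hs.1.le) :
          Ioi s ⊆ Ici (0:ℝ)))
      convert! h2 using 1
      ring
    · refine ContinuousOn.intervalIntegrable_of_Icc ht ?_
      refine ContinuousOn.mul (by fun_prop) (continuousOn_const.mul ?_)
      exact hφ.comp (by fun_prop) fun s hs => by simp only [mem_Ici]; linarith [hs.1]
  have hconv : conv (expKer m Δ) W t
      = ((∫ s in (0:ℝ)..t, Real.exp (-m * (t - s)) * φ (s - Δ) : ℝ) : ℂ) := by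
    rw [conv_apply']
    -- the integrand is supported on `[-Δ, t - Δ]`, where `W` equals the forcing
    have h1 : (fun s => expKer m Δ (t - s) * W s) = (Icc (-Δ) (t - Δ)).indicator
        (fun s => ((Real.exp (-m * (t - (s + Δ))) * φ (s + Δ - Δ) : ℝ) : ℂ)) := by
      ext s
      by_cases hs : s ∈ Icc (-Δ) (t - Δ)
      · rw [indicator_of_mem hs, hW s hs, expKer_of_le (by linarith [hs.2])]
        push_cast
        rw [add_sub_cancel_right]
        congr 2; ring
      · rw [indicator_of_notMem hs]
        rcases lt_or_ge s (-Δ) with h | h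
        · rw [hW0 s h, mul_zero]
        · rw [expKer_of_lt, zero_mul]
          by_contra h'
          exact hs ⟨h, by linarith⟩
    rw [h1, integral_indicator measurableSet_Icc, integral_Icc_eq_integral_Ioc,
      ← intervalIntegral.integral_of_le (by linarith), intervalIntegral.integral_ofReal,
      intervalIntegral.integral_comp_add_right
        (fun s => Real.exp (-m * (t - s)) * φ (s - Δ)) Δ]
    simp
  have hsplit : ∫ s in (0:ℝ)..t, Real.exp (-m * (t - s)) * φ (s - Δ)
      = Real.exp (-m * t) * ∫ s in (0:ℝ)..t, Real.exp (m * s) * φ (s - Δ) := by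
    rw [← intervalIntegral.integral_const_mul]
    congr 1; ext s
    rw [← mul_assoc, ← Real.exp_add]; ring_nf
  have hl : ∫ s in (0:ℝ)..t, Real.exp (m * s) * (l * φ (s - Δ))
      = l * ∫ s in (0:ℝ)..t, Real.exp (m * s) * φ (s - Δ) := by
    rw [← intervalIntegral.integral_const_mul]
    congr 1; ext s; ring
  have hreal : x t = x 0 * Real.exp (-m * t)
      + l * ∫ s in (0:ℝ)..t, Real.exp (-m * (t - s)) * φ (s - Δ) := by
    rw [hsplit, mul_left_comm, ← hl, hftc, mul_sub, ← mul_assoc, ← Real.exp_add]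
    simp
    ring
  rw [hconv, expKer_of_le ht, hreal]
  push_cast
  simp

/-- Pointwise bound for a convolution with an exponential kernel, from the inequality
`‖w‖ ≤ r + ‖w‖² / r`. The parameter `r` stays free, to match the size of the data. -/
theorem norm_conv_expKer_le {m : ℝ} (hm : 0 < m) (Δ : ℝ) {w : ℝ → ℂ} (hw2 : MemLp w 2)
    {C : ℝ} (hC : ∀ s, ‖w s‖ ≤ C) {r : ℝ} (hr : 0 < r) (t : ℝ) :
    ‖conv (expKer m Δ) w t‖ ≤ r / m + (∫ s, ‖expKer m Δ (t - s)‖ * ‖w s‖ ^ 2) / r := by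
  have hm' : 0 < (m : ℂ).re := by simpa
  have hκ := ((integrable_expKer hm' Δ).comp_sub_left t).norm
  have hJ : Integrable fun s => ‖expKer m Δ (t - s)‖ * ‖w s‖ ^ 2 := by
    refine hκ.mul_bdd (c := C ^ 2) (hw2.1.norm.pow 2) (Eventually.of_forall fun s => ?_)
    rw [Real.norm_of_nonneg (by positivity)]
    gcongr; exact hC s
  have hint : ∫ s, ‖expKer m Δ (t - s)‖ = 1 / m := by
    rw [integral_sub_left_eq_self (fun s => ‖expKer m Δ s‖)]
    have h1 : ∀ s, ((‖expKer m Δ s‖ : ℝ) : ℂ) = expKer m Δ s := fun s => by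
      rcases le_or_gt Δ s with h | h
      · rw [norm_expKer_of_le h, expKer_of_le h]; push_cast; simp
      · simp [expKer_of_lt h]
    have h2 := (integral_congr_ae (μ := volume) (Eventually.of_forall h1)).trans
      (integral_expKer hm' Δ)
    rw [integral_complex_ofReal] at h2
    exact_mod_cast h2
  rw [conv_apply']
  refine (norm_integral_le_integral_norm _).trans ?_
  calc ∫ s, ‖expKer m Δ (t - s) * w s‖
      ≤ ∫ s, (r * ‖expKer m Δ (t - s)‖ + (‖expKer m Δ (t - s)‖ * ‖w s‖ ^ 2) / r) := by
        refine integral_mono_of_nonneg (Eventually.of_forall fun s => norm_nonneg _)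
          ((hκ.const_mul r).add (hJ.div_const r)) (Eventually.of_forall fun s => ?_)
        simp only [norm_mul]
        have : ‖w s‖ ≤ r + ‖w s‖ ^ 2 / r := by
          rw [← sub_nonneg]
          have : r + ‖w s‖ ^ 2 / r - ‖w s‖ = (r ^ 2 + ‖w s‖ ^ 2 - ‖w s‖ * r) / r := by
            field_simp
          rw [this]
          refine div_nonneg ?_ hr.le
          nlinarith [sq_nonneg (r - ‖w s‖), mul_nonneg hr.le (norm_nonneg (w s))]
        calc _ ≤ ‖expKer m Δ (t - s)‖ * (r + ‖w s‖ ^ 2 / r) := by gcongr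
          _ = _ := by ring
    _ = _ := by
        rw [integral_add (hκ.const_mul r) (hJ.div_const r), integral_const_mul, hint,
          integral_div]
        ring

theorem integral_expKer_sq_le {m : ℝ} (hm : 0 < m) (Δ : ℝ) {w : ℝ → ℂ} (hw2 : MemLp w 2) (t : ℝ) :
    ∫ s, ‖expKer m Δ (t - s)‖ * ‖w s‖ ^ 2 ≤ ∫ s, ‖w s‖ ^ 2 := by
  have hm' : 0 < (m : ℂ).re := by simpa
  refine integral_mono_of_nonneg (Eventually.of_forall fun s => by positivity)
    ((memLp_two_iff_integrable_sq_norm hw2.1).1 hw2) (Eventually.of_forall fun s => ?_)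
  exact mul_le_of_le_one_left (by positivity) (norm_expKer_le_one hm' Δ _)

/-- An exponentially stable filter driven by a bounded square integrable input decays. -/
theorem tendsto_conv_expKer {m : ℝ} (hm : 0 < m) (Δ : ℝ) {w : ℝ → ℂ} (hw2 : MemLp w 2)
    {C : ℝ} (hC : ∀ s, ‖w s‖ ≤ C) : Tendsto (conv (expKer m Δ) w) atTop (𝓝 0) := by
  have hm' : 0 < (m : ℂ).re := by simpa
  have hw := (memLp_two_iff_integrable_sq_norm hw2.1).1 hw2
  have hJ : Tendsto (fun t => ∫ s, ‖expKer m Δ (t - s)‖ * ‖w s‖ ^ 2) atTop (𝓝 0) := by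
    have : Tendsto (fun t => ∫ s, ‖expKer m Δ (t - s)‖ * ‖w s‖ ^ 2) atTop
        (𝓝 (∫ _ : ℝ, (0:ℝ))) := by
      refine tendsto_integral_filter_of_dominated_convergence (fun s => ‖w s‖ ^ 2)
        (Eventually.of_forall fun t => ?_) (Eventually.of_forall fun t =>
          Eventually.of_forall fun s => ?_) hw (Eventually.of_forall fun s => ?_)
      · exact (((measurable_expKer m Δ).comp (by fun_prop)).norm.aestronglyMeasurable).mul
          (hw2.1.norm.pow 2)
      · rw [Real.norm_of_nonneg (by positivity)]
        exact mul_le_of_le_one_left (by positivity) (norm_expKer_le_one hm' Δ _)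
      · rw [← zero_mul (‖w s‖ ^ 2)]
        refine Tendsto.mul_const _ ?_
        have h1 : Tendsto (fun t : ℝ => Real.exp (-m * (t - s - Δ))) atTop (𝓝 0) := by
          refine Real.tendsto_exp_atBot.comp ?_
          refine Tendsto.const_mul_atTop_of_neg (by linarith) ?_
          exact tendsto_atTop_add_const_right _ _ (tendsto_atTop_add_const_right _ _ tendsto_id)
        refine h1.congr' ?_
        filter_upwards [eventually_ge_atTop (s + Δ)] with t ht
        rw [norm_expKer_of_le (by linarith)]
        simp
    simpa using this
  rw [tendsto_zero_iff_norm_tendsto_zero, Metric.tendsto_nhds]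
  intro ε hε
  have hr : 0 < ε * m / 4 := by positivity
  have := hJ.eventually (gt_mem_nhds (show (0:ℝ) < ε / 2 * (ε * m / 4) by positivity))
  filter_upwards [this] with t ht
  rw [Real.dist_0_eq_abs, abs_of_nonneg (norm_nonneg _)]
  refine (norm_conv_expKer_le hm Δ hw2 hC hr t).trans_lt ?_
  have h1 : ε * m / 4 / m = ε / 4 := by field_simp
  have h2 : (∫ s, ‖expKer m Δ (t - s)‖ * ‖w s‖ ^ 2) / (ε * m / 4) < ε / 2 := by
    rw [div_lt_iff₀ hr]; exact ht
  linarith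

/-! ### `L²` norms and restrictions -/

/-- The `L²` norm, as a real number; it is meaningful for `MemLp f 2`. -/
def l2 (f : ℝ → ℂ) : ℝ := (eLpNorm f 2 volume).toReal

theorem l2_nonneg (f : ℝ → ℂ) : 0 ≤ l2 f := ENNReal.toReal_nonneg

theorem l2_add_le {f g : ℝ → ℂ} (hf : MemLp f 2) (hg : MemLp g 2) : l2 (f + g) ≤ l2 f + l2 g := by
  rw [l2, l2, l2, ← ENNReal.toReal_add hf.2.ne hg.2.ne]
  exact ENNReal.toReal_mono (ENNReal.add_ne_top.2 ⟨hf.2.ne, hg.2.ne⟩)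
    (eLpNorm_add_le hf.1 hg.1 (by norm_num))

theorem l2_sub_le {f g : ℝ → ℂ} (hf : MemLp f 2) (hg : MemLp g 2) : l2 (f - g) ≤ l2 f + l2 g := by
  rw [l2, l2, l2, ← ENNReal.toReal_add hf.2.ne hg.2.ne]
  exact ENNReal.toReal_mono (ENNReal.add_ne_top.2 ⟨hf.2.ne, hg.2.ne⟩)
    (eLpNorm_sub_le hf.1 hg.1 (by norm_num))

theorem l2_le_mul {f g : ℝ → ℂ} (hg : MemLp g 2) {c : ℝ} (hc : 0 ≤ c)
    (h : ∀ t, ‖f t‖ ≤ c * ‖g t‖) : l2 f ≤ c * l2 g := by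
  have := eLpNorm_le_mul_eLpNorm_of_ae_le_mul (p := 2) (μ := volume) (Eventually.of_forall h)
  have h2 := ENNReal.toReal_mono (ENNReal.mul_ne_top ENNReal.ofReal_ne_top hg.2.ne) this
  rwa [ENNReal.toReal_mul, ENNReal.toReal_ofReal hc] at h2

theorem l2_mono {f g : ℝ → ℂ} (hg : MemLp g 2) (h : ∀ t, ‖f t‖ ≤ ‖g t‖) : l2 f ≤ l2 g := by
  simpa using l2_le_mul hg zero_le_one (by simpa using h)

theorem l2_sq {f : ℝ → ℂ} (hf : MemLp f 2) : l2 f ^ 2 = ∫ t, ‖f t‖ ^ 2 := by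
  have hnn : 0 ≤ ∫ t, ‖f t‖ ^ 2 := integral_nonneg fun t => by positivity
  rw [l2, hf.eLpNorm_eq_integral_rpow_norm (by norm_num) (by norm_num)]
  simp only [ENNReal.toReal_ofNat, Real.rpow_ofNat]
  rw [ENNReal.toReal_ofReal (Real.rpow_nonneg hnn _), ← Real.rpow_natCast, ← Real.rpow_mul hnn]
  norm_num

/-- The restriction of a real function to a set, extended by zero and viewed as complex. -/
def restr (s : Set ℝ) (f : ℝ → ℝ) : ℝ → ℂ := s.indicator fun t => (f t : ℂ)

theorem restr_of_mem {s : Set ℝ} {t : ℝ} (f : ℝ → ℝ) (h : t ∈ s) : restr s f t = f t :=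
  indicator_of_mem h _

theorem restr_of_notMem {s : Set ℝ} {t : ℝ} (f : ℝ → ℝ) (h : t ∉ s) : restr s f t = 0 :=
  indicator_of_notMem h _

theorem norm_restr_le {s : Set ℝ} {f : ℝ → ℝ} {C : ℝ} (hC : 0 ≤ C) (h : ∀ t ∈ s, |f t| ≤ C)
    (t : ℝ) : ‖restr s f t‖ ≤ C := by
  by_cases ht : t ∈ s
  · rw [restr_of_mem f ht, Complex.norm_real]; exact h t ht
  · rw [restr_of_notMem f ht, norm_zero]; exact hC

theorem aestronglyMeasurable_restr {s : Set ℝ} (hs : MeasurableSet s) {f : ℝ → ℝ}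
    (hf : ContinuousOn f s) : AEStronglyMeasurable (restr s f) := by
  rw [restr, aestronglyMeasurable_indicator_iff hs]
  exact (Complex.continuous_ofReal.comp_continuousOn hf).aestronglyMeasurable hs

theorem integrable_restr_Ico {a b : ℝ} {f : ℝ → ℝ} (hf : ContinuousOn f (Icc a b)) :
    Integrable (restr (Ico a b) f) := by
  rw [restr, integrable_indicator_iff measurableSet_Ico]
  exact ((Complex.continuous_ofReal.comp_continuousOn hf).integrableOn_Icc).mono_set
    Ico_subset_Icc_self

theorem exists_bound_restr_Ico {a b : ℝ} {f : ℝ → ℝ} (hf : ContinuousOn f (Icc a b)) :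
    ∃ C, ∀ t, ‖restr (Ico a b) f t‖ ≤ C := by
  obtain ⟨C, hC⟩ := isCompact_Icc.exists_bound_of_continuousOn hf
  refine ⟨max C 0, norm_restr_le (le_max_right _ _) fun t ht => ?_⟩
  exact (hC t (Ico_subset_Icc_self ht)).trans (le_max_left _ _)

theorem memLp_restr_Ico {a b : ℝ} {f : ℝ → ℝ} (hf : ContinuousOn f (Icc a b)) :
    MemLp (restr (Ico a b) f) 2 := by
  obtain ⟨C, hC⟩ := exists_bound_restr_Ico hf
  exact memLp_of_integrable_of_bound (integrable_restr_Ico hf) hC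

theorem l2_restr_Ico_le {a b : ℝ} (hab : a ≤ b) {f : ℝ → ℝ} (hf : ContinuousOn f (Icc a b))
    {C : ℝ} (hC : 0 ≤ C) (h : ∀ t ∈ Ico a b, |f t| ≤ C) :
    l2 (restr (Ico a b) f) ≤ C * √(b - a) := by
  refine abs_le_of_sq_le_sq' ?_ (by positivity) |>.2
  rw [l2_sq (memLp_restr_Ico hf), mul_pow, Real.sq_sqrt (by linarith)]
  have h1 : (fun t => ‖restr (Ico a b) f t‖ ^ 2) ≤ (Ico a b).indicator fun _ => C ^ 2 := fun t => by
    by_cases ht : t ∈ Ico a b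
    · rw [indicator_of_mem ht]
      have := norm_restr_le hC h t
      simp only; gcongr
    · rw [indicator_of_notMem ht]; simp [restr_of_notMem f ht]
  refine (integral_mono_of_nonneg (Eventually.of_forall fun t => by positivity) ?_
    (Eventually.of_forall h1)).trans (le_of_eq ?_)
  · rw [integrable_indicator_iff measurableSet_Ico]
    exact integrableOn_const (by simp)
  · rw [integral_indicator measurableSet_Ico, setIntegral_const]
    simp [hab, mul_comm]

/-! ### Delayed feedback loops -/

/-- Two first-order lags with rates `m₁`, `m₂` and inputs of opposite sign, driven by a scalar
nonlinearity `g` of the delayed output `-θ₁ x₁ + θ₂ x₂`. The nonlinearity is bounded by the identity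
and has linear part `k v` at zero with quadratic remainder. -/
structure Loop where
  l₁ : ℝ
  l₂ : ℝ
  m₁ : ℝ
  m₂ : ℝ
  θ₁ : ℝ
  θ₂ : ℝ
  k : ℝ
  G : ℝ
  g : ℝ → ℝ
  l₁_pos : 0 < l₁
  l₂_pos : 0 < l₂
  m₁_pos : 0 < m₁
  m₂_pos : 0 < m₂
  θ₁_pos : 0 < θ₁
  θ₂_pos : 0 < θ₂
  k_pos : 0 < k
  G_pos : 0 < G
  g_cont : Continuous g
  g_quad : ∀ v, |g v - k * v| ≤ G * v ^ 2
  g_lip : ∀ v, |g v| ≤ |v|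

namespace Loop

variable (S : Loop)

/-- The scalar output that is fed back. -/
def out (x₁ x₂ : ℝ → ℝ) (t : ℝ) : ℝ := -S.θ₁ * x₁ t + S.θ₂ * x₂ t

/-- `(x₁, x₂)` is continuous on `[-Δ, ∞)` and solves the loop equations on `[0, ∞)`; at time `0` the
derivative is one-sided. -/
structure IsTrajectory (Δ : ℝ) (x₁ x₂ : ℝ → ℝ) : Prop where
  cont₁ : ContinuousOn x₁ (Ici (-Δ))
  cont₂ : ContinuousOn x₂ (Ici (-Δ))
  deriv₁ : ∀ t, 0 ≤ t →
    HasDerivWithinAt x₁ (S.l₁ * S.g (S.out x₁ x₂ (t - Δ)) - S.m₁ * x₁ t) (Ici 0) t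
  deriv₂ : ∀ t, 0 ≤ t →
    HasDerivWithinAt x₂ (-S.l₂ * S.g (S.out x₁ x₂ (t - Δ)) - S.m₂ * x₂ t) (Ici 0) t

/-- The residue of the linearized loop at the first lag. -/
def a : ℝ := S.k * S.θ₁ * S.l₁

/-- The residue of the linearized loop at the second lag. -/
def b : ℝ := S.k * S.θ₂ * S.l₂

theorem a_pos : 0 < S.a := mul_pos (mul_pos S.k_pos S.θ₁_pos) S.l₁_pos

theorem b_pos : 0 < S.b := mul_pos (mul_pos S.k_pos S.θ₂_pos) S.l₂_pos

theorem m₁_re : 0 < (S.m₁ : ℂ).re := by simpa using S.m₁_pos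

theorem m₂_re : 0 < (S.m₂ : ℂ).re := by simpa using S.m₂_pos

variable {S} {Δ : ℝ} {x₁ x₂ : ℝ → ℝ}

theorem IsTrajectory.cont_out (h : S.IsTrajectory Δ x₁ x₂) :
    ContinuousOn (S.out x₁ x₂) (Ici (-Δ)) :=
  (continuousOn_const.mul h.cont₁).add (continuousOn_const.mul h.cont₂)

theorem IsTrajectory.cont_g (h : S.IsTrajectory Δ x₁ x₂) :
    ContinuousOn (fun t => S.g (S.out x₁ x₂ t)) (Ici (-Δ)) :=
  S.g_cont.comp_continuousOn h.cont_out

theorem abs_out_le {t δ : ℝ} (h₁ : |x₁ t| ≤ δ) (h₂ : |x₂ t| ≤ δ) :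
    |S.out x₁ x₂ t| ≤ (S.θ₁ + S.θ₂) * δ := by
  rw [out, add_mul]
  refine (abs_add_le _ _).trans ?_
  rw [abs_mul, abs_mul, abs_neg, abs_of_pos S.θ₁_pos, abs_of_pos S.θ₂_pos]
  have := S.θ₁_pos; have := S.θ₂_pos
  gcongr

/-- The first state as a filtered version of any `W` that agrees with the nonlinearity on the
relevant past. -/
theorem IsTrajectory.repr₁ (h : S.IsTrajectory Δ x₁ x₂) {t : ℝ} (ht : 0 ≤ t) {W : ℝ → ℂ}
    (hW : ∀ s ∈ Icc (-Δ) (t - Δ), W s = S.g (S.out x₁ x₂ s)) (hW0 : ∀ s < -Δ, W s = 0) :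
    (x₁ t : ℂ) = x₁ 0 * expKer S.m₁ 0 t + S.l₁ * conv (expKer S.m₁ Δ) W t :=
  variation_of_constants ht h.deriv₁ h.cont_g hW hW0

theorem IsTrajectory.repr₂ (h : S.IsTrajectory Δ x₁ x₂) {t : ℝ} (ht : 0 ≤ t) {W : ℝ → ℂ}
    (hW : ∀ s ∈ Icc (-Δ) (t - Δ), W s = S.g (S.out x₁ x₂ s)) (hW0 : ∀ s < -Δ, W s = 0) :
    (x₂ t : ℂ) = x₂ 0 * expKer S.m₂ 0 t - S.l₂ * conv (expKer S.m₂ Δ) W t := by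
  have := variation_of_constants ht h.deriv₂ h.cont_g hW hW0
  rw [this]; push_cast; ring

variable (S) in
/-- The output of the uncontrolled system with the same initial state, zero before time `0`. -/
def free (x₁ x₂ : ℝ → ℝ) : ℝ → ℂ :=
  twoKer (-S.θ₁ * x₁ 0 : ℝ) (S.θ₂ * x₂ 0 : ℝ) S.m₁ S.m₂ 0

variable (S) in
/-- The delayed impulse response of the linearized loop. -/
def ker (Δ : ℝ) : ℝ → ℂ := twoKer S.a S.b S.m₁ S.m₂ Δ

theorem IsTrajectory.repr_out (h : S.IsTrajectory Δ x₁ x₂) {t : ℝ} (ht : 0 ≤ t) {W : ℝ → ℂ}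
    (hWm : AEStronglyMeasurable W) {C : ℝ} (hWb : ∀ s, ‖W s‖ ≤ C)
    (hW : ∀ s ∈ Icc (-Δ) (t - Δ), S.k * W s = S.g (S.out x₁ x₂ s)) (hW0 : ∀ s < -Δ, W s = 0) :
    (S.out x₁ x₂ t : ℂ) = S.free x₁ x₂ t - conv (S.ker Δ) W t := by
  have h1 := h.repr₁ ht (W := fun s => S.k * W s) hW fun s hs => by rw [hW0 s hs, mul_zero]
  have h2 := h.repr₂ ht (W := fun s => S.k * W s) hW fun s hs => by rw [hW0 s hs, mul_zero]
  rw [conv_const_mul_right] at h1 h2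
  rw [ker, conv_twoKer S.m₁_re S.m₂_re Δ hWm hWb, free, twoKer, out]
  push_cast
  rw [h1, h2, a, b]
  push_cast
  ring

theorem l2_free_le {δ : ℝ} (h₁ : |x₁ 0| ≤ δ) (h₂ : |x₂ 0| ≤ δ) :
    l2 (S.free x₁ x₂) ≤ (S.θ₁ * l2 (expKer S.m₁ 0) + S.θ₂ * l2 (expKer S.m₂ 0)) * δ := by
  have hδ : 0 ≤ δ := (abs_nonneg _).trans h₁
  have := S.θ₁_pos; have := S.θ₂_pos
  have e : S.free x₁ x₂ = (fun t => ((-S.θ₁ * x₁ 0 : ℝ) : ℂ) * expKer S.m₁ 0 t)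
    + fun t => ((S.θ₂ * x₂ 0 : ℝ) : ℂ) * expKer S.m₂ 0 t := rfl
  rw [e]
  refine (l2_add_le ((memLp_expKer S.m₁_re 0).const_mul _)
    ((memLp_expKer S.m₂_re 0).const_mul _)).trans ?_
  have e1 := l2_le_mul (f := fun t => ((-S.θ₁ * x₁ 0 : ℝ) : ℂ) * expKer S.m₁ 0 t)
    (memLp_expKer S.m₁_re 0) (c := S.θ₁ * δ) (by positivity) fun t => by
      rw [norm_mul, Complex.norm_real, Real.norm_eq_abs, abs_mul, abs_neg, abs_of_pos S.θ₁_pos]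
      gcongr
  have e2 := l2_le_mul (f := fun t => ((S.θ₂ * x₂ 0 : ℝ) : ℂ) * expKer S.m₂ 0 t)
    (memLp_expKer S.m₂_re 0) (c := S.θ₂ * δ) (by positivity) fun t => by
      rw [norm_mul, Complex.norm_real, Real.norm_eq_abs, abs_mul, abs_of_pos S.θ₂_pos]
      gcongr
  linarith

theorem memLp_free : MemLp (S.free x₁ x₂) 2 :=
  ((memLp_expKer S.m₁_re 0).const_mul _).add ((memLp_expKer S.m₂_re 0).const_mul _)

end Loop

namespace Loop

variable {S : Loop} {Δ : ℝ} {x₁ x₂ : ℝ → ℝ}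

variable (S) in
/-- The symbol of convolution with `ker`. -/
def symb (Δ : ℝ) : BoundedContinuousFunction ℝ ℂ := twoSym S.a S.b S.m₁_re S.m₂_re Δ

/-- The nonlinear part of the feedback. -/
def rem (S : Loop) (v : ℝ) : ℝ := S.g v - S.k * v

theorem continuous_rem : Continuous S.rem := S.g_cont.sub (by fun_prop)

theorem abs_rem_le {v η : ℝ} (h : |v| ≤ η) : |S.rem v| ≤ S.G * η * |v| := by
  refine (S.g_quad v).trans ?_
  rw [← sq_abs, sq, ← mul_assoc]
  have := S.G_pos
  gcongr

variable (S) in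
/-- The part of the feedback that the linear loop does not produce: the initial history on
`[-Δ, 0)` and the nonlinear remainder on `A`, divided by the gain `k` contained in `ker`. -/
def input (Δ : ℝ) (A : Set ℝ) (x₁ x₂ : ℝ → ℝ) (t : ℝ) : ℂ :=
  (S.k : ℂ)⁻¹ * (restr (Ico (-Δ) 0) (fun t => S.g (S.out x₁ x₂ t)) t
    + restr A (fun t => S.rem (S.out x₁ x₂ t)) t)

theorem integrable_ker : Integrable (S.ker Δ) := integrable_twoKer _ _ S.m₁_re S.m₂_re Δ

/-- The output of a trajectory, cut off to a time window `A`, solves the linear convolution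
equation `V + ker ∗ V = free - ker ∗ input` as long as `A` contains the whole interval `[0, t]`. -/
theorem IsTrajectory.loop_equation (h : S.IsTrajectory Δ x₁ x₂) (hΔ : 0 ≤ Δ) {A : Set ℝ}
    (hA : A ⊆ Ici 0) (hVm : AEStronglyMeasurable (restr A (S.out x₁ x₂))) {cV : ℝ}
    (hcV : ∀ t, ‖restr A (S.out x₁ x₂) t‖ ≤ cV)
    (hNm : AEStronglyMeasurable (restr A fun t => S.rem (S.out x₁ x₂ t))) {cN : ℝ}
    (hcN : ∀ t, ‖restr A (fun t => S.rem (S.out x₁ x₂ t)) t‖ ≤ cN) {t : ℝ}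
    (ht : t < 0 ∨ 0 ≤ t ∧ Icc 0 t ⊆ A) :
    restr A (S.out x₁ x₂) t + conv (S.ker Δ) (restr A (S.out x₁ x₂)) t
      = S.free x₁ x₂ t - conv (S.ker Δ) (S.input Δ A x₁ x₂) t := by
  set v := S.out x₁ x₂ with hv
  set V := restr A v with hV
  set N := restr A (fun t => S.rem (v t)) with hN
  set I := restr (Ico (-Δ) 0) (fun t => S.g (v t)) with hI
  set J := S.input Δ A x₁ x₂ with hJ
  have hgc : ContinuousOn (fun t => S.g (v t)) (Icc (-Δ) 0) := h.cont_g.mono fun s hs => hs.1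
  obtain ⟨cI, hcI⟩ := exists_bound_restr_Ico hgc
  have hIi := integrable_restr_Ico hgc
  have hJa : ∀ s, J s = (S.k : ℂ)⁻¹ * (I s + N s) := fun _ => rfl
  have hVin : ∀ s ∈ A, V s = v s := fun s hs => restr_of_mem _ hs
  have hVout : ∀ s < 0, V s = 0 := fun s hs => restr_of_notMem _ fun h => not_le.2 hs (hA h)
  have hNin : ∀ s ∈ A, N s = S.rem (v s) := fun s hs => restr_of_mem _ hs
  have hNout : ∀ s < 0, N s = 0 := fun s hs => restr_of_notMem _ fun h => not_le.2 hs (hA h)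
  have hIin : ∀ s ∈ Ico (-Δ) 0, I s = S.g (v s) := fun s hs => restr_of_mem _ hs
  have hIout : ∀ s < -Δ, I s = 0 := fun s hs => restr_of_notMem _ fun h => not_le.2 hs h.1
  have hIout' : ∀ s, 0 ≤ s → I s = 0 := fun s hs => restr_of_notMem _ fun h => not_lt.2 hs h.2
  have hJm : AEStronglyMeasurable J := (hIi.1.add hNm).const_mul _
  have hJb : ∀ s, ‖J s‖ ≤ ‖(S.k : ℂ)⁻¹‖ * (cI + cN) := fun s => by
    rw [hJa, norm_mul]
    gcongr
    exact (norm_add_le _ _).trans (add_le_add (hcI s) (hcN s))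
  rcases ht with h0 | ⟨h0, hsub⟩
  · have hker0 : ∀ s < Δ, S.ker Δ s = 0 := fun s hs => by
      simp [ker, twoKer, expKer_of_lt hs]
    rw [conv_eq_zero_of_lt (a := Δ) (b := 0) hker0 hVout (by linarith),
      conv_eq_zero_of_lt (a := Δ) (b := -Δ) hker0 (fun s hs => ?_) (by linarith), hVout t h0]
    · simp [free, twoKer, expKer_of_lt h0]
    · rw [hJa, hIout s hs, hNout s (by linarith)]
      simp
  · have hrep := h.repr_out h0 (W := V + J) (C := cV + ‖(S.k : ℂ)⁻¹‖ * (cI + cN))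
      (hVm.add hJm) (fun s => (norm_add_le _ _).trans (add_le_add (hcV s) (hJb s)))
      (fun s hs => ?_) (fun s hs => ?_)
    · rw [conv_add_right integrable_ker hVm hcV hJm hJb] at hrep
      rw [hVin t (hsub ⟨h0, le_rfl⟩), hrep]
      ring
    · have hk' : (S.k : ℂ) ≠ 0 := by exact_mod_cast S.k_pos.ne'
      rw [Pi.add_apply, hJa, mul_add, ← mul_assoc, mul_inv_cancel₀ hk', one_mul]
      rcases lt_or_ge s 0 with h1 | h1
      · rw [hVout s h1, hNout s h1, hIin s ⟨hs.1, h1⟩]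
        simp [hv]
      · have hs2 : s ∈ A := hsub ⟨h1, by linarith [hs.2]⟩
        rw [hVin s hs2, hNin s hs2, hIout' s h1, rem]
        push_cast
        ring
    · rw [Pi.add_apply, hJa, hVout s (by linarith), hNout s (by linarith), hIout s hs]
      simp

/-- A priori estimate: while the output stays below a fixed level `η`, its `L²` norm up to time `T`
is bounded by the size of the initial function, with a constant independent of `T`. The quadratic
remainder is absorbed into the left-hand side. -/
theorem l2_out_le (hΔ : 0 ≤ Δ)
    {n : BoundedContinuousFunction ℝ ℂ} (hn : Causal n) (hmn : (1 + S.symb Δ) * n = 1) :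
    ∃ η > 0, ∃ C > 0, ∀ δ > 0, ∀ x₁ x₂, S.IsTrajectory Δ x₁ x₂ →
      (∀ s ∈ Icc (-Δ) 0, |x₁ s| ≤ δ ∧ |x₂ s| ≤ δ) → ∀ T, 0 ≤ T →
      (∀ t ∈ Ico 0 T, |S.out x₁ x₂ t| ≤ η) →
      l2 (restr (Ico 0 T) (S.out x₁ x₂)) ≤ C * δ := by
  have hk := S.k_pos
  have hG := S.G_pos
  have hθ₁ := S.θ₁_pos
  have hθ₂ := S.θ₂_pos
  set B := ‖n‖ * (‖S.symb Δ‖ / S.k) with hB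
  have hB0 : 0 ≤ B := by positivity
  -- below this level the remainder contributes at most half of the norm to be estimated
  set η := 1 / (2 * (B * S.G + 1)) with hη
  have hηpos : 0 < η := by positivity
  have hηB : B * (S.G * η) ≤ 1 / 2 := by
    rw [hη, ← mul_assoc, mul_one_div, div_le_div_iff₀ (by positivity) (by norm_num)]
    linarith
  set Cf := S.θ₁ * l2 (expKer S.m₁ 0) + S.θ₂ * l2 (expKer S.m₂ 0) with hCf
  have hCf0 : 0 ≤ Cf := by
    have := l2_nonneg (expKer S.m₁ 0); have := l2_nonneg (expKer S.m₂ 0); positivity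
  refine ⟨η, hηpos, 2 * (‖n‖ * Cf + B * ((S.θ₁ + S.θ₂) * √Δ)) + 1, by positivity, ?_⟩
  intro δ hδ x₁ x₂ hx hinit T hT hsmall
  set v := S.out x₁ x₂ with hv
  have hvc : ContinuousOn v (Ici (-Δ)) := hx.cont_out
  have hv0T : ContinuousOn v (Icc 0 T) := hvc.mono fun s hs => by
    simp only [mem_Ici]; linarith [hs.1]
  have hvI : ContinuousOn v (Icc (-Δ) 0) := hvc.mono fun s hs => hs.1
  have hrc : ContinuousOn (fun t => S.rem (v t)) (Icc 0 T) := continuous_rem.comp_continuousOn hv0T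
  have hgc : ContinuousOn (fun t => S.g (v t)) (Icc (-Δ) 0) := S.g_cont.comp_continuousOn hvI
  set V := restr (Ico 0 T) v with hV
  set N := restr (Ico 0 T) (fun t => S.rem (v t)) with hN
  set I := restr (Ico (-Δ) 0) (fun t => S.g (v t)) with hI
  set J := S.input Δ (Ico 0 T) x₁ x₂ with hJ
  have hIi := integrable_restr_Ico hgc
  have hI2 := memLp_restr_Ico hgc
  have hNi := integrable_restr_Ico hrc
  have hN2 := memLp_restr_Ico hrc
  have hVi := integrable_restr_Ico hv0T
  have hV2 := memLp_restr_Ico hv0T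
  have hJi : Integrable J := (hIi.add hNi).const_mul _
  have hJ2 : MemLp J 2 := (hI2.add hN2).const_mul _
  obtain ⟨cV, hcV⟩ := exists_bound_restr_Ico hv0T
  obtain ⟨cI, hcI⟩ := exists_bound_restr_Ico hgc
  obtain ⟨cN, hcN⟩ := exists_bound_restr_Ico hrc
  have hkerI : Integrable (S.ker Δ) := integrable_ker
  have hkerF : ∀ y, 𝓕 (S.ker Δ) y = S.symb Δ y := fourier_twoKer _ _ S.m₁_re S.m₂_re Δ
  have hc2 : MemLp (conv (S.ker Δ) J) 2 := memLp_conv hkerI hkerF hJi hJ2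
  -- the loop equation on `(-∞, T)`
  have heq : (Iio T).indicator (V + conv (S.ker Δ) V)
      = (Iio T).indicator (S.free x₁ x₂ - conv (S.ker Δ) J) := by
    ext t
    by_cases ht : t ∈ Iio T
    swap
    · rw [indicator_of_notMem ht, indicator_of_notMem ht]
    rw [indicator_of_mem ht, indicator_of_mem ht, Pi.add_apply, Pi.sub_apply]
    refine hx.loop_equation hΔ (fun s hs => hs.1) hVi.1 hcV hNi.1 hcN ?_
    rcases lt_or_ge t 0 with h0 | h0
    · exact Or.inl h0
    · exact Or.inr ⟨h0, fun s hs => ⟨hs.1, hs.2.trans_lt ht⟩⟩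
  have h1 := eLpNorm_le_of_causal (T := T) hkerI hkerF hmn hn hVi hV2
    fun t ht => restr_of_notMem _ (fun h => by linarith [h.2])
  rw [heq] at h1
  change l2 V ≤ ‖n‖ * l2 _ at h1
  have h2 : l2 ((Iio T).indicator (S.free x₁ x₂ - conv (S.ker Δ) J))
      ≤ l2 (S.free x₁ x₂) + l2 (conv (S.ker Δ) J) :=
    (l2_mono (memLp_free.sub hc2) fun t => norm_indicator_le_norm_self _ _).trans
      (l2_sub_le memLp_free hc2)
  have h3 : l2 (conv (S.ker Δ) J) ≤ ‖S.symb Δ‖ * l2 J := eLpNorm_conv_le hkerI hkerF hJi hJ2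
  have h4 : l2 J ≤ S.k⁻¹ * (l2 I + l2 N) := by
    refine (l2_le_mul (hI2.add hN2) (c := S.k⁻¹) (by positivity) fun t => ?_).trans ?_
    · rw [hJ, input, norm_mul, norm_inv, Complex.norm_of_nonneg hk.le]; rfl
    · gcongr
      exact l2_add_le hI2 hN2
  have h5 : l2 N ≤ S.G * η * l2 V := by
    refine l2_le_mul hV2 (by positivity) fun t => ?_
    change ‖N t‖ ≤ S.G * η * ‖V t‖
    by_cases ht : t ∈ Ico 0 T
    · rw [show N t = S.rem (v t) from restr_of_mem _ ht, show V t = v t from restr_of_mem _ ht,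
        Complex.norm_real, Complex.norm_real]
      exact abs_rem_le (hsmall t ht)
    · rw [show N t = 0 from restr_of_notMem _ ht, norm_zero]
      positivity
  have h6 : l2 I ≤ (S.θ₁ + S.θ₂) * √Δ * δ := by
    have := l2_restr_Ico_le (by linarith : -Δ ≤ 0) hgc (C := (S.θ₁ + S.θ₂) * δ) (by positivity)
      fun t ht => (S.g_lip _).trans (abs_out_le (hinit t (Ico_subset_Icc_self ht)).1
        (hinit t (Ico_subset_Icc_self ht)).2)
    rw [zero_sub, neg_neg] at this
    linarith
  have h0mem : (0:ℝ) ∈ Icc (-Δ) 0 := ⟨by linarith, le_rfl⟩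
  have h7 := l2_free_le (S := S) (hinit 0 h0mem).1 (hinit 0 h0mem).2
  have hV0 := l2_nonneg V
  have h8 : l2 V ≤ ‖n‖ * (Cf * δ) + B * ((S.θ₁ + S.θ₂) * √Δ * δ + S.G * η * l2 V) := by
    calc l2 V ≤ ‖n‖ * (Cf * δ + ‖S.symb Δ‖ * (S.k⁻¹ * ((S.θ₁ + S.θ₂) * √Δ * δ
          + S.G * η * l2 V))) := by
          refine h1.trans ?_
          gcongr
          refine h2.trans (add_le_add h7 (h3.trans ?_))
          gcongr
          refine h4.trans ?_
          gcongr
      _ = _ := by rw [hB]; field_simp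
  have h9 : B * (S.G * η) * l2 V ≤ 1 / 2 * l2 V := by gcongr
  nlinarith

/-- A pointwise bound for a lag from an `L²` bound for its input. -/
theorem abs_le_of_repr {m l δ r K t x x0 : ℝ} {W : ℝ → ℂ} {C : ℝ} (hm : 0 < m) (hr : 0 < r)
    (h0 : |x0| ≤ δ) (hW2 : MemLp W 2) (hC : ∀ s, ‖W s‖ ≤ C) (hK : l2 W ≤ K)
    (hx : (x : ℂ) = x0 * expKer m 0 t + l * conv (expKer m Δ) W t) :
    |x| ≤ δ + |l| * (r / m + K ^ 2 / r) := by
  have hm' : 0 < (m : ℂ).re := by simpa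
  have h1 : |x| = ‖(x : ℂ)‖ := (Complex.norm_real x).symm
  rw [h1, hx]
  refine (norm_add_le _ _).trans ?_
  rw [norm_mul, norm_mul, Complex.norm_real, Complex.norm_real, Real.norm_eq_abs,
    Real.norm_eq_abs]
  have h2 := norm_conv_expKer_le hm Δ hW2 hC hr t
  have h3 := integral_expKer_sq_le hm Δ hW2 t
  rw [← l2_sq hW2] at h3
  have h4 : l2 W ^ 2 ≤ K ^ 2 := by
    have := l2_nonneg W
    gcongr
  have h5 := norm_expKer_le_one hm' 0 t
  have hδ0 : 0 ≤ δ := (abs_nonneg _).trans h0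
  have h6 : (∫ s, ‖expKer m Δ (t - s)‖ * ‖W s‖ ^ 2) / r ≤ K ^ 2 / r := by
    gcongr; linarith
  calc _ ≤ δ * 1 + |l| * (r / m + (∫ s, ‖expKer m Δ (t - s)‖ * ‖W s‖ ^ 2) / r) := by gcongr
    _ ≤ _ := by rw [mul_one]; gcongr

/-- Stability of the loop when there is no characteristic exponent on the imaginary axis for any
delay up to `Δ`: the `L²` estimate closes a continuation argument, and square integrability of the
output forces convergence. -/
theorem stability (hΔ : 0 ≤ Δ)
    (h : ∀ Δ' ∈ Icc 0 Δ, ∀ ω : ℝ, charFn S.a S.b S.m₁ S.m₂ Δ' (ω * Complex.I) ≠ 0) :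
    ∃ C > 0, ∃ δ₀ > 0, ∀ δ > 0, δ ≤ δ₀ → ∀ x₁ x₂, S.IsTrajectory Δ x₁ x₂ →
      (∀ s ∈ Icc (-Δ) 0, |x₁ s| ≤ δ ∧ |x₂ s| ≤ δ) →
      (∀ t, 0 ≤ t → |x₁ t| ≤ C * δ ∧ |x₂ t| ≤ C * δ) ∧
        Tendsto x₁ atTop (𝓝 0) ∧ Tendsto x₂ atTop (𝓝 0) := by
  obtain ⟨n, hn, hmn⟩ := exists_causal_inverse S.a_pos S.b_pos S.m₁_re S.m₂_re hΔ h
  obtain ⟨η, hη, C₁, hC₁, key⟩ := l2_out_le hΔ hn hmn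
  have hθ₁ := S.θ₁_pos
  have hθ₂ := S.θ₂_pos
  have hl₁ := S.l₁_pos
  have hl₂ := S.l₂_pos
  have hm₁ := S.m₁_pos
  have hm₂ := S.m₂_pos
  -- `K δ` bounds the `L²` norm of the feedback; `C` is then the constant of `abs_le_of_repr` with
  -- `r = δ`, and `δ₀` keeps the output below `η`
  set K := (S.θ₁ + S.θ₂) * √Δ + C₁ with hK
  have hK0 : 0 < K := by positivity
  set C := 1 + S.l₁ * (1 / S.m₁ + K ^ 2) + S.l₂ * (1 / S.m₂ + K ^ 2) with hC
  have hCpos : 0 < C := by positivity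
  have hC1 : 1 ≤ C := by
    have : 0 ≤ S.l₁ * (1 / S.m₁ + K ^ 2) + S.l₂ * (1 / S.m₂ + K ^ 2) := by positivity
    linarith
  set δ₀ := η / (2 * ((S.θ₁ + S.θ₂) * C)) with hδ₀
  refine ⟨C, hCpos, δ₀, by positivity, ?_⟩
  intro δ hδ hδδ x₁ x₂ hx hinit
  have hδη : (S.θ₁ + S.θ₂) * (C * δ) < η := by
    have : (S.θ₁ + S.θ₂) * (C * δ₀) = η / 2 := by
      rw [hδ₀]; field_simp
    have h2 : (S.θ₁ + S.θ₂) * (C * δ) ≤ (S.θ₁ + S.θ₂) * (C * δ₀) := by gcongr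
    linarith
  set v := S.out x₁ x₂ with hv
  have hvc : ContinuousOn v (Ici (-Δ)) := hx.cont_out
  have h0mem : (0:ℝ) ∈ Icc (-Δ) 0 := ⟨by linarith, le_rfl⟩
  -- smallness of the output on `[0, T)` bounds the state on `[0, T)`
  have step : ∀ T, 0 ≤ T → (∀ t ∈ Ico 0 T, |v t| ≤ η) →
      ∀ t ∈ Ico 0 T, |x₁ t| ≤ C * δ ∧ |x₂ t| ≤ C * δ := by
    intro T hT hsmall t ht
    have hgI : ContinuousOn (fun t => S.g (v t)) (Icc (-Δ) 0) :=
      hx.cont_g.mono fun s hs => hs.1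
    have hgT : ContinuousOn (fun t => S.g (v t)) (Icc 0 T) :=
      hx.cont_g.mono fun s hs => by simp only [mem_Ici]; linarith [hs.1]
    have hvT : ContinuousOn v (Icc 0 T) :=
      hvc.mono fun s hs => by simp only [mem_Ici]; linarith [hs.1]
    set I := restr (Ico (-Δ) 0) (fun t => S.g (v t)) with hI
    set N := restr (Ico 0 T) (fun t => S.g (v t)) with hN
    obtain ⟨cI, hcI⟩ := exists_bound_restr_Ico hgI
    obtain ⟨cN, hcN⟩ := exists_bound_restr_Ico hgT
    have hI2 := memLp_restr_Ico hgI
    have hN2 := memLp_restr_Ico hgT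
    have hWb : ∀ s, ‖(I + N) s‖ ≤ cI + cN := fun s =>
      (norm_add_le _ _).trans (add_le_add (hcI s) (hcN s))
    have hW : ∀ s ∈ Icc (-Δ) (t - Δ), (I + N) s = S.g (S.out x₁ x₂ s) := fun s hs => by
      rw [Pi.add_apply]
      rcases lt_or_ge s 0 with h1 | h1
      · have e1 : I s = S.g (v s) := restr_of_mem _ ⟨hs.1, h1⟩
        have e2 : N s = 0 := restr_of_notMem _ fun h => not_le.2 h1 h.1
        rw [e1, e2, add_zero]
      · have e1 : I s = 0 := restr_of_notMem _ fun h => not_lt.2 h1 h.2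
        have e2 : N s = S.g (v s) := restr_of_mem _ ⟨h1, by linarith [hs.2, ht.2]⟩
        rw [e1, e2, zero_add]
    have hW0 : ∀ s < -Δ, (I + N) s = 0 := fun s hs => by
      have e1 : I s = 0 := restr_of_notMem _ fun h => not_le.2 hs h.1
      have e2 : N s = 0 := restr_of_notMem _ fun h => by linarith [h.1]
      rw [Pi.add_apply, e1, e2, add_zero]
    have hWK : l2 (I + N) ≤ K * δ := by
      have e1 : l2 I ≤ (S.θ₁ + S.θ₂) * √Δ * δ := by
        have := l2_restr_Ico_le (by linarith : -Δ ≤ 0) hgI (C := (S.θ₁ + S.θ₂) * δ)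
          (by positivity) fun t ht => (S.g_lip _).trans (abs_out_le
            (hinit t (Ico_subset_Icc_self ht)).1 (hinit t (Ico_subset_Icc_self ht)).2)
        rw [zero_sub, neg_neg] at this
        linarith
      have e2 : l2 N ≤ C₁ * δ := by
        refine le_trans (l2_mono (memLp_restr_Ico hvT) fun t => ?_) (key δ hδ x₁ x₂ hx hinit T hT
          hsmall)
        by_cases ht : t ∈ Ico 0 T
        · rw [hN, restr_of_mem _ ht, restr_of_mem _ ht, Complex.norm_real, Complex.norm_real]
          exact S.g_lip _
        · rw [hN, restr_of_notMem _ ht, restr_of_notMem _ ht]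
      rw [hK, add_mul]
      exact (l2_add_le hI2 hN2).trans (add_le_add e1 e2)
    have r1 := abs_le_of_repr hm₁ hδ (hinit 0 h0mem).1 (hI2.add hN2) hWb hWK
      (hx.repr₁ ht.1 hW hW0)
    have r2 := abs_le_of_repr (l := -S.l₂) hm₂ hδ (hinit 0 h0mem).2 (hI2.add hN2) hWb hWK
      (by rw [hx.repr₂ ht.1 hW hW0]; push_cast; ring)
    have e3 : ∀ m, δ / m + (K * δ) ^ 2 / δ = (1 / m + K ^ 2) * δ := fun m => by
      field_simp
    rw [e3, abs_of_pos hl₁] at r1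
    rw [e3, abs_neg, abs_of_pos hl₂] at r2
    have p1 : 0 ≤ S.l₁ * ((1 / S.m₁ + K ^ 2) * δ) := by positivity
    have p2 : 0 ≤ S.l₂ * ((1 / S.m₂ + K ^ 2) * δ) := by positivity
    have e4 : C * δ = δ + S.l₁ * ((1 / S.m₁ + K ^ 2) * δ)
        + S.l₂ * ((1 / S.m₂ + K ^ 2) * δ) := by rw [hC]; ring
    constructor <;> linarith
  -- continuation: the output never reaches the level `η`
  have hall : ∀ t, 0 ≤ t → |v t| < η := by
    by_contra! hcon
    obtain ⟨t₁, ht₁, hvt₁⟩ := hcon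
    have hvabs : ContinuousOn (fun t => |v t|) (Icc 0 t₁) :=
      (hvc.mono fun s hs => by simp only [mem_Ici]; linarith [hs.1]).abs
    have hcl : IsCompact (Icc 0 t₁ ∩ (fun t => |v t|) ⁻¹' Ici η) :=
      isCompact_Icc.of_isClosed_subset (hvabs.preimage_isClosed_of_isClosed isClosed_Icc
        isClosed_Ici) inter_subset_left
    -- the first time at which the level is reached
    obtain ⟨t₀, ⟨ht₀, hvt₀⟩, hleast⟩ := hcl.exists_isLeast ⟨t₁, ⟨ht₁, le_rfl⟩, hvt₁⟩
    have hbefore : ∀ t ∈ Ico 0 t₀, |v t| ≤ η := fun t ht => by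
      by_contra! hlt
      exact absurd (hleast ⟨⟨ht.1, ht.2.le.trans ht₀.2⟩, hlt.le⟩) (not_le.2 ht.2)
    have hst := step t₀ ht₀.1 hbefore
    have hb : ∀ t ∈ Ico 0 t₀, |v t| ≤ (S.θ₁ + S.θ₂) * (C * δ) := fun t ht =>
      abs_out_le (hst t ht).1 (hst t ht).2
    have hvt₀' : |v t₀| ≤ (S.θ₁ + S.θ₂) * (C * δ) := by
      rcases ht₀.1.eq_or_lt with h0 | h0
      · rw [← h0]
        refine (abs_out_le (hinit 0 h0mem).1 (hinit 0 h0mem).2).trans ?_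
        gcongr
        nlinarith
      · have hcl2 : t₀ ∈ closure (Ico 0 t₀) := by
          rw [closure_Ico h0.ne]; exact ⟨h0.le, le_rfl⟩
        have hcw : ContinuousWithinAt (fun t => |v t|) (Ico 0 t₀) t₀ :=
          ((hvabs t₀ ht₀).mono fun s hs => ⟨hs.1, hs.2.le.trans ht₀.2⟩)
        exact hcw.closure_le hcl2 continuousWithinAt_const hb
    have : η ≤ |v t₀| := hvt₀
    linarith
  have hbound : ∀ t, 0 ≤ t → |x₁ t| ≤ C * δ ∧ |x₂ t| ≤ C * δ := fun t ht =>
    step (t + 1) (by linarith) (fun s hs => (hall s hs.1).le) t ⟨ht, by linarith⟩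
  refine ⟨hbound, ?_⟩
  -- the output is square integrable on `[0, ∞)`, so the filtered feedback decays
  have hsq : IntegrableOn (fun t => |v t| ^ 2) (Ioi 0) := by
    refine integrableOn_Ioi_of_intervalIntegral_norm_bounded ((C₁ * δ) ^ 2) 0
      (l := atTop) (b := fun T : ℝ => T) (fun T => ?_) tendsto_id ?_
    · have : ContinuousOn (fun t => |v t| ^ 2) (Icc 0 T) :=
        ((hvc.mono fun s hs => by simp only [mem_Ici]; linarith [hs.1]).abs).pow 2
      exact this.integrableOn_Icc.mono_set Ioc_subset_Icc_self
    · filter_upwards [eventually_ge_atTop 0] with T hT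
      have hvT : ContinuousOn v (Icc 0 T) :=
        hvc.mono fun s hs => by simp only [mem_Ici]; linarith [hs.1]
      have e1 := key δ hδ x₁ x₂ hx hinit T hT fun t ht => (hall t ht.1).le
      have e2 := l2_sq (memLp_restr_Ico hvT)
      have e3 : ∫ t, ‖restr (Ico 0 T) v t‖ ^ 2 = ∫ t in (0:ℝ)..T, ‖|v t| ^ 2‖ := by
        rw [intervalIntegral.integral_of_le hT, ← integral_Ico_eq_integral_Ioc,
          ← integral_indicator measurableSet_Ico]
        congr 1; ext t
        by_cases ht : t ∈ Ico 0 T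
        · rw [restr_of_mem _ ht, indicator_of_mem ht]; simp
        · rw [restr_of_notMem _ ht, indicator_of_notMem ht]; simp
      rw [← e3, ← e2]
      have := l2_nonneg (restr (Ico 0 T) v)
      gcongr
  set W := restr (Ici (-Δ)) (fun t => S.g (v t)) with hW
  have hWm : AEStronglyMeasurable W := aestronglyMeasurable_restr measurableSet_Ici hx.cont_g
  have hWb : ∀ t, ‖W t‖ ≤ η := by
    refine norm_restr_le hη.le fun t ht => (S.g_lip _).trans ?_
    rcases le_or_gt t 0 with h0 | h0
    · refine (abs_out_le (hinit t ⟨ht, h0⟩).1 (hinit t ⟨ht, h0⟩).2).trans (le_trans ?_ hδη.le)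
      gcongr
      nlinarith
    · exact (hall t h0.le).le
  have hW2 : MemLp W 2 := by
    rw [memLp_two_iff_integrable_sq_norm hWm]
    have hdom : Integrable ((Icc (-Δ) 0 ∪ Ioi 0).indicator fun t => |v t| ^ 2) := by
      rw [integrable_indicator_iff (measurableSet_Icc.union measurableSet_Ioi)]
      refine IntegrableOn.union ?_ hsq
      exact (((hvc.mono fun s hs => hs.1).abs).pow 2).integrableOn_Icc
    refine hdom.mono' (hWm.norm.pow 2) (Eventually.of_forall fun t => ?_)
    rw [Real.norm_of_nonneg (by positivity)]
    by_cases ht : t ∈ Ici (-Δ)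
    · rw [indicator_of_mem, hW, restr_of_mem _ ht, Complex.norm_real]
      · have := S.g_lip (v t)
        rw [Real.norm_eq_abs]
        gcongr
      · rcases le_or_gt t 0 with h0 | h0
        · exact Or.inl ⟨ht, h0⟩
        · exact Or.inr h0
    · rw [hW, restr_of_notMem _ ht, norm_zero]
      refine le_trans (le_of_eq (by norm_num)) (indicator_nonneg (fun t _ => by positivity) t)
  have hWeq : ∀ t, ∀ s ∈ Icc (-Δ) (t - Δ), W s = S.g (S.out x₁ x₂ s) := fun t s hs =>
    restr_of_mem _ hs.1
  have hW0 : ∀ s < -Δ, W s = 0 := fun s hs =>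
    restr_of_notMem _ (fun h => by linarith [mem_Ici.1 h])
  have hexp : ∀ m : ℝ, 0 < m → Tendsto (fun t => expKer m 0 t) atTop (𝓝 0) := fun m hm => by
    have h1 : Tendsto (fun t : ℝ => Real.exp (-m * t)) atTop (𝓝 0) :=
      Real.tendsto_exp_atBot.comp (Tendsto.const_mul_atTop_of_neg (by linarith) tendsto_id)
    rw [tendsto_zero_iff_norm_tendsto_zero]
    refine h1.congr' ?_
    filter_upwards [eventually_ge_atTop 0] with t ht
    rw [norm_expKer_of_le ht]; simp
  have hlim : ∀ (m l x0 : ℝ) (x : ℝ → ℝ), 0 < m →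
      (∀ t, 0 ≤ t → (x t : ℂ) = x0 * expKer m 0 t + l * conv (expKer m Δ) W t) →
      Tendsto x atTop (𝓝 0) := fun m l x0 x hm hrep => by
    have h1 : Tendsto (fun t => (x0 : ℂ) * expKer m 0 t + l * conv (expKer m Δ) W t) atTop
        (𝓝 (x0 * 0 + l * 0)) :=
      ((hexp m hm).const_mul _).add ((tendsto_conv_expKer hm Δ hW2 hWb).const_mul _)
    rw [mul_zero, mul_zero, add_zero] at h1
    have h2 : Tendsto (fun t => (x t : ℂ)) atTop (𝓝 0) := by
      refine h1.congr' ?_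
      filter_upwards [eventually_ge_atTop 0] with t ht
      rw [hrep t ht]
    have h3 := (Complex.continuous_re.tendsto 0).comp h2
    simpa [Function.comp_def] using h3
  refine ⟨hlim S.m₁ S.l₁ (x₁ 0) x₁ hm₁ fun t ht => hx.repr₁ ht (hWeq t) hW0,
    hlim S.m₂ (-S.l₂) (x₂ 0) x₂ hm₂ fun t ht => ?_⟩
  rw [hx.repr₂ ht (hWeq t) hW0]
  push_cast; ring

end Loop

/-! ### Existence of trajectories -/

/-- The characteristic exponents are countable in number, so almost every vertical line avoids
them. -/
theorem exists_line_without_roots {a b m₁ m₂ Δ r : ℝ} (ha : 0 < a) (hb : 0 < b) (hm₁ : 0 < m₁)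
    (hm₂ : 0 < m₂) (hr : 0 < r) :
    ∃ β ∈ Ioo 0 r, ∀ ω : ℝ, charFn a b m₁ m₂ Δ (β + ω * Complex.I) ≠ 0 := by
  set P : ℂ → ℂ := fun z => (z + m₁) * (z + m₂)
    + Complex.exp (-z * Δ) * (a * (z + m₂) + b * (z + m₁)) with hP
  -- `P` is entire and equals the characteristic function times the denominators
  have hPd : Differentiable ℂ P := by
    simp only [hP]; fun_prop
  have hP0 : P 0 ≠ 0 := by
    simp only [hP, zero_add, neg_zero, zero_mul, Complex.exp_zero, one_mul]
    norm_cast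
    positivity
  have hPa : AnalyticOnNhd ℂ P univ := fun z _ => hPd.analyticAt z
  have hco := hPa.preimage_zero_mem_codiscrete hP0
  have hcount : (P ⁻¹' {0}).Countable := by
    have hd := (mem_codiscrete'.1 hco).2
    rw [preimage_compl, compl_compl] at hd
    have : IsLindelof (P ⁻¹' {0}) :=
      (isClosed_singleton.preimage hPd.continuous).isLindelof
    exact this.countable_of_isDiscrete hd
  have hre : (Complex.re '' (P ⁻¹' {0})).Countable := hcount.image _
  have hne : (Ioo 0 r \ Complex.re '' (P ⁻¹' {0})).Nonempty := by
    rw [nonempty_iff_ne_empty]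
    intro h
    rw [sdiff_eq_empty] at h
    exact absurd (Cardinal.Real.Ioo_countable_iff.1 (hre.mono h)) (not_le.2 hr)
  obtain ⟨β, hβ, hβn⟩ := hne
  refine ⟨β, hβ, fun ω h0 => hβn ⟨β + ω * Complex.I, ?_, by simp⟩⟩
  have hden : ∀ m : ℝ, 0 < m → ((β : ℂ) + ω * Complex.I + m) ≠ 0 := fun m hm h => by
    have := congrArg Complex.re h
    simp at this
    linarith [hβ.1]
  have e : P (β + ω * Complex.I) = charFn a b m₁ m₂ Δ (β + ω * Complex.I)
      * ((β + ω * Complex.I + m₁) * (β + ω * Complex.I + m₂)) := by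
    simp only [hP, charFn, transfer]
    have := hden m₁ hm₁; have := hden m₂ hm₂
    field_simp
  rw [mem_preimage, mem_singleton_iff, e, h0, zero_mul]

/-- The solution of `x' = l φ(t - Δ) - m x` on `[0, ∞)` with value `x0` on `(-∞, 0]`. -/
def response (l m x0 Δ : ℝ) (φ : ℝ → ℝ) (t : ℝ) : ℝ :=
  Real.exp (-m * max t 0) * (x0 + l * ∫ s in (0:ℝ)..max t 0, Real.exp (m * s) * φ (s - Δ))

theorem continuous_response {l m x0 Δ : ℝ} {φ : ℝ → ℝ} (hφ : Continuous φ) :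
    Continuous (response l m x0 Δ φ) := by
  have h1 : Continuous fun T => ∫ s in (0:ℝ)..T, Real.exp (m * s) * φ (s - Δ) :=
    intervalIntegral.continuous_primitive
      (fun a b => (by fun_prop : Continuous fun s => Real.exp (m * s) * φ (s - Δ)).intervalIntegrable
        a b) 0
  have h2 : Continuous fun t : ℝ => max t 0 := by fun_prop
  have h3 := h1.comp h2
  unfold response
  exact Continuous.mul (by fun_prop) (continuous_const.add (continuous_const.mul h3))

theorem response_of_nonpos {l m x0 Δ t : ℝ} {φ : ℝ → ℝ} (ht : t ≤ 0) :
    response l m x0 Δ φ t = x0 := by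
  simp [response, max_eq_right ht]

theorem response_congr {l m x0 Δ t T : ℝ} {φ ψ : ℝ → ℝ} (h : ∀ s ≤ T, φ s = ψ s)
    (ht : t ≤ T + Δ) : response l m x0 Δ φ t = response l m x0 Δ ψ t := by
  rcases le_or_gt t 0 with h0 | h0
  · rw [response_of_nonpos h0, response_of_nonpos h0]
  · rw [response, response]
    congr 3
    refine intervalIntegral.integral_congr fun s hs => ?_
    rw [uIcc_of_le (le_max_right _ _), max_eq_left h0.le] at hs
    rw [h (s - Δ) (by linarith [hs.2])]

theorem hasDerivWithinAt_response {l m x0 Δ t : ℝ} {φ : ℝ → ℝ} (hφ : Continuous φ) (ht : 0 ≤ t) :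
    HasDerivWithinAt (response l m x0 Δ φ) (l * φ (t - Δ) - m * response l m x0 Δ φ t) (Ici 0) t := by
  set f : ℝ → ℝ := fun t =>
    Real.exp (-m * t) * (x0 + l * ∫ s in (0:ℝ)..t, Real.exp (m * s) * φ (s - Δ)) with hf
  have hc : Continuous fun s => Real.exp (m * s) * φ (s - Δ) := by fun_prop
  have h1 : HasDerivAt f (l * φ (t - Δ) - m * f t) t := by
    have e1 : HasDerivAt (fun s => Real.exp (-m * s)) (Real.exp (-m * t) * (-m)) t := by
      simpa using ((hasDerivAt_id t).const_mul (-m)).exp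
    have e2 := ((hc.integral_hasStrictDerivAt 0 t).hasDerivAt.const_mul l).const_add x0
    convert! e1.mul e2 using 1
    have : Real.exp (-m * t) * Real.exp (m * t) = 1 := by rw [← Real.exp_add]; simp
    simp only [hf]
    linear_combination (-l * φ (t - Δ)) * this
  have h2 : ∀ s ∈ Ici (0:ℝ), response l m x0 Δ φ s = f s := fun s hs => by
    rw [response, max_eq_left hs]
  rw [h2 t ht]
  exact h1.hasDerivWithinAt.congr h2 (h2 t ht)

namespace Loop

variable (S : Loop)

/-- Method of steps: the `n`-th iterate agrees with the output of the trajectory that starts from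
the constant history `(d, 0)`, up to time `n Δ`. -/
def iterOut (Δ d : ℝ) : ℕ → ℝ → ℝ
  | 0 => fun _ => -S.θ₁ * d
  | n + 1 => S.out (response S.l₁ S.m₁ d Δ fun t => S.g (iterOut Δ d n t))
      (response (-S.l₂) S.m₂ 0 Δ fun t => S.g (iterOut Δ d n t))

variable {S}

theorem continuous_iterOut (Δ d : ℝ) (n : ℕ) : Continuous (S.iterOut Δ d n) := by
  induction n with
  | zero => exact continuous_const
  | succ n ih =>
    have := S.g_cont.comp ih
    exact (continuous_const.mul (continuous_response this)).add
      (continuous_const.mul (continuous_response this))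

theorem iterOut_succ_eq {Δ d : ℝ} (n : ℕ) :
    ∀ t ≤ n * Δ, S.iterOut Δ d (n + 1) t = S.iterOut Δ d n t := by
  induction n with
  | zero =>
    intro t ht
    have ht0 : t ≤ 0 := by simpa using ht
    simp [iterOut, out, response_of_nonpos ht0]
  | succ n ih =>
    intro t ht
    have ht' : t ≤ n * Δ + Δ := by push_cast at ht; linarith
    have hg : ∀ s ≤ n * Δ, S.g (S.iterOut Δ d (n + 1) s) = S.g (S.iterOut Δ d n s) := fun s hs => by
      rw [ih s hs]
    change S.out _ _ t = S.out _ _ t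
    rw [out, out, response_congr hg ht', response_congr hg ht']

theorem iterOut_eq_of_le {Δ d : ℝ} (hΔ : 0 < Δ) {n n' : ℕ} (h : n ≤ n') :
    ∀ t ≤ n * Δ, S.iterOut Δ d n' t = S.iterOut Δ d n t := by
  induction n', h using Nat.le_induction with
  | base => intro t _; rfl
  | succ k hk ih =>
    intro t ht
    rw [iterOut_succ_eq k t (ht.trans (by gcongr)), ih t ht]

theorem exists_trajectory {Δ : ℝ} (hΔ : 0 < Δ) (d : ℝ) :
    ∃ x₁ x₂ : ℝ → ℝ, S.IsTrajectory Δ x₁ x₂ ∧ (∀ t ≤ 0, x₁ t = d) ∧ ∀ t ≤ 0, x₂ t = 0 := by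
  set u : ℝ → ℝ := fun t => S.iterOut Δ d ⌈t / Δ⌉₊ t with hu
  have hceil : ∀ t, t ≤ ⌈t / Δ⌉₊ * Δ := fun t => by
    have := Nat.le_ceil (t / Δ)
    rwa [div_le_iff₀ hΔ] at this
  have hun : ∀ (n : ℕ) (t : ℝ), t ≤ n * Δ → u t = S.iterOut Δ d n t := fun n t ht => by
    rw [hu]
    rcases le_total ⌈t / Δ⌉₊ n with h | h
    · exact (iterOut_eq_of_le hΔ h t (hceil t)).symm
    · exact iterOut_eq_of_le hΔ h t ht
  have huc : Continuous u := by
    rw [continuous_iff_continuousAt]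
    intro t
    obtain ⟨n, hn⟩ := exists_nat_gt (t / Δ)
    rw [div_lt_iff₀ hΔ] at hn
    refine ((continuous_iterOut (S := S) Δ d n).continuousAt (x := t)).congr ?_
    filter_upwards [Iio_mem_nhds hn] with s hs
    exact (hun n s (le_of_lt hs)).symm
  have hgu := S.g_cont.comp huc
  set x₁ := response S.l₁ S.m₁ d Δ (fun t => S.g (u t)) with hx₁
  set x₂ := response (-S.l₂) S.m₂ 0 Δ (fun t => S.g (u t)) with hx₂
  have hout : S.out x₁ x₂ = u := by
    ext t
    set n := ⌈t / Δ⌉₊ with hn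
    have ht : t ≤ n * Δ := hceil t
    have hg : ∀ s ≤ n * Δ, S.g (u s) = S.g (S.iterOut Δ d n s) := fun s hs => by
      rw [hun n s hs]
    rw [hun (n + 1) t (by push_cast; linarith)]
    change S.out _ _ t = S.out _ _ t
    rw [out, out, hx₁, hx₂, response_congr hg (by linarith), response_congr hg (by linarith)]
  refine ⟨x₁, x₂, ⟨(continuous_response hgu).continuousOn, (continuous_response hgu).continuousOn,
    fun t ht => ?_, fun t ht => ?_⟩, fun t ht => response_of_nonpos ht,
    fun t ht => response_of_nonpos ht⟩
  · rw [hout]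
    exact hasDerivWithinAt_response hgu ht
  · rw [hout]
    exact hasDerivWithinAt_response hgu ht

end Loop

/-! ### Exponentially weighted estimates and instability -/

/-- The function `f` with the complex exponential weight `exp (-z t)`. Its integral is the Laplace
transform of `f` at `z`. -/
def weighted (z : ℂ) (f : ℝ → ℂ) (t : ℝ) : ℂ := Complex.exp (-z * t) * f t

theorem norm_weighted_le {z : ℂ} {f : ℝ → ℂ} {C t₀ : ℝ} (hC : ∀ t, ‖f t‖ ≤ C)
    (h0 : ∀ t < t₀, f t = 0) (t : ℝ) :
    ‖weighted z f t‖ ≤ C * ‖Complex.exp (-z * t₀)‖ * ‖expKer z t₀ t‖ := by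
  rcases lt_or_ge t t₀ with h | h
  · rw [weighted, h0 t h, mul_zero, norm_zero]
    have := (norm_nonneg _).trans (hC t)
    positivity
  · have : Complex.exp (-z * t) = Complex.exp (-z * t₀) * expKer z t₀ t := by
      rw [expKer_of_le h, ← Complex.exp_add]; ring_nf
    rw [weighted, this, norm_mul, norm_mul, mul_comm, ← mul_assoc]
    gcongr
    exact hC t

theorem aestronglyMeasurable_weighted {z : ℂ} {f : ℝ → ℂ} (hf : AEStronglyMeasurable f) :
    AEStronglyMeasurable (weighted z f) :=
  AEStronglyMeasurable.mul (Continuous.aestronglyMeasurable (by fun_prop)) hf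

theorem integrable_weighted {z : ℂ} (hz : 0 < z.re) {f : ℝ → ℂ} (hf : AEStronglyMeasurable f)
    {C t₀ : ℝ} (hC : ∀ t, ‖f t‖ ≤ C) (h0 : ∀ t < t₀, f t = 0) : Integrable (weighted z f) :=
  ((integrable_expKer hz t₀).norm.const_mul _).mono' (aestronglyMeasurable_weighted hf)
    (Eventually.of_forall (norm_weighted_le hC h0))

theorem memLp_weighted {z : ℂ} (hz : 0 < z.re) {f : ℝ → ℂ} (hf : AEStronglyMeasurable f)
    {C t₀ : ℝ} (hC : ∀ t, ‖f t‖ ≤ C) (h0 : ∀ t < t₀, f t = 0) : MemLp (weighted z f) 2 := by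
  refine memLp_of_integrable_of_bound (integrable_weighted hz hf hC h0)
    (C := C * ‖Complex.exp (-z * t₀)‖) fun t => (norm_weighted_le hC h0 t).trans ?_
  have := (norm_nonneg _).trans (hC t)
  exact mul_le_of_le_one_right (by positivity) (norm_expKer_le_one hz _ _)

/-- An exponential weight of rate `β` translates the characteristic function by `β`. -/
theorem charFn_shift (a b m₁ m₂ Δ β : ℝ) (w : ℂ) :
    charFn (Real.exp (-β * Δ) * a) (Real.exp (-β * Δ) * b) (m₁ + β) (m₂ + β) Δ w
      = charFn a b m₁ m₂ Δ (β + w) := by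
  have e : Complex.exp (-(β + w) * Δ) = Complex.exp (-w * Δ) * Complex.exp (-β * Δ) := by
    rw [← Complex.exp_add]; ring_nf
  rw [charFn, charFn, transfer, transfer, e]
  push_cast
  rw [show w + (m₁ + β) = (β : ℂ) + w + m₁ by ring, show w + (m₂ + β) = (β : ℂ) + w + m₂ by ring]
  ring

namespace Loop

variable {S : Loop} {Δ : ℝ} {x₁ x₂ : ℝ → ℝ}

theorem weighted_loop_equation (z : ℂ) {A : Set ℝ} {t : ℝ}
    (h : restr A (S.out x₁ x₂) t + conv (S.ker Δ) (restr A (S.out x₁ x₂)) t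
      = S.free x₁ x₂ t - conv (S.ker Δ) (S.input Δ A x₁ x₂) t) :
    weighted z (restr A (S.out x₁ x₂)) t
      + conv (weighted z (S.ker Δ)) (weighted z (restr A (S.out x₁ x₂))) t
      = weighted z (S.free x₁ x₂) t
        - conv (weighted z (S.ker Δ)) (weighted z (S.input Δ A x₁ x₂)) t := by
  have h1 := weight_mul_conv z (S.ker Δ) (restr A (S.out x₁ x₂)) t
  have h2 := weight_mul_conv z (S.ker Δ) (S.input Δ A x₁ x₂) t
  change _ = conv (weighted z (S.ker Δ)) (weighted z _) t at h1 h2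
  rw [← h1, ← h2, weighted, weighted, ← mul_add, h]
  ring

theorem weighted_ker (z : ℂ) : weighted z (S.ker Δ)
    = twoKer (Complex.exp (-z * Δ) * S.a) (Complex.exp (-z * Δ) * S.b) (S.m₁ + z) (S.m₂ + z) Δ :=
  weight_mul_twoKer z _ _ _ _ Δ

theorem weighted_free (z : ℂ) : weighted z (S.free x₁ x₂)
    = twoKer (-S.θ₁ * x₁ 0 : ℝ) (S.θ₂ * x₂ 0 : ℝ) (S.m₁ + z) (S.m₂ + z) 0 := by
  have := weight_mul_twoKer z (-S.θ₁ * x₁ 0 : ℝ) (S.θ₂ * x₂ 0 : ℝ) S.m₁ S.m₂ 0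
  simp only [Complex.ofReal_zero, mul_zero, Complex.exp_zero, one_mul] at this
  exact this

/-- A trajectory that starts from the constant history `(d, 0)` and whose output never exceeds
`η`. -/
structure IsSmallStep (S : Loop) (Δ d η : ℝ) (x₁ x₂ : ℝ → ℝ) : Prop where
  traj : S.IsTrajectory Δ x₁ x₂
  init₁ : ∀ t ∈ Icc (-Δ) 0, x₁ t = d
  init₂ : ∀ t ∈ Icc (-Δ) 0, x₂ t = 0
  small : ∀ t, 0 ≤ t → |S.out x₁ x₂ t| ≤ η

namespace IsSmallStep

variable {d η : ℝ}

theorem cont_Ici (h : IsSmallStep S Δ d η x₁ x₂) (hΔ : 0 ≤ Δ) :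
    ContinuousOn (S.out x₁ x₂) (Ici 0) :=
  h.traj.cont_out.mono (Ici_subset_Ici.2 (by linarith))

theorem eta_nonneg (h : IsSmallStep S Δ d η x₁ x₂) : 0 ≤ η :=
  (abs_nonneg _).trans (h.small 0 le_rfl)

theorem out_init (h : IsSmallStep S Δ d η x₁ x₂) {t : ℝ} (ht : t ∈ Icc (-Δ) 0) :
    S.out x₁ x₂ t = -S.θ₁ * d := by
  rw [out, h.init₁ t ht, h.init₂ t ht, mul_zero, add_zero]

theorem meas_out (h : IsSmallStep S Δ d η x₁ x₂) (hΔ : 0 ≤ Δ) :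
    AEStronglyMeasurable (restr (Ici 0) (S.out x₁ x₂)) :=
  aestronglyMeasurable_restr measurableSet_Ici (h.cont_Ici hΔ)

theorem meas_rem (h : IsSmallStep S Δ d η x₁ x₂) (hΔ : 0 ≤ Δ) :
    AEStronglyMeasurable (restr (Ici 0) fun t => S.rem (S.out x₁ x₂ t)) :=
  aestronglyMeasurable_restr measurableSet_Ici (continuous_rem.comp_continuousOn (h.cont_Ici hΔ))

theorem norm_out_le (h : IsSmallStep S Δ d η x₁ x₂) (t : ℝ) :
    ‖restr (Ici 0) (S.out x₁ x₂) t‖ ≤ η :=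
  norm_restr_le h.eta_nonneg (fun t ht => h.small t ht) t

theorem norm_rem_le_mul (h : IsSmallStep S Δ d η x₁ x₂) (t : ℝ) :
    ‖restr (Ici 0) (fun t => S.rem (S.out x₁ x₂ t)) t‖
      ≤ S.G * η * ‖restr (Ici 0) (S.out x₁ x₂) t‖ := by
  by_cases ht : t ∈ Ici (0:ℝ)
  · rw [restr_of_mem _ ht, restr_of_mem _ ht, Complex.norm_real, Complex.norm_real]
    exact abs_rem_le (h.small t ht)
  · rw [restr_of_notMem _ ht, restr_of_notMem _ ht]
    simp

theorem norm_rem_le (h : IsSmallStep S Δ d η x₁ x₂) (t : ℝ) :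
    ‖restr (Ici 0) (fun t => S.rem (S.out x₁ x₂ t)) t‖ ≤ S.G * η * η := by
  have := S.G_pos
  have := h.eta_nonneg
  exact (h.norm_rem_le_mul t).trans (by gcongr; exact h.norm_out_le t)

theorem loop_equation (h : IsSmallStep S Δ d η x₁ x₂) (hΔ : 0 ≤ Δ) (t : ℝ) :
    restr (Ici 0) (S.out x₁ x₂) t + conv (S.ker Δ) (restr (Ici 0) (S.out x₁ x₂)) t
      = S.free x₁ x₂ t - conv (S.ker Δ) (S.input Δ (Ici 0) x₁ x₂) t := by
  refine h.traj.loop_equation hΔ subset_rfl (h.meas_out hΔ) h.norm_out_le (h.meas_rem hΔ)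
    h.norm_rem_le ?_
  rcases lt_or_ge t 0 with h0 | h0
  · exact Or.inl h0
  · exact Or.inr ⟨h0, fun s hs => hs.1⟩

theorem cont_g_init (h : IsSmallStep S Δ d η x₁ x₂) :
    ContinuousOn (fun t => S.g (S.out x₁ x₂ t)) (Icc (-Δ) 0) :=
  h.traj.cont_g.mono fun _ hs => hs.1

end IsSmallStep

/-- On a line `Re z = β` without characteristic exponents, the weighted output of a small trajectory
is bounded by the size `d` of its initial function. Boundedness of the trajectory makes the weighted
output square integrable, so no causality is needed here. -/
theorem l2_weighted_out_le (hΔ : 0 ≤ Δ) {β : ℝ} (hβ : 0 < β)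
    (hline : ∀ ω : ℝ, charFn S.a S.b S.m₁ S.m₂ Δ (β + ω * Complex.I) ≠ 0) :
    ∃ η > 0, ∃ C > 0, ∀ d > 0, ∀ η', η' ≤ η → ∀ x₁ x₂, IsSmallStep S Δ d η' x₁ x₂ →
      l2 (weighted β (restr (Ici 0) (S.out x₁ x₂))) ≤ C * d := by
  have hk := S.k_pos
  have hG := S.G_pos
  have hθ₁ := S.θ₁_pos
  have hθ₂ := S.θ₂_pos
  have hβ' : 0 < (β : ℂ).re := by simpa
  have hM₁ : 0 < ((S.m₁ + β : ℝ) : ℂ).re := by simpa using add_pos S.m₁_pos hβ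
  have hM₂ : 0 < ((S.m₂ + β : ℝ) : ℂ).re := by simpa using add_pos S.m₂_pos hβ
  set A := Real.exp (-β * Δ) * S.a with hA
  set B := Real.exp (-β * Δ) * S.b with hB
  have hA0 : 0 < A := mul_pos (Real.exp_pos _) S.a_pos
  have hB0 : 0 < B := mul_pos (Real.exp_pos _) S.b_pos
  set m := twoSym A B hM₁ hM₂ Δ with hm
  have hmne : ∀ y : ℝ, 1 + m y ≠ 0 := fun y => by
    rw [hm, one_add_twoSym, charFn_shift]
    have := hline (2 * Real.pi * y)
    push_cast at this
    exact this
  obtain ⟨M, hM, hMb⟩ := exists_uniform_lower_bound (K := {0}) isCompact_singleton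
    (F := fun _ y => 1 + m y) (by
      simp only [Function.uncurry_def]
      exact continuous_const.add (m.continuous.comp continuous_snd))
    (fun _ _ y => hmne y) (Y := 2 * (A + B) + 1)
    (fun s _ y hy => half_le_norm_one_add (norm_twoSym_le_half hA0.le hB0.le hM₁ hM₂ Δ hy))
  obtain ⟨n, hmn, -⟩ := exists_inverse_symbol hM.le (hMb 0 rfl)
  have hkereq : weighted β (S.ker Δ) = twoKer A B (S.m₁ + β : ℝ) (S.m₂ + β : ℝ) Δ := by
    rw [weighted_ker, hA, hB]
    push_cast
    rfl
  have hkerI : Integrable (weighted β (S.ker Δ)) := by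
    rw [hkereq]; exact integrable_twoKer _ _ hM₁ hM₂ Δ
  have hkerF : ∀ y, 𝓕 (weighted β (S.ker Δ)) y = m y := by
    rw [hkereq]; exact fourier_twoKer _ _ hM₁ hM₂ Δ
  set D := ‖n‖ * (‖m‖ / S.k) with hD
  have hD0 : 0 ≤ D := by positivity
  -- below this level the remainder contributes at most half of the norm to be estimated
  set η := 1 / (2 * (D * S.G + 1)) with hη
  have hηpos : 0 < η := by positivity
  have hηD : D * (S.G * η) ≤ 1 / 2 := by
    rw [hη, ← mul_assoc, mul_one_div, div_le_div_iff₀ (by positivity) (by norm_num)]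
    linarith
  set Cf := S.θ₁ * l2 (expKer S.m₁ 0) + S.θ₂ * l2 (expKer S.m₂ 0) with hCf
  have hCf0 : 0 ≤ Cf := by
    have := l2_nonneg (expKer S.m₁ 0); have := l2_nonneg (expKer S.m₂ 0); positivity
  set CI := Real.exp (β * Δ) * (S.θ₁ * √Δ) with hCI
  refine ⟨η, hηpos, 2 * (‖n‖ * Cf + D * CI) + 1, by positivity, ?_⟩
  intro d hd η' hη' x₁ x₂ hx
  have hη0 := hx.eta_nonneg
  set V := restr (Ici 0) (S.out x₁ x₂) with hV
  set N := restr (Ici 0) (fun t => S.rem (S.out x₁ x₂ t)) with hN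
  set I := restr (Ico (-Δ) 0) (fun t => S.g (S.out x₁ x₂ t)) with hI
  set J := S.input Δ (Ici 0) x₁ x₂ with hJ
  obtain ⟨cI, hcI⟩ := exists_bound_restr_Ico hx.cont_g_init
  have hI2 : MemLp I 2 := memLp_restr_Ico hx.cont_g_init
  have hIm : AEStronglyMeasurable I := hI2.1
  have hV0 : ∀ t < 0, V t = 0 := fun t ht => restr_of_notMem _ (by simpa using ht)
  have hN0 : ∀ t < 0, N t = 0 := fun t ht => restr_of_notMem _ (by simpa using ht)
  have hI0 : ∀ t < -Δ, I t = 0 := fun t ht => restr_of_notMem _ fun h => not_le.2 ht h.1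
  have hJa : ∀ t, J t = (S.k : ℂ)⁻¹ * (I t + N t) := fun _ => rfl
  have hJm : AEStronglyMeasurable J := (hIm.add (hx.meas_rem hΔ)).const_mul _
  have hJb : ∀ t, ‖J t‖ ≤ ‖(S.k : ℂ)⁻¹‖ * (cI + S.G * η' * η') := fun t => by
    rw [hJa, norm_mul]
    gcongr
    exact (norm_add_le _ _).trans (add_le_add (hcI t) (hx.norm_rem_le t))
  have hJ0 : ∀ t < -Δ, J t = 0 := fun t ht => by
    rw [hJa, hI0 t ht, hN0 t (by linarith)]; simp
  have hVi := integrable_weighted hβ' (hx.meas_out hΔ) hx.norm_out_le hV0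
  have hV2 := memLp_weighted hβ' (hx.meas_out hΔ) hx.norm_out_le hV0
  have hJi := integrable_weighted hβ' hJm hJb hJ0
  have hJ2 := memLp_weighted hβ' hJm hJb hJ0
  have hN2 := memLp_weighted hβ' (hx.meas_rem hΔ) hx.norm_rem_le hN0
  have hIw2 := memLp_weighted hβ' hIm hcI hI0
  have hc2 := memLp_conv hkerI hkerF hJi hJ2
  have hf2 : MemLp (weighted β (S.free x₁ x₂)) 2 := by
    rw [weighted_free]
    have e1 : 0 < ((S.m₁ : ℂ) + β).re := by simpa using hM₁
    have e2 : 0 < ((S.m₂ : ℂ) + β).re := by simpa using hM₂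
    exact ((memLp_expKer e1 0).const_mul _).add ((memLp_expKer e2 0).const_mul _)
  have heq : weighted β V + conv (weighted β (S.ker Δ)) (weighted β V)
      = weighted β (S.free x₁ x₂) - conv (weighted β (S.ker Δ)) (weighted β J) := by
    ext t
    exact weighted_loop_equation β (hx.loop_equation hΔ t)
  have h1 := eLpNorm_le_of_symbol hkerI hkerF hmn hVi hV2
  change l2 (weighted β V) ≤ ‖n‖ * l2 (weighted β V + conv _ (weighted β V)) at h1
  rw [heq] at h1
  have h2 := l2_sub_le hf2 hc2
  have h3 : l2 (conv (weighted β (S.ker Δ)) (weighted β J)) ≤ ‖m‖ * l2 (weighted β J) :=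
    eLpNorm_conv_le hkerI hkerF hJi hJ2
  have h4 : l2 (weighted β J) ≤ S.k⁻¹ * (l2 (weighted β I) + l2 (weighted β N)) := by
    refine (l2_le_mul (hIw2.add hN2) (c := S.k⁻¹) (by positivity) fun t => ?_).trans ?_
    · have e : weighted β J t = (S.k : ℂ)⁻¹ * (weighted β I + weighted β N) t := by
        rw [weighted, hJa, Pi.add_apply, weighted, weighted]; ring
      rw [e, norm_mul, norm_inv, Complex.norm_of_nonneg hk.le]
    · gcongr
      exact l2_add_le hIw2 hN2
  have h5 : l2 (weighted β N) ≤ S.G * η * l2 (weighted β V) := by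
    refine l2_le_mul hV2 (by positivity) fun t => ?_
    rw [weighted, weighted, norm_mul, norm_mul, mul_left_comm]
    gcongr
    exact (hx.norm_rem_le_mul t).trans (by gcongr)
  have h6 : l2 (weighted β I) ≤ CI * d := by
    have e1 := l2_le_mul (f := weighted β I) hI2 (c := Real.exp (β * Δ)) (by positivity) fun t => by
      rw [weighted, norm_mul]
      by_cases ht : t ∈ Ico (-Δ) 0
      · gcongr
        rw [Complex.norm_exp]
        refine Real.exp_le_exp.2 ?_
        have : (-(β : ℂ) * t).re = -β * t := by simp
        rw [this]
        nlinarith [ht.1]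
      · rw [hI, restr_of_notMem _ ht]; simp
    have e2 := l2_restr_Ico_le (by linarith : -Δ ≤ 0) hx.cont_g_init (C := S.θ₁ * d)
      (by positivity) fun t ht => by
        refine (S.g_lip _).trans (le_of_eq ?_)
        rw [hx.out_init (Ico_subset_Icc_self ht), abs_mul, abs_neg, abs_of_pos hθ₁, abs_of_pos hd]
    rw [zero_sub, neg_neg] at e2
    calc _ ≤ Real.exp (β * Δ) * (S.θ₁ * d * √Δ) := e1.trans (by gcongr)
      _ = _ := by rw [hCI]; ring
  have h0mem : (0:ℝ) ∈ Icc (-Δ) 0 := ⟨by linarith, le_rfl⟩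
  have h7 : l2 (weighted β (S.free x₁ x₂)) ≤ Cf * d := by
    refine le_trans ?_ (l2_free_le (S := S) (x₁ := x₁) (x₂ := x₂) (δ := d) ?_ ?_)
    · refine l2_mono memLp_free fun t => ?_
      rw [weighted, norm_mul]
      rcases lt_or_ge t 0 with h | h
      · simp [free, twoKer, expKer_of_lt h]
      · refine mul_le_of_le_one_left (norm_nonneg _) ?_
        rw [Complex.norm_exp, Real.exp_le_one_iff]
        have : (-(β : ℂ) * t).re = -β * t := by simp
        rw [this]
        nlinarith
    · rw [hx.init₁ 0 h0mem, abs_of_pos hd]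
    · rw [hx.init₂ 0 h0mem, abs_zero]; exact hd.le
  have hVn := l2_nonneg (weighted β V)
  have h8 : l2 (weighted β V) ≤ ‖n‖ * (Cf * d) + D * (CI * d + S.G * η * l2 (weighted β V)) := by
    calc l2 (weighted β V) ≤ ‖n‖ * (Cf * d + ‖m‖ * (S.k⁻¹ * (CI * d
          + S.G * η * l2 (weighted β V)))) := by
          refine h1.trans ?_
          gcongr
          refine h2.trans (add_le_add h7 (h3.trans ?_))
          gcongr
          refine h4.trans ?_
          gcongr
      _ = _ := by rw [hD]; field_simp
  have h9 : D * (S.G * η) * l2 (weighted β V) ≤ 1 / 2 * l2 (weighted β V) := by gcongr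
  nlinarith

end Loop

theorem integral_weighted_restr_const {z : ℂ} (hz : z ≠ 0) {Δ : ℝ} (hΔ : 0 ≤ Δ) (r : ℝ)
    {f : ℝ → ℝ} (hf : ∀ t ∈ Ico (-Δ) 0, f t = r) :
    ∫ t, weighted z (restr (Ico (-Δ) 0) f) t = r * ((Complex.exp (z * Δ) - 1) / z) := by
  have h1 : weighted z (restr (Ico (-Δ) 0) f)
      = (Ico (-Δ) 0).indicator fun t => (r : ℂ) * Complex.exp (-z * t) := by
    ext t
    by_cases ht : t ∈ Ico (-Δ) 0
    · rw [weighted, restr_of_mem _ ht, indicator_of_mem ht, hf t ht, mul_comm]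
    · rw [weighted, restr_of_notMem _ ht, indicator_of_notMem ht, mul_zero]
  rw [h1, integral_indicator measurableSet_Ico, integral_Ico_eq_integral_Ioc,
    ← intervalIntegral.integral_of_le (by linarith), intervalIntegral.integral_const_mul,
    integral_exp_mul_complex (neg_ne_zero.2 hz)]
  congr 1
  rw [div_eq_div_iff (neg_ne_zero.2 hz) hz]
  push_cast
  simp
  ring

/-- At a characteristic exponent with positive real part, the constant history `(d, 0)` has a
nonzero Laplace moment: otherwise `a + b (z + m₁) / (z + m₂) + m₁ = 0`, while the real part of
`(z + m₁) / (z + m₂)` is positive. -/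
theorem moment_ne_zero {a b m₁ m₂ Δ : ℝ} (ha : 0 < a) (hb : 0 < b) (hm₁ : 0 < m₁) (hm₂ : 0 < m₂)
    {z : ℂ} (hz : 0 < z.re) (h : charFn a b m₁ m₂ Δ z = 0) :
    1 / (m₁ + z) + (Complex.exp (z * Δ) - 1) / z ≠ 0 := by
  have hne : ∀ m : ℝ, 0 < m → z + m ≠ 0 := fun m hm h => by
    have := congrArg Complex.re h
    simp at this
    linarith
  have hz0 : z ≠ 0 := fun h => by rw [h] at hz; simp at hz
  have h1 := hne m₁ hm₁
  have h2 := hne m₂ hm₂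
  have hA : Complex.exp (z * Δ) = - transfer a b m₁ m₂ z := by
    have e : Complex.exp (z * Δ) * Complex.exp (-z * Δ) = 1 := by
      rw [← Complex.exp_add]; simp
    have : Complex.exp (z * Δ) * charFn a b m₁ m₂ Δ z = 0 := by rw [h, mul_zero]
    rw [charFn, mul_add, ← mul_assoc, e] at this
    linear_combination this
  intro h0
  rw [hA, transfer, add_comm (m₁ : ℂ) z] at h0
  have h3 : (a : ℂ) + b * ((z + m₁) / (z + m₂)) + m₁ = 0 := by
    field_simp at h0 ⊢
    linear_combination -h0
  have h4 := congrArg Complex.re h3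
  have h5 : 0 < ((z + m₁) / (z + m₂)).re := by
    rw [Complex.div_re, ← add_div]
    refine div_pos ?_ (Complex.normSq_pos.2 h2)
    simp
    nlinarith [mul_pos (add_pos hz hm₁) (add_pos hz hm₂), mul_self_nonneg z.im]
  simp only [Complex.add_re, Complex.ofReal_re, Complex.mul_re, Complex.ofReal_im, zero_mul,
    sub_zero, Complex.zero_re] at h4
  nlinarith [mul_pos hb h5]

namespace Loop

variable {S : Loop} {Δ : ℝ} {x₁ x₂ : ℝ → ℝ}

namespace IsSmallStep

variable {d η : ℝ}

/-- The Laplace transform of the loop equation at a characteristic exponent. The unknown output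
drops out, which leaves a balance between the initial function and the nonlinear remainder. -/
theorem moment_identity (h : IsSmallStep S Δ d η x₁ x₂) (hΔ : 0 ≤ Δ) {z : ℂ} (hz : 0 < z.re)
    (hroot : charFn S.a S.b S.m₁ S.m₂ Δ z = 0) :
    (-S.θ₁ * d : ℝ) * (1 / (S.m₁ + z) + (Complex.exp (z * Δ) - 1) / z)
      = -((S.k : ℂ)⁻¹ * (S.rem (-S.θ₁ * d) * ((Complex.exp (z * Δ) - 1) / z)
        + ∫ t, weighted z (restr (Ici 0) fun t => S.rem (S.out x₁ x₂ t)) t)) := by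
  have hk := S.k_pos
  have hz0 : z ≠ 0 := fun h => by rw [h] at hz; simp at hz
  have hM₁ : 0 < ((S.m₁ : ℂ) + z).re := by simpa using add_pos S.m₁_pos hz
  have hM₂ : 0 < ((S.m₂ : ℂ) + z).re := by simpa using add_pos S.m₂_pos hz
  set V := restr (Ici 0) (S.out x₁ x₂) with hV
  set N := restr (Ici 0) (fun t => S.rem (S.out x₁ x₂ t)) with hN
  set I := restr (Ico (-Δ) 0) (fun t => S.g (S.out x₁ x₂ t)) with hI
  set J := S.input Δ (Ici 0) x₁ x₂ with hJ
  obtain ⟨cI, hcI⟩ := exists_bound_restr_Ico h.cont_g_init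
  have hIm : AEStronglyMeasurable I := (memLp_restr_Ico h.cont_g_init).1
  have hV0 : ∀ t < 0, V t = 0 := fun t ht => restr_of_notMem _ (by simpa using ht)
  have hN0 : ∀ t < 0, N t = 0 := fun t ht => restr_of_notMem _ (by simpa using ht)
  have hI0 : ∀ t < -Δ, I t = 0 := fun t ht => restr_of_notMem _ fun h => not_le.2 ht h.1
  have hVi := integrable_weighted hz (h.meas_out hΔ) h.norm_out_le hV0
  have hNi := integrable_weighted hz (h.meas_rem hΔ) h.norm_rem_le hN0
  have hIi := integrable_weighted hz hIm hcI hI0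
  have hJw : weighted z J = fun t => (S.k : ℂ)⁻¹ * (weighted z I t + weighted z N t) := by
    ext t
    simp only [hJ, input, weighted, ← hI, ← hN]
    ring
  have hJi : Integrable (weighted z J) := by
    rw [hJw]; exact (hIi.add hNi).const_mul _
  have hkI : Integrable (weighted z (S.ker Δ)) := by
    rw [weighted_ker]; exact integrable_twoKer _ _ hM₁ hM₂ Δ
  have hfI : Integrable (weighted z (S.free x₁ x₂)) := by
    rw [weighted_free]; exact integrable_twoKer _ _ hM₁ hM₂ 0
  have hkint : ∫ t, weighted z (S.ker Δ) t = -1 := by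
    rw [weighted_ker, integral_twoKer _ _ hM₁ hM₂]
    rw [charFn, transfer] at hroot
    rw [add_comm (S.m₁ : ℂ), add_comm (S.m₂ : ℂ)]
    linear_combination hroot
  have h0mem : (0:ℝ) ∈ Icc (-Δ) 0 := ⟨by linarith, le_rfl⟩
  have hfint : ∫ t, weighted z (S.free x₁ x₂) t = (-S.θ₁ * d : ℝ) / (S.m₁ + z) := by
    rw [weighted_free, integral_twoKer _ _ hM₁ hM₂, h.init₁ 0 h0mem, h.init₂ 0 h0mem]
    simp
  have hIint : ∫ t, weighted z I t
      = S.g (-S.θ₁ * d) * ((Complex.exp (z * Δ) - 1) / z) :=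
    integral_weighted_restr_const hz0 hΔ _ fun t ht => by
      rw [h.out_init (Ico_subset_Icc_self ht)]
  have hJint : ∫ t, weighted z J t
      = (S.k : ℂ)⁻¹ * (S.g (-S.θ₁ * d) * ((Complex.exp (z * Δ) - 1) / z)
        + ∫ t, weighted z N t) := by
    rw [hJw, integral_const_mul, integral_add hIi hNi, hIint]
  have heq : ∀ t, weighted z V t + conv (weighted z (S.ker Δ)) (weighted z V) t
      = weighted z (S.free x₁ x₂) t - conv (weighted z (S.ker Δ)) (weighted z J) t :=
    fun t => weighted_loop_equation z (h.loop_equation hΔ t)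
  have hcV : Integrable (conv (weighted z (S.ker Δ)) (weighted z V)) := integrable_conv hkI hVi
  have hcJ : Integrable (conv (weighted z (S.ker Δ)) (weighted z J)) := integrable_conv hkI hJi
  have e := congrArg (fun f : ℝ → ℂ => ∫ t, f t) (funext heq)
  rw [integral_add hVi hcV, integral_sub hfI hcJ, integral_conv hkI hVi, integral_conv hkI hJi,
    hkint, hfint, hJint] at e
  have hg : (S.g (-S.θ₁ * d) : ℂ) = S.k * (-S.θ₁ * d : ℝ) + S.rem (-S.θ₁ * d) := by
    rw [rem]; push_cast; ring
  have hkk : (S.k : ℂ)⁻¹ * S.k = 1 := inv_mul_cancel₀ (by exact_mod_cast hk.ne')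
  rw [hg] at e
  linear_combination -e - (-S.θ₁ * d : ℝ) * ((Complex.exp (z * Δ) - 1) / z) * hkk

end IsSmallStep

/-- If there is a characteristic exponent with positive real part, no trajectory from a constant
history `(d, 0)` stays small: the left side of `moment_identity` is of order `d`, and its right side
of order `η d`. -/
theorem exists_not_isSmallStep (hΔ : 0 ≤ Δ) {z : ℂ} (hz : 0 < z.re)
    (hroot : charFn S.a S.b S.m₁ S.m₂ Δ z = 0) :
    ∃ η > 0, ∀ d > 0, S.θ₁ * d ≤ η → ∀ x₁ x₂, ¬ IsSmallStep S Δ d η x₁ x₂ := by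
  have hk := S.k_pos
  have hG := S.G_pos
  have hθ₁ := S.θ₁_pos
  obtain ⟨β, hβ, hline⟩ := exists_line_without_roots (Δ := Δ) S.a_pos S.b_pos S.m₁_pos S.m₂_pos hz
  obtain ⟨η₀, hη₀, C, hC, hCb⟩ := l2_weighted_out_le hΔ hβ.1 hline
  -- `|exp (-z t)|` splits into the weight `exp (-β t)`, for which the output is controlled in `L²`,
  -- and a decaying factor of rate `γ`
  set γ : ℂ := ((z.re - β : ℝ) : ℂ) with hγ
  have hγre : 0 < γ.re := by rw [hγ, Complex.ofReal_re]; linarith [hβ.2]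
  set K := l2 (expKer γ 0) with hK
  set E := (Complex.exp (z * Δ) - 1) / z with hE
  set c := ‖1 / (S.m₁ + z) + E‖ with hc
  have hc0 : 0 < c := norm_pos_iff.2 (moment_ne_zero S.a_pos S.b_pos S.m₁_pos S.m₂_pos hz hroot)
  set Q := S.k⁻¹ * (S.G * S.θ₁ * ‖E‖ + S.G * (K ^ 2 + C ^ 2)) with hQ
  have hQ0 : 0 ≤ Q := by positivity
  set η := min η₀ (S.θ₁ * c / (Q + 1) / 2) with hη
  have hηpos : 0 < η := lt_min hη₀ (by positivity)
  refine ⟨η, hηpos, fun d hd hdη x₁ x₂ h => ?_⟩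
  have hV := hCb d hd η (min_le_left _ _) x₁ x₂ h
  have hβre : 0 < (β : ℂ).re := by simpa using hβ.1
  have hV0 : ∀ t < 0, restr (Ici 0) (S.out x₁ x₂) t = 0 :=
    fun t ht => restr_of_notMem _ (by simpa using ht)
  have hV2 := memLp_weighted hβre (h.meas_out hΔ) h.norm_out_le hV0
  have hE2 := memLp_expKer hγre 0
  have hNint : ‖∫ t, weighted z (restr (Ici 0) fun t => S.rem (S.out x₁ x₂ t)) t‖
      ≤ S.G * η * (d * K ^ 2 + d⁻¹ * (C * d) ^ 2) := by
    have hs1 := (memLp_two_iff_integrable_sq_norm hE2.1).1 hE2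
    have hs2 := (memLp_two_iff_integrable_sq_norm hV2.1).1 hV2
    refine (norm_integral_le_of_norm_le (g := fun t => S.G * η *
      (d * ‖expKer γ 0 t‖ ^ 2 + d⁻¹ * ‖weighted β (restr (Ici 0) (S.out x₁ x₂)) t‖ ^ 2))
      (((hs1.const_mul _).add (hs2.const_mul _)).const_mul _) (Eventually.of_forall fun t => ?_)).trans
      ?_
    · have e1 : ‖weighted z (restr (Ici 0) fun t => S.rem (S.out x₁ x₂ t)) t‖
          ≤ S.G * η * (‖expKer γ 0 t‖ * ‖weighted β (restr (Ici 0) (S.out x₁ x₂)) t‖) := by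
        rcases lt_or_ge t 0 with ht | ht
        · rw [weighted, restr_of_notMem _ (by simpa using ht), mul_zero, norm_zero]
          positivity
        · have e2 : ‖Complex.exp (-z * t)‖ = ‖expKer γ 0 t‖ * ‖Complex.exp (-(β : ℂ) * t)‖ := by
            rw [norm_expKer_of_le ht, Complex.norm_exp, Complex.norm_exp, ← Real.exp_add]
            congr 1
            simp [hγ]
            ring
          rw [weighted, weighted, norm_mul, norm_mul, e2]
          calc _ ≤ ‖expKer γ 0 t‖ * ‖Complex.exp (-(β : ℂ) * t)‖
                * (S.G * η * ‖restr (Ici 0) (S.out x₁ x₂) t‖) := by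
                gcongr; exact h.norm_rem_le_mul t
            _ = _ := by ring
      refine e1.trans ?_
      gcongr
      set p := ‖expKer γ 0 t‖
      set q := ‖weighted β (restr (Ici 0) (S.out x₁ x₂)) t‖
      have hdi : d * d⁻¹ = 1 := mul_inv_cancel₀ hd.ne'
      -- `2 p q ≤ d p² + q² / d`: the weights keep the bound linear in `d`, as `q` is of order `d`
      have : d * p ^ 2 + d⁻¹ * q ^ 2 - 2 * (p * q) = d * (p - d⁻¹ * q) ^ 2 := by
        linear_combination (2 * p * q - d⁻¹ * q ^ 2) * hdi
      have : 0 ≤ d * (p - d⁻¹ * q) ^ 2 := by positivity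
      have : 0 ≤ p * q := by positivity
      linarith
    · rw [integral_const_mul, integral_add (hs1.const_mul _) (hs2.const_mul _),
        integral_const_mul, integral_const_mul, ← l2_sq hE2, ← l2_sq hV2]
      have := l2_nonneg (weighted β (restr (Ici 0) (S.out x₁ x₂)))
      gcongr
  have hid := congrArg norm (h.moment_identity hΔ hz hroot)
  rw [norm_mul, norm_neg, norm_mul, Complex.norm_real, Real.norm_eq_abs, abs_mul, abs_neg,
    abs_of_pos hθ₁, abs_of_pos hd, norm_inv, Complex.norm_of_nonneg hk.le] at hid
  have hrem : ‖(S.rem (-S.θ₁ * d) : ℂ)‖ ≤ S.G * η * (S.θ₁ * d) := by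
    have habs : |(-S.θ₁ * d)| = S.θ₁ * d := by
      rw [abs_mul, abs_neg, abs_of_pos hθ₁, abs_of_pos hd]
    rw [Complex.norm_real, Real.norm_eq_abs]
    exact (abs_rem_le (habs.trans_le hdη)).trans_eq (by rw [habs])
  have hfin : S.θ₁ * d * c ≤ η * Q * d := by
    rw [hc, hid]
    calc _ ≤ S.k⁻¹ * (S.G * η * (S.θ₁ * d) * ‖E‖ + S.G * η * (d * K ^ 2 + d⁻¹ * (C * d) ^ 2)) := by
          gcongr
          refine (norm_add_le _ _).trans (add_le_add ?_ hNint)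
          rw [norm_mul]
          gcongr
      _ = _ := by rw [hQ]; field_simp
  have h1 : η * (Q + 1) ≤ S.θ₁ * c / 2 := by
    have : η ≤ S.θ₁ * c / 2 / (Q + 1) := (min_le_right _ _).trans_eq (by ring)
    rwa [le_div_iff₀ (by positivity)] at this
  have h2 : 0 < S.θ₁ * c := by positivity
  have h3 : S.θ₁ * c ≤ η * Q := by
    refine le_of_mul_le_mul_right ?_ hd
    linarith
  nlinarith

/-- Instability of the loop when there is a characteristic exponent with positive real part. -/
theorem instability (hΔ : 0 < Δ) {z : ℂ} (hz : 0 < z.re)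
    (hroot : charFn S.a S.b S.m₁ S.m₂ Δ z = 0) :
    ∃ η > 0, ∀ δ > 0, ∃ x₁ x₂, S.IsTrajectory Δ x₁ x₂ ∧
      (∀ s ∈ Icc (-Δ) 0, |x₁ s| < δ ∧ |x₂ s| < δ) ∧
      ∃ t, 0 ≤ t ∧ (η ≤ |x₁ t| ∨ η ≤ |x₂ t|) := by
  have hθ₁ := S.θ₁_pos
  have hθ₂ := S.θ₂_pos
  obtain ⟨η, hη, hno⟩ := exists_not_isSmallStep hΔ.le hz hroot
  refine ⟨η / (S.θ₁ + S.θ₂), by positivity, fun δ hδ => ?_⟩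
  set d := min (δ / 2) (η / S.θ₁) with hd
  have hd0 : 0 < d := lt_min (by positivity) (by positivity)
  obtain ⟨x₁, x₂, hx, h1, h2⟩ := S.exists_trajectory hΔ d
  refine ⟨x₁, x₂, hx, fun s hs => ?_, ?_⟩
  · rw [h1 s hs.2, h2 s hs.2, abs_zero, abs_of_pos hd0]
    exact ⟨(min_le_left _ _).trans_lt (by linarith), hδ⟩
  · by_contra! hcon
    refine hno d hd0 ?_ x₁ x₂ ⟨hx, fun t ht => h1 t ht.2, fun t ht => h2 t ht.2, fun t ht => ?_⟩
    · rw [mul_comm, ← le_div_iff₀ hθ₁]; exact min_le_right _ _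
    · obtain ⟨e1, e2⟩ := hcon t ht
      refine (abs_out_le e1.le e2.le).trans_eq ?_
      field_simp

end Loop

/-! ### Location of the characteristic exponents -/

section Roots

variable {a b m₁ m₂ : ℝ}

theorem add_ofReal_ne_zero {z : ℂ} (hz : 0 ≤ z.re) {m : ℝ} (hm : 0 < m) : z + m ≠ 0 := fun h => by
  have := congrArg Complex.re h
  simp at this
  linarith

theorem normSq_transfer (hm₁ : 0 < m₁) (hm₂ : 0 < m₂) {z : ℂ} (hz : 0 ≤ z.re) :
    Complex.normSq (transfer a b m₁ m₂ z)
      = (((a + b) * z.re + (a * m₂ + b * m₁)) ^ 2 + (a + b) ^ 2 * z.im ^ 2)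
        / (((z.re + m₁) ^ 2 + z.im ^ 2) * ((z.re + m₂) ^ 2 + z.im ^ 2)) := by
  have h : transfer a b m₁ m₂ z
      = ((a + b : ℝ) * z + (a * m₂ + b * m₁ : ℝ)) / ((z + m₁) * (z + m₂)) := by
    have := add_ofReal_ne_zero hz hm₁
    have := add_ofReal_ne_zero hz hm₂
    rw [transfer]
    field_simp
    push_cast
    ring
  rw [h, map_div₀, map_mul, Complex.normSq_apply, Complex.normSq_apply, Complex.normSq_apply]
  simp only [Complex.add_re, Complex.mul_re, Complex.ofReal_re, Complex.ofReal_im, Complex.add_im,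
    Complex.mul_im, zero_mul, sub_zero, add_zero]
  congr 1 <;> ring

theorem re_inv_add {z : ℂ} {m : ℝ} (r : ℝ) :
    ((r : ℂ) / (z + m)).re = r * (z.re + m) / ((z.re + m) ^ 2 + z.im ^ 2) := by
  rw [Complex.div_re]
  simp [Complex.normSq_apply]
  rw [sq, sq]

theorem re_transfer (z : ℂ) : (transfer a b m₁ m₂ z).re
    = a * (z.re + m₁) / ((z.re + m₁) ^ 2 + z.im ^ 2)
      + b * (z.re + m₂) / ((z.re + m₂) ^ 2 + z.im ^ 2) := by
  rw [transfer, Complex.add_re, re_inv_add, re_inv_add]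

theorem re_transfer_pos (ha : 0 < a) (hb : 0 < b) (hm₁ : 0 < m₁) (hm₂ : 0 < m₂) {z : ℂ}
    (hz : 0 ≤ z.re) : 0 < (transfer a b m₁ m₂ z).re := by
  rw [re_transfer]
  positivity

theorem im_transfer_nonpos (ha : 0 < a) (hb : 0 < b) {z : ℂ} (hz : 0 ≤ z.im) :
    (transfer a b m₁ m₂ z).im ≤ 0 := by
  have h : ∀ r m : ℝ, 0 < r → ((r : ℂ) / (z + m)).im ≤ 0 := fun r m hr => by
    rw [Complex.div_im]
    simp only [Complex.ofReal_im, zero_mul, zero_div, Complex.ofReal_re, Complex.add_im, add_zero,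
      zero_sub, Left.neg_nonpos_iff]
    exact div_nonneg (mul_nonneg hr.le hz) (Complex.normSq_nonneg _)
  rw [transfer, Complex.add_im]
  linarith [h a m₁ ha, h b m₂ hb]

/-- The square of the crossing frequency: the positive root `Ω` of
`Ω² + (m₁² + m₂² - (a + b)²) Ω + m₁² m₂² - (a m₂ + b m₁)²`, which is the equation
`|transfer (i √Ω)| = 1`. -/
def critSq (a b m₁ m₂ : ℝ) : ℝ :=
  (-(m₁ ^ 2 + m₂ ^ 2 - (a + b) ^ 2) + √((m₁ ^ 2 + m₂ ^ 2 - (a + b) ^ 2) ^ 2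
    - 4 * (m₁ ^ 2 * m₂ ^ 2 - (a * m₂ + b * m₁) ^ 2))) / 2

/-- The smallest delay with a characteristic exponent on the imaginary axis. The argument of `arccos`
is minus the real part of `transfer` at the crossing frequency. -/
def critDelay (a b m₁ m₂ : ℝ) : ℝ :=
  Real.arccos (-(a * m₁ / (m₁ ^ 2 + critSq a b m₁ m₂) + b * m₂ / (m₂ ^ 2 + critSq a b m₁ m₂)))
    / √(critSq a b m₁ m₂)

theorem critSq_spec (hm₁ : 0 < m₁) (hm₂ : 0 < m₂) (hc : m₁ * m₂ < a * m₂ + b * m₁) :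
    critSq a b m₁ m₂ ^ 2 + (m₁ ^ 2 + m₂ ^ 2 - (a + b) ^ 2) * critSq a b m₁ m₂
      + (m₁ ^ 2 * m₂ ^ 2 - (a * m₂ + b * m₁) ^ 2) = 0 ∧ 0 < critSq a b m₁ m₂ := by
  set B := m₁ ^ 2 + m₂ ^ 2 - (a + b) ^ 2 with hB
  set D := m₁ ^ 2 * m₂ ^ 2 - (a * m₂ + b * m₁) ^ 2 with hD
  have hD0 : D < 0 := by
    have : 0 < m₁ * m₂ := mul_pos hm₁ hm₂
    rw [hD]; nlinarith
  have hnn : 0 ≤ B ^ 2 - 4 * D := by nlinarith [sq_nonneg B]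
  have hs := Real.sq_sqrt hnn
  have hcr : critSq a b m₁ m₂ = (-B + √(B ^ 2 - 4 * D)) / 2 := rfl
  refine ⟨by rw [hcr]; linear_combination (1 / 4) * hs, ?_⟩
  have : |B| < √(B ^ 2 - 4 * D) := by
    rw [← Real.sqrt_sq_eq_abs]
    exact Real.sqrt_lt_sqrt (sq_nonneg _) (by linarith)
  rw [hcr]
  linarith [le_abs_self B]

theorem normSq_transfer_imag (hm₁ : 0 < m₁) (hm₂ : 0 < m₂) (hc : m₁ * m₂ < a * m₂ + b * m₁)
    {z : ℂ} (hz : z.re = 0) :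
    (Complex.normSq (transfer a b m₁ m₂ z) = 1 ↔ z.im ^ 2 = critSq a b m₁ m₂) ∧
      (z.im ^ 2 < critSq a b m₁ m₂ → 1 < Complex.normSq (transfer a b m₁ m₂ z)) := by
  obtain ⟨hΩ, hΩ0⟩ := critSq_spec hm₁ hm₂ hc
  set Ω := critSq a b m₁ m₂
  rw [normSq_transfer hm₁ hm₂ hz.ge, hz, div_eq_one_iff_eq (by positivity),
    one_lt_div (by positivity)]
  set B := m₁ ^ 2 + m₂ ^ 2 - (a + b) ^ 2 with hB
  set s := z.im ^ 2 with hs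
  have hs0 : 0 ≤ s := sq_nonneg _
  have hB0 : 0 < Ω + B := by
    have : 0 < m₁ * m₂ := mul_pos hm₁ hm₂
    have h1 : Ω * (Ω + B) = (a * m₂ + b * m₁) ^ 2 - (m₁ * m₂) ^ 2 := by linear_combination hΩ
    have h2 : 0 < Ω * (Ω + B) := by rw [h1]; nlinarith
    exact pos_of_mul_pos_right h2 hΩ0.le
  -- the second root of the quadratic is `-(Ω + B) < 0`
  have key : ((0 + m₁) ^ 2 + s) * ((0 + m₂) ^ 2 + s)
      - (((a + b) * 0 + (a * m₂ + b * m₁)) ^ 2 + (a + b) ^ 2 * s) = (s - Ω) * (s + Ω + B) := by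
    rw [hB]; linear_combination hΩ
  constructor
  · constructor
    · intro h
      rw [h, sub_self, eq_comm, mul_eq_zero] at key
      rcases key with h | h <;> linarith
    · intro h
      rw [h, sub_self, zero_mul] at key
      rw [h]; linarith
  · intro h
    nlinarith

/-- The modulus of the transfer function decreases strictly along horizontal rays in the right
half-plane, provided the two rates are comparable. The hypothesis `hr` is what makes the mixed
term monotone. -/
theorem normSq_transfer_lt (ha : 0 < a) (hb : 0 < b) (hm₁ : 0 < m₁) (hm₂ : 0 < m₂)
    (hr : (m₁ - m₂) ^ 2 ≤ 4 * (m₁ * m₂)) {z w : ℂ} (hz : 0 ≤ z.re) (hzw : z.re < w.re)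
    (him : z.im = w.im) :
    Complex.normSq (transfer a b m₁ m₂ w) < Complex.normSq (transfer a b m₁ m₂ z) := by
  -- by the identity `(P² + s) (Q² + s) = (P Q + s)² + s (P - Q)²`, in which `P - Q` does not depend
  -- on the real part, the mixed term is `u / (u² + const)` with `u = P Q + s`
  have split : ∀ z : ℂ, 0 ≤ z.re → Complex.normSq (transfer a b m₁ m₂ z)
      = a ^ 2 / ((z.re + m₁) ^ 2 + z.im ^ 2) + b ^ 2 / ((z.re + m₂) ^ 2 + z.im ^ 2)
        + 2 * a * b * (((z.re + m₁) * (z.re + m₂) + z.im ^ 2)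
          / (((z.re + m₁) * (z.re + m₂) + z.im ^ 2) ^ 2 + z.im ^ 2 * (m₁ - m₂) ^ 2)) := by
    intro z hz
    have e : ((z.re + m₁) * (z.re + m₂) + z.im ^ 2) ^ 2 + z.im ^ 2 * (m₁ - m₂) ^ 2
        = ((z.re + m₁) ^ 2 + z.im ^ 2) * ((z.re + m₂) ^ 2 + z.im ^ 2) := by ring
    rw [normSq_transfer hm₁ hm₂ hz, e]
    have h1 : 0 < (z.re + m₁) ^ 2 + z.im ^ 2 := by positivity
    have h2 : 0 < (z.re + m₂) ^ 2 + z.im ^ 2 := by positivity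
    field_simp
    ring
  rw [split z hz, split w (hz.trans hzw.le), ← him]
  set s := z.im ^ 2 with hs
  have hs0 : 0 ≤ s := sq_nonneg _
  set x := z.re
  set x' := w.re
  set u := (x + m₁) * (x + m₂) + s with hu
  set u' := (x' + m₁) * (x' + m₂) + s with hu'
  have hx' : 0 ≤ x' := hz.trans hzw.le
  have hu0 : 0 < u := by positivity
  have huu : u < u' := by rw [hu, hu']; gcongr
  have hu0' := hu0.trans huu
  -- `u ↦ u / (u² + e)` decreases where `u² ≥ e`; the inequality of means gives `u² ≥ 4 s P Q`
  have he : s * (m₁ - m₂) ^ 2 ≤ u * u' := by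
    have h1 : m₁ * m₂ ≤ (x + m₁) * (x + m₂) := by nlinarith
    have h2 : 4 * s * ((x + m₁) * (x + m₂)) ≤ u * u := by
      rw [hu]; nlinarith [sq_nonneg ((x + m₁) * (x + m₂) - s)]
    have h3 : s * (m₁ - m₂) ^ 2 ≤ s * (4 * ((x + m₁) * (x + m₂))) := by gcongr; linarith
    have h4 : u * u ≤ u * u' := by gcongr
    linarith
  have t1 : a ^ 2 / ((x' + m₁) ^ 2 + s) < a ^ 2 / ((x + m₁) ^ 2 + s) := by gcongr
  have t2 : b ^ 2 / ((x' + m₂) ^ 2 + s) < b ^ 2 / ((x + m₂) ^ 2 + s) := by gcongr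
  have t3 : u' / (u' ^ 2 + s * (m₁ - m₂) ^ 2) ≤ u / (u ^ 2 + s * (m₁ - m₂) ^ 2) := by
    rw [div_le_div_iff₀ (by positivity) (by positivity)]
    nlinarith [mul_nonneg (sub_nonneg.2 huu.le) (sub_nonneg.2 he)]
  have t4 : 2 * a * b * (u' / (u' ^ 2 + s * (m₁ - m₂) ^ 2))
      ≤ 2 * a * b * (u / (u ^ 2 + s * (m₁ - m₂) ^ 2)) := by gcongr
  linarith

theorem normSq_eq_one_of_charFn_eq_zero {Δ : ℝ} {z : ℂ} (hz : z.re = 0)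
    (h : charFn a b m₁ m₂ Δ z = 0) :
    Complex.normSq (transfer a b m₁ m₂ z) = 1 ∧
      (transfer a b m₁ m₂ z).re = -Real.cos (z.im * Δ) := by
  have hA : transfer a b m₁ m₂ z = -Complex.exp (z * Δ) := by
    have e : Complex.exp (z * Δ) * Complex.exp (-z * Δ) = 1 := by
      rw [← Complex.exp_add]; simp
    have : Complex.exp (z * Δ) * charFn a b m₁ m₂ Δ z = 0 := by rw [h, mul_zero]
    rw [charFn, mul_add, ← mul_assoc, e] at this
    linear_combination this
  constructor
  · rw [Complex.normSq_eq_norm_sq, hA, norm_neg, Complex.norm_exp]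
    simp [hz]
  · rw [hA, Complex.neg_re, Complex.exp_re]
    simp [hz]

/-- Below the critical delay there is no characteristic exponent on the imaginary axis. -/
theorem charFn_imag_ne_zero (hm₁ : 0 < m₁) (hm₂ : 0 < m₂)
    (hc : m₁ * m₂ < a * m₂ + b * m₁) {Δ : ℝ} (hΔ : 0 ≤ Δ) (hlt : Δ < critDelay a b m₁ m₂) (y : ℝ) :
    charFn a b m₁ m₂ Δ (y * Complex.I) ≠ 0 := by
  intro h
  obtain ⟨hΩ, hΩ0⟩ := critSq_spec hm₁ hm₂ hc
  have hre : ((y : ℂ) * Complex.I).re = 0 := by simp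
  have him : ((y : ℂ) * Complex.I).im = y := by simp
  obtain ⟨h1, h2⟩ := normSq_eq_one_of_charFn_eq_zero hre h
  have h3 := (normSq_transfer_imag hm₁ hm₂ hc hre).1.1 h1
  rw [re_transfer, h3, hre, zero_add, zero_add, him] at h2
  rw [him] at h3
  have hω : |y| = √(critSq a b m₁ m₂) := by rw [← h3, Real.sqrt_sq_eq_abs]
  have hω0 : 0 < √(critSq a b m₁ m₂) := Real.sqrt_pos.2 hΩ0
  rw [critDelay, h2, neg_neg, lt_div_iff₀ hω0, ← Real.cos_abs, abs_mul, abs_of_nonneg hΔ, hω] at hlt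
  have h4 : Δ * √(critSq a b m₁ m₂) < Real.pi := hlt.trans_le (Real.arccos_le_pi _)
  rw [Real.arccos_cos (by positivity) (by linarith [mul_comm Δ √(critSq a b m₁ m₂)])] at hlt
  linarith [mul_comm Δ √(critSq a b m₁ m₂)]

theorem critDelay_pos (ha : 0 < a) (hb : 0 < b) (hm₁ : 0 < m₁) (hm₂ : 0 < m₂)
    (hc : m₁ * m₂ < a * m₂ + b * m₁) : 0 < critDelay a b m₁ m₂ := by
  obtain ⟨hΩ, hΩ0⟩ := critSq_spec hm₁ hm₂ hc
  refine div_pos (Real.arccos_pos.2 ?_) (Real.sqrt_pos.2 hΩ0)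
  have : 0 < a * m₁ / (m₁ ^ 2 + critSq a b m₁ m₂) + b * m₂ / (m₂ ^ 2 + critSq a b m₁ m₂) := by
    positivity
  linarith

theorem continuousAt_transfer (hm₁ : 0 < m₁) (hm₂ : 0 < m₂) {z : ℂ} (hz : 0 ≤ z.re) :
    ContinuousAt (transfer a b m₁ m₂) z := by
  have := add_ofReal_ne_zero hz hm₁
  have := add_ofReal_ne_zero hz hm₂
  unfold transfer
  fun_prop (disch := assumption)

theorem norm_transfer_le (ha : 0 < a) (hb : 0 < b) (hm₁ : 0 < m₁) (hm₂ : 0 < m₂) {z : ℂ}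
    (hz : z.re = a + b) : ‖transfer a b m₁ m₂ z‖ < 1 := by
  have h : ∀ r m : ℝ, 0 < r → 0 < m → ‖(r : ℂ) / (z + m)‖ < r / (a + b) := fun r m hr hm => by
    rw [norm_div, Complex.norm_of_nonneg hr.le]
    have : a + b < ‖z + m‖ := lt_of_lt_of_le (by simpa [hz] using hm) (Complex.re_le_norm _)
    gcongr
  calc _ ≤ _ := norm_add_le _ _
    _ < a / (a + b) + b / (a + b) := add_lt_add (h a m₁ ha hm₁) (h b m₂ hb hm₂)
    _ = 1 := by rw [← add_div]; exact div_self (by positivity)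

/-- The curve in the right half-plane on which `|exp (-z Δ) transfer z| = 1`, as a graph over the
imaginary part. It meets the imaginary axis at the crossing frequency only. -/
theorem exists_level_curve (ha : 0 < a) (hb : 0 < b) (hm₁ : 0 < m₁) (hm₂ : 0 < m₂)
    (hr : (m₁ - m₂) ^ 2 ≤ 4 * (m₁ * m₂)) (hc : m₁ * m₂ < a * m₂ + b * m₁) {Δ : ℝ} (hΔ : 0 ≤ Δ) :
    ∃ x : ℝ → ℝ, ContinuousOn x (Icc 0 √(critSq a b m₁ m₂)) ∧
      ∀ y ∈ Icc 0 √(critSq a b m₁ m₂), 0 ≤ x y ∧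
        ‖transfer a b m₁ m₂ (x y + y * Complex.I)‖ = Real.exp (x y * Δ) ∧
        (y < √(critSq a b m₁ m₂) → 0 < x y) ∧ (y = √(critSq a b m₁ m₂) → x y = 0) := by
  obtain ⟨hΩ, hΩ0⟩ := critSq_spec hm₁ hm₂ hc
  set ω := √(critSq a b m₁ m₂) with hω
  have hω2 : ω ^ 2 = critSq a b m₁ m₂ := Real.sq_sqrt hΩ0.le
  set f : ℝ → ℝ → ℝ := fun x y =>
    Real.exp (-x * Δ) * ‖transfer a b m₁ m₂ (x + y * Complex.I)‖ with hf
  have hre : ∀ x y : ℝ, ((x : ℂ) + y * Complex.I).re = x := fun x y => by simp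
  have him : ∀ x y : ℝ, ((x : ℂ) + y * Complex.I).im = y := fun x y => by simp
  have hanti : ∀ x x' y, 0 ≤ x → x < x' → f x' y < f x y := fun x x' y hx hxx => by
    have h1 := normSq_transfer_lt ha hb hm₁ hm₂ hr (z := x + y * Complex.I)
      (w := x' + y * Complex.I) (by rwa [hre]) (by rwa [hre, hre]) (by rw [him, him])
    rw [Complex.normSq_eq_norm_sq, Complex.normSq_eq_norm_sq] at h1
    have h2 := lt_of_pow_lt_pow_left₀ 2 (norm_nonneg _) h1
    have h3 : Real.exp (-x' * Δ) ≤ Real.exp (-x * Δ) := Real.exp_le_exp.2 (by nlinarith)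
    exact mul_lt_mul' h3 h2 (norm_nonneg _) (Real.exp_pos _)
  have hcx : ∀ y, ContinuousOn (fun x => f x y) (Ici 0) := fun y x hx => by
    have h1 : ContinuousAt (fun x : ℝ => transfer a b m₁ m₂ (x + y * Complex.I)) x :=
      (continuousAt_transfer hm₁ hm₂ (z := (x : ℂ) + y * Complex.I) (by rw [hre]; exact hx)).comp
        (f := fun x : ℝ => (x : ℂ) + y * Complex.I) (by fun_prop)
    exact (ContinuousAt.mul (by fun_prop) h1.norm).continuousWithinAt
  have hcy : ∀ x y, 0 ≤ x → ContinuousAt (fun y => f x y) y := fun x y hx => by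
    have h1 : ContinuousAt (fun y : ℝ => transfer a b m₁ m₂ (x + y * Complex.I)) y :=
      (continuousAt_transfer hm₁ hm₂ (z := (x : ℂ) + y * Complex.I) (by rw [hre]; exact hx)).comp
        (f := fun y : ℝ => (x : ℂ) + y * Complex.I) (by fun_prop)
    exact h1.norm.const_mul _
  have hf0 : ∀ y, f 0 y = ‖transfer a b m₁ m₂ ((0 : ℝ) + y * Complex.I)‖ := fun y => by simp [hf]
  have hgt : ∀ y, 0 ≤ y → y < ω → 1 < f 0 y := fun y hy hyω => by
    have h1 := (normSq_transfer_imag hm₁ hm₂ hc (hre 0 y)).2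
      (by rw [him, ← hω2]; gcongr)
    rw [Complex.normSq_eq_norm_sq] at h1
    rw [hf0]
    exact (one_lt_sq_iff₀ (norm_nonneg _)).1 h1
  have heq : f 0 ω = 1 := by
    have h1 := (normSq_transfer_imag hm₁ hm₂ hc (hre 0 ω)).1.2 (by rw [him, hω2])
    rw [Complex.normSq_eq_norm_sq] at h1
    rw [hf0]
    exact (pow_eq_one_iff_of_nonneg (norm_nonneg _) two_ne_zero).1 h1
  have hge : ∀ y ∈ Icc 0 ω, 1 ≤ f 0 y := fun y hy => by
    rcases hy.2.lt_or_eq with h | h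
    · exact (hgt y hy.1 h).le
    · rw [h, heq]
  have hlt : ∀ y, f (a + b) y < 1 := fun y => by
    have h1 := norm_transfer_le ha hb hm₁ hm₂ (hre (a + b) y)
    have h2 : Real.exp (-(a + b) * Δ) ≤ 1 := Real.exp_le_one_iff.2 (by nlinarith)
    exact mul_lt_one_of_nonneg_of_lt_one_right h2 (norm_nonneg _) h1
  have hex : ∀ y, ∃ x, y ∈ Icc 0 ω → 0 ≤ x ∧ f x y = 1 := fun y => by
    by_cases hy : y ∈ Icc 0 ω
    · obtain ⟨x, hx, hxy⟩ := intermediate_value_Icc' (by positivity : 0 ≤ a + b)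
        ((hcx y).mono Icc_subset_Ici_self) ⟨(hlt y).le, hge y hy⟩
      exact ⟨x, fun _ => ⟨hx.1, hxy⟩⟩
    · exact ⟨0, fun h => absurd h hy⟩
  choose x hx using hex
  -- `f` is strictly decreasing in its first variable, which gives both uniqueness and, by trapping
  -- `x y` between nearby values, continuity
  have hpos : ∀ y ∈ Icc 0 ω, y < ω → 0 < x y := fun y hy h => by
    refine (hx y hy).1.lt_of_ne fun h0 => ?_
    have := (hx y hy).2
    rw [← h0] at this
    linarith [hgt y hy.1 h]
  refine ⟨x, fun y₀ hy₀ => ?_, fun y hy => ⟨(hx y hy).1, ?_, hpos y hy, fun h => ?_⟩⟩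
  · obtain ⟨h0, h1⟩ := hx y₀ hy₀
    refine tendsto_order.2 ⟨fun p hp => ?_, fun p hp => ?_⟩
    · rcases lt_or_ge p 0 with hp0 | hp0
      · filter_upwards [self_mem_nhdsWithin] with y hy
        exact hp0.trans_le (hx y hy).1
      · have h2 : 1 < f p y₀ := h1 ▸ hanti p _ y₀ hp0 hp
        filter_upwards [self_mem_nhdsWithin, nhdsWithin_le_nhds ((hcy p y₀ hp0).eventually
          (lt_mem_nhds h2))] with y hy hy2
        by_contra! hcon
        have := (hx y hy).2
        rcases hcon.lt_or_eq with h | h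
        · linarith [hanti _ p y (hx y hy).1 h]
        · rw [h] at this; linarith
    · have hp0 : 0 ≤ p := h0.trans hp.le
      have h2 : f p y₀ < 1 := h1 ▸ hanti _ p y₀ h0 hp
      filter_upwards [self_mem_nhdsWithin, nhdsWithin_le_nhds ((hcy p y₀ hp0).eventually
        (gt_mem_nhds h2))] with y hy hy2
      by_contra! hcon
      have := (hx y hy).2
      rcases hcon.lt_or_eq with h | h
      · linarith [hanti p _ y hp0 h]
      · rw [← h] at this; linarith
  · have := (hx y hy).2
    simp only [hf] at this
    rw [neg_mul, Real.exp_neg, inv_mul_eq_one₀ (Real.exp_pos _).ne'] at this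
    exact this.symm
  · by_contra hne
    have h2 := hanti 0 (x y) y le_rfl ((hx y hy).1.lt_of_ne (Ne.symm hne))
    rw [(hx y hy).2, h, heq] at h2
    exact lt_irrefl _ h2

/-- Above the critical delay there is a characteristic exponent with positive real part. On the level
curve the phase `y Δ - arg (transfer z)` varies continuously from `0` to a value above `π`; where it
equals `π` the characteristic function vanishes. -/
theorem exists_root (ha : 0 < a) (hb : 0 < b) (hm₁ : 0 < m₁) (hm₂ : 0 < m₂)
    (hr : (m₁ - m₂) ^ 2 ≤ 4 * (m₁ * m₂)) (hc : m₁ * m₂ < a * m₂ + b * m₁) {Δ : ℝ}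
    (hΔ : critDelay a b m₁ m₂ < Δ) :
    ∃ z : ℂ, 0 < z.re ∧ charFn a b m₁ m₂ Δ z = 0 := by
  obtain ⟨hΩ, hΩ0⟩ := critSq_spec hm₁ hm₂ hc
  have hΔ0 : 0 < Δ := (critDelay_pos ha hb hm₁ hm₂ hc).trans hΔ
  obtain ⟨x, hxc, hx⟩ := exists_level_curve ha hb hm₁ hm₂ hr hc hΔ0.le
  set ω := √(critSq a b m₁ m₂) with hω
  have hω2 : ω ^ 2 = critSq a b m₁ m₂ := Real.sq_sqrt hΩ0.le
  have hω0 : 0 < ω := Real.sqrt_pos.2 hΩ0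
  have hre : ∀ x y : ℝ, ((x : ℂ) + y * Complex.I).re = x := fun x y => by simp
  have him : ∀ x y : ℝ, ((x : ℂ) + y * Complex.I).im = y := fun x y => by simp
  set A : ℝ → ℂ := fun y => transfer a b m₁ m₂ (x y + y * Complex.I) with hA
  have hAre : ∀ y ∈ Icc 0 ω, 0 < (A y).re := fun y hy =>
    re_transfer_pos ha hb hm₁ hm₂ (by rw [hre]; exact (hx y hy).1)
  have hAc : ContinuousOn A (Icc 0 ω) := fun y hy =>
    (continuousAt_transfer hm₁ hm₂ (by rw [hre]; exact (hx y hy).1)).comp_continuousWithinAt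
      (f := fun y : ℝ => (x y : ℂ) + y * Complex.I)
      (((Complex.continuous_ofReal.continuousAt.comp_continuousWithinAt (hxc y hy))).add
        (Continuous.continuousWithinAt (by fun_prop)))
  have hφc : ContinuousOn (fun y => y * Δ - (A y).arg) (Icc 0 ω) :=
    (Continuous.continuousOn (by fun_prop)).sub fun y hy =>
      (Complex.continuousAt_arg (Or.inl (hAre y hy))).comp_continuousWithinAt (hAc y hy)
  have h0mem : (0:ℝ) ∈ Icc 0 ω := ⟨le_rfl, hω0.le⟩
  have hωmem : ω ∈ Icc 0 ω := ⟨hω0.le, le_rfl⟩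
  have hφ0 : (0:ℝ) * Δ - (A 0).arg = 0 := by
    have e : A 0 = ((a / (x 0 + m₁) + b / (x 0 + m₂) : ℝ) : ℂ) := by
      simp [hA, transfer]
    have h := hAre 0 h0mem
    rw [e, Complex.ofReal_re] at h
    rw [e, Complex.arg_ofReal_of_nonneg h.le]
    ring
  have hφω : Real.pi < ω * Δ - (A ω).arg := by
    have h1 : ‖A ω‖ = 1 := by
      have := (hx ω hωmem).2.1
      rwa [(hx ω hωmem).2.2.2 rfl, zero_mul, Real.exp_zero, ← (hx ω hωmem).2.2.2 rfl] at this
    have h2 : (A ω).arg = -Real.arccos (A ω).re := by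
      have himA : (A ω).im ≤ 0 := im_transfer_nonpos ha hb (by rw [him]; exact hω0.le)
      rcases himA.lt_or_eq with h | h
      · rw [Complex.arg_of_im_neg h, h1, div_one]
      · have e : A ω = 1 := by
          apply Complex.ext
          · have := Complex.sq_norm (A ω)
            rw [h1, Complex.normSq_apply, h] at this
            have h3 := hAre ω hωmem
            rw [Complex.one_re]; nlinarith
          · rw [h, Complex.one_im]
        rw [e]; simp
    have h3 : (A ω).re = a * m₁ / (m₁ ^ 2 + critSq a b m₁ m₂)
        + b * m₂ / (m₂ ^ 2 + critSq a b m₁ m₂) := by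
      simp only [hA]
      rw [re_transfer, hre, him, hω2, (hx ω hωmem).2.2.2 rfl, zero_add, zero_add]
    rw [critDelay, ← hω, div_lt_iff₀ hω0, Real.arccos_neg, ← h3] at hΔ
    rw [h2]
    linarith [mul_comm ω Δ]
  obtain ⟨y, hy, hyφ⟩ := intermediate_value_Icc hω0.le hφc
    (⟨by rw [hφ0]; exact Real.pi_pos.le, hφω.le⟩ :
      Real.pi ∈ Icc ((0:ℝ) * Δ - (A 0).arg) (ω * Δ - (A ω).arg))
  simp only at hyφ
  have hyω : y < ω := hy.2.lt_of_ne fun h => by rw [h] at hyφ; linarith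
  refine ⟨x y + y * Complex.I, by rw [hre]; exact (hx y hy).2.2.1 hyω, ?_⟩
  -- at the point of phase `π`, `exp (z Δ)` and `-transfer z` have equal moduli and arguments
  have hpolar := Complex.norm_mul_exp_arg_mul_I (A y)
  have hn : ‖A y‖ = Real.exp (x y * Δ) := (hx y hy).2.1
  have harg : (A y).arg = y * Δ - Real.pi := by linarith
  rw [hn, harg] at hpolar
  change 1 + Complex.exp (-(x y + y * Complex.I) * Δ) * A y = 0
  rw [← hpolar]
  push_cast
  rw [← Complex.exp_add, ← Complex.exp_add, show -((x y : ℂ) + y * Complex.I) * Δ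
    + (x y * Δ + (y * Δ - Real.pi) * Complex.I) = -(Real.pi * Complex.I) by ring,
    Complex.exp_neg, Complex.exp_pi_mul_I]
  norm_num

end Roots

/-! ### Expansion of the critical delay -/

open Asymptotics in
/-- Second-order Taylor estimate for a function that is `C²` at a point. -/
theorem isBigO_sub_fderiv {E : Type*} [NormedAddCommGroup E] [NormedSpace ℝ E] {F : E → ℝ} {p : E}
    (hF : ContDiffAt ℝ 2 F p) :
    (fun x => F x - F p - fderiv ℝ F p (x - p)) =O[𝓝 p] fun x => ‖x - p‖ ^ 2 := by
  obtain ⟨K, t, ht, hK⟩ := (hF.fderiv_right (m := 1) (by norm_num)).exists_lipschitzOnWith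
  have hd : ∀ᶠ x in 𝓝 p, DifferentiableAt ℝ F x :=
    (hF.eventually (by simp)).mono fun x hx => hx.differentiableAt (by simp)
  obtain ⟨r, hr, hball⟩ := Metric.mem_nhds_iff.1 (inter_mem ht hd)
  refine IsBigO.of_bound K ?_
  filter_upwards [Metric.ball_mem_nhds p hr] with x hx
  have hsub : Metric.closedBall p ‖x - p‖ ⊆ Metric.ball p r :=
    Metric.closedBall_subset_ball (by rwa [← dist_eq_norm])
  have := (convex_closedBall p ‖x - p‖).norm_image_sub_le_of_norm_hasFDerivWithin_le' (f := F)
    (φ := fderiv ℝ F p) (C := K * ‖x - p‖)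
    (fun y hy => (hball (hsub hy)).2.hasFDerivAt.hasFDerivWithinAt) (fun y hy => by
      have h1 := hK.dist_le_mul y (hball (hsub hy)).1 p (hball (Metric.mem_ball_self hr)).1
      rw [dist_eq_norm] at h1
      refine h1.trans ?_
      gcongr
      exact hy)
    (Metric.mem_closedBall_self (norm_nonneg _)) (y := x) (by simp [dist_eq_norm])
  rw [norm_pow, norm_norm, sq, ← mul_assoc]
  exact this

/-- The symmetric loop: with equal residues `K / 2` and equal rates, the discriminant is `K⁴`. -/
theorem critSq_base {K μ : ℝ} : critSq (K / 2) (K / 2) μ μ = K ^ 2 - μ ^ 2 := by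
  rw [critSq, show (μ ^ 2 + μ ^ 2 - (K / 2 + K / 2) ^ 2) ^ 2
    - 4 * (μ ^ 2 * μ ^ 2 - (K / 2 * μ + K / 2 * μ) ^ 2) = (K ^ 2) ^ 2 by ring,
    Real.sqrt_sq (by positivity)]
  ring

theorem contDiffAt_critSq {E : Type*} [NormedAddCommGroup E] [NormedSpace ℝ E] {K μ : ℝ}
    (hK : K ≠ 0) {a b m : E → ℝ} {p : E} (ha : ContDiffAt ℝ 2 a p) (hb : ContDiffAt ℝ 2 b p)
    (hm : ContDiffAt ℝ 2 m p) (ha0 : a p = K / 2) (hb0 : b p = K / 2) (hm0 : m p = μ) :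
    ContDiffAt ℝ 2 (fun x => critSq (a x) (b x) (m x) μ) p := by
  unfold critSq
  have h : (m p ^ 2 + μ ^ 2 - (a p + b p) ^ 2) ^ 2
      - 4 * (m p ^ 2 * μ ^ 2 - (a p * μ + b p * m p) ^ 2) ≠ 0 := by
    rw [ha0, hb0, hm0, show (μ ^ 2 + μ ^ 2 - (K / 2 + K / 2) ^ 2) ^ 2
      - 4 * (μ ^ 2 * μ ^ 2 - (K / 2 * μ + K / 2 * μ) ^ 2) = (K ^ 2) ^ 2 by ring]
    positivity
  refine ContDiffAt.div_const (ContDiffAt.add (by fun_prop) (ContDiffAt.sqrt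
    (f := fun x => (m x ^ 2 + μ ^ 2 - (a x + b x) ^ 2) ^ 2
      - 4 * (m x ^ 2 * μ ^ 2 - (a x * μ + b x * m x) ^ 2)) (by fun_prop) h)) 2

theorem ratio_base {K μ : ℝ} (hμ : 0 < μ) (hK : μ < K) :
    K / 2 * μ / (μ ^ 2 + (K ^ 2 - μ ^ 2)) + K / 2 * μ / (μ ^ 2 + (K ^ 2 - μ ^ 2)) = μ / K := by
  have : 0 < K := hμ.trans hK
  field_simp
  ring

theorem contDiffAt_critDelay {E : Type*} [NormedAddCommGroup E] [NormedSpace ℝ E] {K μ : ℝ}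
    (hμ : 0 < μ) (hK : μ < K) {a b m : E → ℝ} {p : E} (ha : ContDiffAt ℝ 2 a p)
    (hb : ContDiffAt ℝ 2 b p) (hm : ContDiffAt ℝ 2 m p) (ha0 : a p = K / 2) (hb0 : b p = K / 2)
    (hm0 : m p = μ) :
    ContDiffAt ℝ 2 (fun x => critDelay (a x) (b x) (m x) μ) p := by
  have hK0 : 0 < K := hμ.trans hK
  have hΩ := contDiffAt_critSq hK0.ne' ha hb hm ha0 hb0 hm0
  have hΩp : critSq (a p) (b p) (m p) μ = K ^ 2 - μ ^ 2 := by rw [ha0, hb0, hm0, critSq_base]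
  have hΩ0 : 0 < critSq (a p) (b p) (m p) μ := by rw [hΩp]; nlinarith
  have h1 : m p ^ 2 + critSq (a p) (b p) (m p) μ ≠ 0 := by positivity
  have h2 : μ ^ 2 + critSq (a p) (b p) (m p) μ ≠ 0 := by positivity
  have hlt : μ / K < 1 := (div_lt_one hK0).2 hK
  have hR : a p * m p / (m p ^ 2 + critSq (a p) (b p) (m p) μ)
      + b p * μ / (μ ^ 2 + critSq (a p) (b p) (m p) μ) = μ / K := by
    rw [hΩp, ha0, hb0, hm0, ratio_base hμ hK]
  unfold critDelay
  refine ContDiffAt.div ?_ (hΩ.sqrt hΩ0.ne') (Real.sqrt_pos.2 hΩ0).ne'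
  refine ContDiffAt.comp p (g := Real.arccos) (Real.contDiffAt_arccos ?_ ?_) ?_
  · rw [hR]; intro h; linarith
  · rw [hR]; intro h; have := div_pos hμ hK0; linarith
  · exact (((ha.mul hm).div ((hm.pow 2).add hΩ) h1).add
      ((hb.mul contDiffAt_const).div (contDiffAt_const.add hΩ) h2)).neg

theorem hasDerivAt_critSq {K μ : ℝ} (hK : K ≠ 0) {a m : ℝ → ℝ} {a' m' : ℝ}
    (ha : HasDerivAt a a' 0) (hm : HasDerivAt m m' 0) (ha0 : a 0 = K / 2) (hm0 : m 0 = μ) :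
    HasDerivAt (fun ε => critSq (a ε) (K / 2) (m ε) μ) (2 * K * a' - μ * m') 0 := by
  unfold critSq
  have hB := ((hm.pow 2).add_const (μ ^ 2)).sub ((ha.add_const (K / 2)).pow 2)
  have hC := ((hm.pow 2).mul_const (μ ^ 2)).sub (((ha.mul_const μ).add (hm.const_mul (K / 2))).pow 2)
  have hd0 : (m 0 ^ 2 + μ ^ 2 - (a 0 + K / 2) ^ 2) ^ 2
      - 4 * (m 0 ^ 2 * μ ^ 2 - (a 0 * μ + K / 2 * m 0) ^ 2) = (K ^ 2) ^ 2 := by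
    rw [ha0, hm0]; ring
  have hd := ((hB.pow 2).sub (hC.const_mul 4)).sqrt (by
    simp only [Pi.sub_apply, Pi.pow_apply, Pi.add_apply]
    rw [hd0]; positivity)
  refine ((hB.neg.add hd).div_const 2).congr_deriv ?_
  simp only [Pi.sub_apply, Pi.pow_apply, Pi.add_apply]
  rw [hd0, Real.sqrt_sq (by positivity), ha0, hm0]
  field_simp
  push_cast
  ring

theorem hasDerivAt_critDelay {K μ : ℝ} (hμ : 0 < μ) (hK : μ < K) {a m : ℝ → ℝ} {a' m' : ℝ}
    (ha : HasDerivAt a a' 0) (hm : HasDerivAt m m' 0) (ha0 : a 0 = K / 2) (hm0 : m 0 = μ) :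
    HasDerivAt (fun ε => critDelay (a ε) (K / 2) (m ε) μ)
      ((K * m' / 2 - μ * a') / (K * (K ^ 2 - μ ^ 2))
        - Real.arccos (-(μ / K)) / √(K ^ 2 - μ ^ 2) * (2 * K * a' - μ * m')
          / (2 * (K ^ 2 - μ ^ 2))) 0 := by
  have hK0 : 0 < K := hμ.trans hK
  have hΩ := hasDerivAt_critSq hK0.ne' ha hm ha0 hm0
  have hΩp : critSq (a 0) (K / 2) (m 0) μ = K ^ 2 - μ ^ 2 := by rw [ha0, hm0, critSq_base]
  have hΩ0 : 0 < K ^ 2 - μ ^ 2 := by nlinarith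
  have h1 : m 0 ^ 2 + critSq (a 0) (K / 2) (m 0) μ ≠ 0 := by rw [hΩp]; positivity
  have h2 : μ ^ 2 + critSq (a 0) (K / 2) (m 0) μ ≠ 0 := by rw [hΩp]; positivity
  have hlt : μ / K < 1 := (div_lt_one hK0).2 hK
  have hR0 : a 0 * m 0 / (m 0 ^ 2 + critSq (a 0) (K / 2) (m 0) μ)
      + K / 2 * μ / (μ ^ 2 + critSq (a 0) (K / 2) (m 0) μ) = μ / K := by
    rw [hΩp, ha0, hm0, ratio_base hμ hK]
  have hR := ((ha.mul hm).div ((hm.pow 2).add hΩ) h1).add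
    (((hasDerivAt_const 0 (K / 2)).mul_const μ).div (hΩ.const_add (μ ^ 2)) h2)
  have hRd : HasDerivAt (fun ε => a ε * m ε / (m ε ^ 2 + critSq (a ε) (K / 2) (m ε) μ)
      + K / 2 * μ / (μ ^ 2 + critSq (a ε) (K / 2) (m ε) μ)) ((K * m' / 2 - μ * a') / K ^ 2) 0 := by
    refine hR.congr_deriv ?_
    simp only [Pi.mul_apply, Pi.pow_apply, Pi.add_apply]
    rw [hΩp, ha0, hm0, show μ ^ 2 + (K ^ 2 - μ ^ 2) = K ^ 2 by ring]
    field_simp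
    push_cast
    ring
  have harc := (Real.hasDerivAt_arccos (x := -(a 0 * m 0 / (m 0 ^ 2 + critSq (a 0) (K / 2) (m 0) μ)
      + K / 2 * μ / (μ ^ 2 + critSq (a 0) (K / 2) (m 0) μ)))
    (by rw [hR0]; intro h; linarith)
    (by rw [hR0]; intro h; have := div_pos hμ hK0; linarith)).comp 0 hRd.neg
  have hsq := hΩ.sqrt (by rw [hΩp]; exact hΩ0.ne')
  have hsne : √(critSq (a 0) (K / 2) (m 0) μ) ≠ 0 := by
    rw [hΩp]; exact (Real.sqrt_pos.2 hΩ0).ne'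
  unfold critDelay
  refine (harc.div hsq hsne).congr_deriv ?_
  simp only [Function.comp_apply, Pi.neg_apply]
  rw [hR0, hΩp]
  set w := √(K ^ 2 - μ ^ 2) with hw
  have hw0 : 0 < w := Real.sqrt_pos.2 hΩ0
  have hw2 : w ^ 2 = K ^ 2 - μ ^ 2 := Real.sq_sqrt hΩ0.le
  have hs : √(1 - (-(μ / K)) ^ 2) = w / K := by
    rw [show 1 - (-(μ / K)) ^ 2 = (w / K) ^ 2 by rw [div_pow, hw2]; field_simp]
    exact Real.sqrt_sq (by positivity)
  rw [hs, ← hw2]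
  field_simp

/-! ### The logistic function -/

section Sigmoid

theorem abs_sigmoid_sub_le (u v : ℝ) : |Real.sigmoid u - Real.sigmoid v| ≤ |u - v| := by
  have := convex_univ.norm_image_sub_le_of_norm_hasDerivWithin_le (f := Real.sigmoid) (C := 1)
    (fun x _ => (Real.hasDerivAt_sigmoid x).hasDerivWithinAt) (fun x _ => ?_)
    (mem_univ v) (mem_univ u)
  · simpa using this
  · have h0 := Real.sigmoid_pos x
    have h1 := Real.sigmoid_lt_one x
    rw [Real.norm_of_nonneg (mul_nonneg h0.le (by linarith))]
    nlinarith

theorem abs_sigmoid_sub_linear_le (u v : ℝ) :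
    |Real.sigmoid (u + v) - Real.sigmoid u
      - Real.sigmoid u * (1 - Real.sigmoid u) * v| ≤ v ^ 2 := by
  have h := (convex_closedBall u |v|).norm_image_sub_le_of_norm_hasDerivWithin_le
    (f := fun x => Real.sigmoid x - Real.sigmoid u * (1 - Real.sigmoid u) * x) (C := |v|)
    (f' := fun x => Real.sigmoid x * (1 - Real.sigmoid x)
      - Real.sigmoid u * (1 - Real.sigmoid u)) (x := u) (y := u + v)
    (fun x _ => (((Real.hasDerivAt_sigmoid x).sub ((hasDerivAt_id x).const_mul
      (Real.sigmoid u * (1 - Real.sigmoid u)))).congr_deriv (by rw [mul_one])).hasDerivWithinAt)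
    (fun x hx => ?_) (Metric.mem_closedBall_self (abs_nonneg _)) (by simp)
  · rw [Real.norm_eq_abs, Real.norm_eq_abs] at h
    rw [← sq_abs, sq]
    convert h using 2 <;> ring_nf
  · have h0 := Real.sigmoid_pos x
    have h1 := Real.sigmoid_lt_one x
    have h2 := Real.sigmoid_pos u
    have h3 := Real.sigmoid_lt_one u
    rw [show Real.sigmoid x * (1 - Real.sigmoid x) - Real.sigmoid u * (1 - Real.sigmoid u)
      = (1 - Real.sigmoid x - Real.sigmoid u) * (Real.sigmoid x - Real.sigmoid u) by ring,
      norm_mul, Real.norm_eq_abs, Real.norm_eq_abs]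
    calc _ ≤ 1 * |x - u| :=
          mul_le_mul (abs_le.2 ⟨by linarith, by linarith⟩) (abs_sigmoid_sub_le _ _)
            (abs_nonneg _) zero_le_one
      _ ≤ |v| := by rw [one_mul]; exact hx

theorem exists_eq_sigmoid {κ : ℝ} (c : ℝ) : ∃ s, s = Real.sigmoid (c - κ * s) := by
  have hc : ContinuousOn (fun s => s - Real.sigmoid (c - κ * s)) (Icc 0 1) :=
    (continuous_id.sub (continuous_sigmoid.comp (by fun_prop))).continuousOn
  obtain ⟨s, -, hs⟩ := intermediate_value_Icc zero_le_one hc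
    (⟨by simpa using (Real.sigmoid_pos _).le, by simpa using (Real.sigmoid_lt_one _).le⟩ :
      (0:ℝ) ∈ Icc (0 - Real.sigmoid (c - κ * 0)) (1 - Real.sigmoid (c - κ * 1)))
  exact ⟨s, sub_eq_zero.1 hs⟩

/-- A fixed point of the decreasing map `s ↦ sigmoid (c - κ s)` is at most as far from `t` as `t` is
from its image. The case of a second fixed point `t` gives uniqueness. -/
theorem abs_sub_le_of_eq_sigmoid {κ c s : ℝ} (hκ : 0 ≤ κ) (hs : s = Real.sigmoid (c - κ * s))
    (t : ℝ) : |s - t| ≤ |t - Real.sigmoid (c - κ * t)| := by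
  rcases le_total s t with h | h
  · have : Real.sigmoid (c - κ * t) ≤ s := by
      rw [hs]
      refine Real.sigmoid_le (sub_le_sub_left (mul_le_mul_of_nonneg_left h hκ) c)
    rw [abs_sub_comm, abs_of_nonneg (sub_nonneg.2 h)]
    exact (le_abs_self _).trans' (by linarith)
  · have : s ≤ Real.sigmoid (c - κ * t) := by
      rw [hs]
      refine Real.sigmoid_le (sub_le_sub_left (mul_le_mul_of_nonneg_left h hκ) c)
    rw [abs_of_nonneg (sub_nonneg.2 h)]
    exact (neg_le_abs _).trans' (by linarith)

end Sigmoid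

end DelayFeedback

/-! ### The queueing system as a feedback loop -/

namespace QueueParams

open DelayFeedback

variable (P : QueueParams) (ε : ℝ)

/-- The perturbed arrival rate of the first queue. -/
def lam₁ : ℝ := P.lam + ε * P.lamHat

/-- The perturbed service rate of the first queue. -/
def mu₁ : ℝ := P.mu + ε * P.muHat

/-- The perturbed sensitivity of the first queue. -/
def theta₁ : ℝ := P.theta + ε * P.thetaHat

/-- The logarithm of the ratio of the two logit weights, at the delayed state `y`. -/
def utility (y : ℝ × ℝ) : ℝ := -P.theta₁ ε * y.1 + P.theta * y.2 + ε * P.alphaHat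

theorem drift_eq (x y : ℝ × ℝ) : P.drift ε x y
    = (P.lam₁ ε * Real.sigmoid (P.utility ε y) - P.mu₁ ε * x.1,
      P.lam * (1 - Real.sigmoid (P.utility ε y)) - P.mu * x.2) := by
  have h1 : 0 < P.weight₁ ε y.1 := Real.exp_pos _
  have h2 : 0 < P.weight₂ y.2 := Real.exp_pos _
  have h : P.weight₁ ε y.1 / (P.weight₁ ε y.1 + P.weight₂ y.2)
      = Real.sigmoid (P.utility ε y) := by
    have : P.weight₂ y.2 = P.weight₁ ε y.1 * Real.exp (-P.utility ε y) := by
      rw [weight₁, weight₂, ← Real.exp_add, utility, theta₁]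
      ring_nf
    rw [Real.sigmoid_def, this]
    field_simp
  have h' : P.weight₂ y.2 / (P.weight₁ ε y.1 + P.weight₂ y.2)
      = 1 - Real.sigmoid (P.utility ε y) := by
    rw [← h]; field_simp; ring
  rw [drift, h, h']
  rfl

/-- At the state `rest ε s` the utility is `offset - slope * s`. -/
def slope : ℝ := P.theta₁ ε * P.lam₁ ε / P.mu₁ ε + P.theta * P.lam / P.mu

/-- The constant term of the utility at the states `rest ε s`. -/
def offset : ℝ := P.theta * P.lam / P.mu + ε * P.alphaHat

/-- The state at which both queues are balanced when a fraction `s` of the customers joins the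
first queue. -/
def rest (s : ℝ) : ℝ × ℝ := (P.lam₁ ε * s / P.mu₁ ε, P.lam * (1 - s) / P.mu)

variable {P ε}

theorem utility_rest (s : ℝ) : P.utility ε (P.rest ε s) = P.offset ε - P.slope ε * s := by
  simp only [utility, rest, offset, slope]
  ring

theorem isEquilibrium_iff (hm₁ : 0 < P.mu₁ ε) (hmu : 0 < P.mu) (p : ℝ × ℝ) :
    P.IsEquilibrium ε p ↔ p = P.rest ε (Real.sigmoid (P.utility ε p)) := by
  rw [IsEquilibrium, drift_eq, Prod.mk_eq_zero, rest, Prod.ext_iff, sub_eq_zero, sub_eq_zero,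
    eq_div_iff hm₁.ne', eq_div_iff hmu.ne', mul_comm p.1, mul_comm p.2, eq_comm, @eq_comm _ (P.lam * _)]

theorem isEquilibrium_rest (hm₁ : 0 < P.mu₁ ε) (hmu : 0 < P.mu) {s : ℝ}
    (hs : s = Real.sigmoid (P.offset ε - P.slope ε * s)) : P.IsEquilibrium ε (P.rest ε s) := by
  rw [isEquilibrium_iff hm₁ hmu, utility_rest, ← hs]

theorem eq_rest_of_isEquilibrium (hm₁ : 0 < P.mu₁ ε) (hmu : 0 < P.mu) (hκ : 0 ≤ P.slope ε) {s : ℝ}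
    (hs : s = Real.sigmoid (P.offset ε - P.slope ε * s)) {p : ℝ × ℝ} (hp : P.IsEquilibrium ε p) :
    p = P.rest ε s := by
  rw [isEquilibrium_iff hm₁ hmu] at hp
  set t := Real.sigmoid (P.utility ε p) with ht
  have h : t = Real.sigmoid (P.offset ε - P.slope ε * t) := by
    rw [← utility_rest, ← hp]
  have h2 := abs_sub_le_of_eq_sigmoid hκ hs t
  rw [← h, sub_self, abs_zero, abs_nonpos_iff, sub_eq_zero] at h2
  rw [hp, h2]

variable (P ε) in
/-- All rates and sensitivities are positive. -/
structure IsAdmissible : Prop where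
  lam : 0 < P.lam
  mu : 0 < P.mu
  theta : 0 < P.theta
  lam₁ : 0 < P.lam₁ ε
  mu₁ : 0 < P.mu₁ ε
  theta₁ : 0 < P.theta₁ ε

/-- The deviation of the queueing system from an equilibrium of utility `u`, as a feedback loop. -/
def loop (h : P.IsAdmissible ε) (u : ℝ) : Loop where
  l₁ := P.lam₁ ε
  l₂ := P.lam
  m₁ := P.mu₁ ε
  m₂ := P.mu
  θ₁ := P.theta₁ ε
  θ₂ := P.theta
  k := Real.sigmoid u * (1 - Real.sigmoid u)
  G := 1
  g v := Real.sigmoid (u + v) - Real.sigmoid u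
  l₁_pos := h.lam₁
  l₂_pos := h.lam
  m₁_pos := h.mu₁
  m₂_pos := h.mu
  θ₁_pos := h.theta₁
  θ₂_pos := h.theta
  k_pos := mul_pos (Real.sigmoid_pos u) (sub_pos.2 (Real.sigmoid_lt_one u))
  G_pos := one_pos
  g_cont := (continuous_sigmoid.comp (by fun_prop)).sub continuous_const
  g_quad v := by rw [one_mul]; exact abs_sigmoid_sub_linear_le u v
  g_lip v := by simpa using abs_sigmoid_sub_le (u + v) u

variable {Δ : ℝ} {p : ℝ × ℝ}

theorem drift_of_isEquilibrium (h : P.IsAdmissible ε) (hp : P.IsEquilibrium ε p) {x₁ x₂ : ℝ → ℝ}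
    (t s : ℝ) :
    P.drift ε (p + (x₁ t, x₂ t)) (p + (x₁ s, x₂ s))
      = ((P.loop h (P.utility ε p)).l₁ * (P.loop h (P.utility ε p)).g
          ((P.loop h (P.utility ε p)).out x₁ x₂ s) - (P.loop h (P.utility ε p)).m₁ * x₁ t,
        -(P.loop h (P.utility ε p)).l₂ * (P.loop h (P.utility ε p)).g
          ((P.loop h (P.utility ε p)).out x₁ x₂ s) - (P.loop h (P.utility ε p)).m₂ * x₂ t) := by
  rw [IsEquilibrium, drift_eq, Prod.mk_eq_zero] at hp
  have e : P.utility ε (p + (x₁ s, x₂ s))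
      = P.utility ε p + (P.loop h (P.utility ε p)).out x₁ x₂ s := by
    simp only [utility, Loop.out, loop, Prod.fst_add, Prod.snd_add]
    ring
  rw [drift_eq, e]
  simp only [loop, Prod.fst_add, Prod.snd_add, Prod.mk.injEq]
  constructor
  · linear_combination hp.1
  · linear_combination hp.2

theorem IsSolution.isTrajectory (h : P.IsAdmissible ε) (hp : P.IsEquilibrium ε p) {q : ℝ → ℝ × ℝ}
    (hq : P.IsSolution ε Δ q) :
    (P.loop h (P.utility ε p)).IsTrajectory Δ (fun t => (q t).1 - p.1) (fun t => (q t).2 - p.2) := by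
  have e : ∀ t, p + ((q t).1 - p.1, (q t).2 - p.2) = q t := fun t => by ext <;> simp
  refine ⟨hq.1.fst.sub continuousOn_const, hq.1.snd.sub continuousOn_const, fun t ht => ?_,
    fun t ht => ?_⟩
  · have := (hq.2 t ht).hasFDerivWithinAt.fst.hasDerivWithinAt.sub_const p.1
    refine this.congr_deriv ?_
    have := congrArg Prod.fst (drift_of_isEquilibrium h hp (x₁ := fun t => (q t).1 - p.1)
      (x₂ := fun t => (q t).2 - p.2) t (t - Δ))
    simp only [e] at this
    simpa using this
  · have := (hq.2 t ht).hasFDerivWithinAt.snd.hasDerivWithinAt.sub_const p.2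
    refine this.congr_deriv ?_
    have := congrArg Prod.snd (drift_of_isEquilibrium h hp (x₁ := fun t => (q t).1 - p.1)
      (x₂ := fun t => (q t).2 - p.2) t (t - Δ))
    simp only [e] at this
    simpa using this

theorem isSolution_of_isTrajectory (h : P.IsAdmissible ε) (hp : P.IsEquilibrium ε p)
    {x₁ x₂ : ℝ → ℝ} (hx : (P.loop h (P.utility ε p)).IsTrajectory Δ x₁ x₂) :
    P.IsSolution ε Δ fun t => p + (x₁ t, x₂ t) := by
  refine ⟨continuousOn_const.add (hx.cont₁.prodMk hx.cont₂), fun t ht => ?_⟩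
  rw [drift_of_isEquilibrium h hp]
  exact ((hx.deriv₁ t ht).prodMk (hx.deriv₂ t ht)).const_add p

theorem isAsymptoticallyStable (h : P.IsAdmissible ε) (hp : P.IsEquilibrium ε p) (hΔ : 0 ≤ Δ)
    (hroots : ∀ Δ' ∈ Icc 0 Δ, ∀ y : ℝ, charFn (P.loop h (P.utility ε p)).a
      (P.loop h (P.utility ε p)).b (P.mu₁ ε) P.mu Δ' (y * Complex.I) ≠ 0) :
    P.IsAsymptoticallyStable ε Δ p := by
  obtain ⟨C, hC, δ₀, hδ₀, hst⟩ := (P.loop h (P.utility ε p)).stability hΔ hroots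
  refine ⟨fun η hη => ⟨min δ₀ (η / (2 * C)), by positivity, fun q hq hi t ht => ?_⟩,
    δ₀, hδ₀, fun q hq hi => ?_⟩
  · have h1 := (hst (min δ₀ (η / (2 * C))) (by positivity) (min_le_left _ _) _ _
      (hq.isTrajectory h hp) fun s hs => ?_).1 t ht
    · have h2 : C * min δ₀ (η / (2 * C)) ≤ η / 2 :=
        (mul_le_mul_of_nonneg_left (min_le_right _ _) hC.le).trans_eq (by field_simp)
      rw [Prod.dist_eq, max_lt_iff, Real.dist_eq, Real.dist_eq]
      exact ⟨by linarith [h1.1], by linarith [h1.2]⟩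
    · have := hi s hs
      rw [Prod.dist_eq, max_lt_iff, Real.dist_eq, Real.dist_eq] at this
      exact ⟨this.1.le, this.2.le⟩
  · have h1 := (hst δ₀ hδ₀ le_rfl _ _ (hq.isTrajectory h hp) fun s hs => ?_).2
    · have h2 := (h1.1.add_const p.1).prodMk_nhds (h1.2.add_const p.2)
      simpa using h2
    · have := hi s hs
      rw [Prod.dist_eq, max_lt_iff, Real.dist_eq, Real.dist_eq] at this
      exact ⟨this.1.le, this.2.le⟩

theorem not_isStable (h : P.IsAdmissible ε) (hp : P.IsEquilibrium ε p) (hΔ : 0 < Δ) {z : ℂ}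
    (hz : 0 < z.re) (hroot : charFn (P.loop h (P.utility ε p)).a
      (P.loop h (P.utility ε p)).b (P.mu₁ ε) P.mu Δ z = 0) : ¬ P.IsStable ε Δ p := by
  intro hst
  obtain ⟨η, hη, hun⟩ := (P.loop h (P.utility ε p)).instability hΔ hz hroot
  obtain ⟨δ, hδ, hq⟩ := hst η hη
  obtain ⟨x₁, x₂, hx, hi, t, ht, hbig⟩ := hun δ hδ
  have h1 := hq _ (isSolution_of_isTrajectory h hp hx) (fun s hs => by
    rw [dist_self_add_left, Prod.norm_mk, max_lt_iff]
    exact hi s hs) t ht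
  rw [dist_self_add_left, Prod.norm_mk, max_lt_iff] at h1
  rcases hbig with h2 | h2
  · exact absurd h1.1 (not_lt.2 h2)
  · exact absurd h1.2 (not_lt.2 h2)

/-- For an admissible perturbation with comparable service rates and gain above the threshold, the
equilibrium is unique and its stability changes at `critDelay`. -/
theorem stability_switch (h : P.IsAdmissible ε) {s : ℝ}
    (hs : s = Real.sigmoid (P.offset ε - P.slope ε * s))
    (hr : (P.mu₁ ε - P.mu) ^ 2 ≤ 4 * (P.mu₁ ε * P.mu))
    (hc : P.mu₁ ε * P.mu < s * (1 - s) * P.theta₁ ε * P.lam₁ ε * P.mu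
      + s * (1 - s) * P.theta * P.lam * P.mu₁ ε) :
    0 < critDelay (s * (1 - s) * P.theta₁ ε * P.lam₁ ε) (s * (1 - s) * P.theta * P.lam)
        (P.mu₁ ε) P.mu ∧
      ∃ p : ℝ × ℝ, P.IsEquilibrium ε p ∧ (∀ p', P.IsEquilibrium ε p' → p' = p) ∧
        (∀ Δ : ℝ, 0 ≤ Δ → Δ < critDelay (s * (1 - s) * P.theta₁ ε * P.lam₁ ε)
          (s * (1 - s) * P.theta * P.lam) (P.mu₁ ε) P.mu → P.IsAsymptoticallyStable ε Δ p) ∧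
        (∀ Δ : ℝ, critDelay (s * (1 - s) * P.theta₁ ε * P.lam₁ ε) (s * (1 - s) * P.theta * P.lam)
          (P.mu₁ ε) P.mu < Δ → ¬ P.IsStable ε Δ p) := by
  have hκ : 0 ≤ P.slope ε := by
    have := h.lam; have := h.mu; have := h.theta; have := h.lam₁; have := h.mu₁; have := h.theta₁
    rw [slope]; positivity
  have hp := isEquilibrium_rest h.mu₁ h.mu hs
  have hsu : Real.sigmoid (P.utility ε (P.rest ε s)) = s := by rw [utility_rest, ← hs]
  have ha : (P.loop h (P.utility ε (P.rest ε s))).a = s * (1 - s) * P.theta₁ ε * P.lam₁ ε := by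
    simp only [Loop.a, loop, hsu]
  have hb : (P.loop h (P.utility ε (P.rest ε s))).b = s * (1 - s) * P.theta * P.lam := by
    simp only [Loop.b, loop, hsu]
  have ha0 := (P.loop h (P.utility ε (P.rest ε s))).a_pos
  have hb0 := (P.loop h (P.utility ε (P.rest ε s))).b_pos
  rw [ha] at ha0
  rw [hb] at hb0
  have hpos := critDelay_pos ha0 hb0 h.mu₁ h.mu hc
  refine ⟨hpos, P.rest ε s, hp, fun p' hp' => eq_rest_of_isEquilibrium h.mu₁ h.mu hκ hs hp',
    fun Δ hΔ hlt => isAsymptoticallyStable h hp hΔ fun Δ' hΔ' y => ?_, fun Δ hlt => ?_⟩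
  · rw [ha, hb]
    exact charFn_imag_ne_zero h.mu₁ h.mu hc hΔ'.1 (hΔ'.2.trans_lt hlt) y
  · obtain ⟨z, hz, hroot⟩ := exists_root ha0 hb0 h.mu₁ h.mu hr hc hlt
    refine not_isStable h hp (hpos.trans hlt) hz ?_
    rw [ha, hb]
    exact hroot

/-! ### Expansion of the threshold -/

section Threshold

open Asymptotics

variable (P : QueueParams)

/-- The critical delay as a function of the perturbation size `x.1` and of the slope `x.2` of the
logit curve at the equilibrium. -/
def threshold (x : ℝ × ℝ) : ℝ :=
  critDelay (x.2 * P.theta₁ x.1 * P.lam₁ x.1) (x.2 * P.theta * P.lam) (P.mu₁ x.1) P.mu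

variable {P}

theorem contDiffAt_threshold (hmu : 0 < P.mu) (hcrit : 2 * P.mu < P.lam * P.theta) :
    ContDiffAt ℝ 2 P.threshold (0, 1 / 4) := by
  unfold threshold
  refine contDiffAt_critDelay (K := P.lam * P.theta / 2) hmu (by linarith)
    (by unfold theta₁ lam₁; fun_prop) (by fun_prop) (by unfold mu₁; fun_prop) ?_ ?_ ?_
  · simp [theta₁, lam₁]; ring
  · ring
  · simp [mu₁]

theorem omegaCr_eq : P.omegaCr = √((P.lam * P.theta / 2) ^ 2 - P.mu ^ 2) := by
  rw [omegaCr, show P.lam ^ 2 * P.theta ^ 2 - 4 * P.mu ^ 2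
    = 2 ^ 2 * ((P.lam * P.theta / 2) ^ 2 - P.mu ^ 2) by ring, Real.sqrt_mul (by norm_num),
    Real.sqrt_sq (by norm_num)]
  ring

theorem deltaCr_eq : P.deltaCr = Real.arccos (-(P.mu / (P.lam * P.theta / 2)))
    / √((P.lam * P.theta / 2) ^ 2 - P.mu ^ 2) := by
  rw [deltaCr, omegaCr_eq]
  congr 2
  rw [div_div_eq_mul_div]; ring

theorem threshold_base (hmu : 0 < P.mu) (hcrit : 2 * P.mu < P.lam * P.theta) :
    P.threshold (0, 1 / 4) = P.deltaCr := by
  have e1 : 1 / 4 * P.theta₁ 0 * P.lam₁ 0 = P.lam * P.theta / 2 / 2 := by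
    rw [theta₁, lam₁]; ring
  have e2 : 1 / 4 * P.theta * P.lam = P.lam * P.theta / 2 / 2 := by ring
  have e3 : P.mu₁ 0 = P.mu := by rw [mu₁]; ring
  rw [threshold, e1, e2, e3, critDelay, critSq_base, ratio_base hmu (by linarith), deltaCr_eq]

/-- At the symmetric slope `1 / 4`, the first-order variation of the critical delay is
`-deltaCoeff`. -/
theorem hasDerivAt_threshold (hlam : 0 < P.lam) (hmu : 0 < P.mu)
    (hcrit : 2 * P.mu < P.lam * P.theta) :
    HasDerivAt (fun ε => P.threshold (ε, 1 / 4)) (-P.deltaCoeff) 0 := by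
  have hθ : 0 < P.theta := pos_of_mul_pos_right (by linarith) hlam.le
  have hlin : ∀ c d : ℝ, HasDerivAt (fun ε => c + ε * d) d 0 := fun c d => by
    simpa using ((hasDerivAt_id (0:ℝ)).mul_const d).const_add c
  have ha : HasDerivAt (fun ε => 1 / 4 * P.theta₁ ε * P.lam₁ ε)
      ((P.thetaHat * P.lam + P.theta * P.lamHat) / 4) 0 := by
    refine (((hlin P.theta P.thetaHat).const_mul (1 / 4)).mul
      (hlin P.lam P.lamHat)).congr_deriv ?_
    ring
  have hm : HasDerivAt P.mu₁ P.muHat 0 := hlin P.mu P.muHat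
  have h := hasDerivAt_critDelay (K := P.lam * P.theta / 2) hmu (by linarith) ha hm
    (by simp only [theta₁, lam₁]; ring) (by simp [mu₁])
  have e : (fun ε => P.threshold (ε, 1 / 4)) = fun ε => critDelay (1 / 4 * P.theta₁ ε * P.lam₁ ε)
      (P.lam * P.theta / 2 / 2) (P.mu₁ ε) P.mu := by
    ext ε
    rw [threshold, show 1 / 4 * P.theta * P.lam = P.lam * P.theta / 2 / 2 by ring]
  rw [e]
  refine h.congr_deriv ?_
  have hΩ : 0 < (P.lam * P.theta / 2) ^ 2 - P.mu ^ 2 := by nlinarith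
  have hw : P.omegaCr ^ 2 = (P.lam * P.theta / 2) ^ 2 - P.mu ^ 2 := by
    rw [omegaCr_eq, Real.sq_sqrt hΩ.le]
  rw [← deltaCr_eq, deltaCoeff, hw]
  set W := (P.lam * P.theta / 2) ^ 2 - P.mu ^ 2 with hW
  rw [show P.mu ^ 2 + W = (P.lam * P.theta / 2) ^ 2 by rw [hW]; ring]
  field_simp
  ring

theorem exists_share (P : QueueParams) :
    ∃ s : ℝ → ℝ, ∀ ε, s ε = Real.sigmoid (P.offset ε - P.slope ε * s ε) := by
  choose s hs using fun ε => exists_eq_sigmoid (κ := P.slope ε) (P.offset ε)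
  exact ⟨s, hs⟩

theorem eventually_isAdmissible (hlam : 0 < P.lam) (hmu : 0 < P.mu) (hθ : 0 < P.theta) :
    ∀ᶠ ε in 𝓝 0, P.IsAdmissible ε := by
  have h : ∀ c d : ℝ, 0 < c → ∀ᶠ ε in 𝓝 (0:ℝ), 0 < c + ε * d := fun c d hc =>
    ContinuousAt.eventually_lt (by fun_prop) (by fun_prop) (by simpa using hc)
  filter_upwards [h _ P.lamHat hlam, h _ P.muHat hmu, h _ P.thetaHat hθ] with ε h1 h2 h3
  exact ⟨hlam, hmu, hθ, h1, h2, h3⟩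

theorem IsAdmissible.slope_nonneg {ε : ℝ} (h : P.IsAdmissible ε) : 0 ≤ P.slope ε := by
  have := h.lam; have := h.mu; have := h.theta; have := h.lam₁; have := h.mu₁; have := h.theta₁
  rw [slope]; positivity

/-- The fraction of customers that joins the first queue is `1 / 2 + O(ε)`. -/
theorem share_isBigO (hlam : 0 < P.lam) (hmu : 0 < P.mu) (hθ : 0 < P.theta) {s : ℝ → ℝ}
    (hs : ∀ ε, s ε = Real.sigmoid (P.offset ε - P.slope ε * s ε)) :
    (fun ε => s ε - 1 / 2) =O[𝓝 0] fun ε => ε := by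
  set w : ℝ → ℝ := fun ε => P.offset ε - P.slope ε * (1 / 2) with hw
  have hw0 : w 0 = 0 := by
    simp only [hw, offset, slope, theta₁, lam₁, mu₁, zero_mul, add_zero]
    ring
  have hwd : DifferentiableAt ℝ w 0 := by
    simp only [hw, offset, slope, theta₁, lam₁, mu₁]
    have : P.mu + 0 * P.muHat ≠ 0 := by simpa using hmu.ne'
    fun_prop (disch := assumption)
  have h1 := hwd.isBigO_sub
  simp only [hw0, sub_zero] at h1
  refine IsBigO.trans (IsBigO.of_bound 1 ?_) h1
  filter_upwards [eventually_isAdmissible hlam hmu hθ] with ε hε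
  have h2 := abs_sub_le_of_eq_sigmoid hε.slope_nonneg (hs ε) (1 / 2)
  have h3 := abs_sigmoid_sub_le 0 (w ε)
  rw [Real.sigmoid_zero, zero_sub, abs_neg, ← one_div] at h3
  rw [one_mul, Real.norm_eq_abs, Real.norm_eq_abs]
  exact h2.trans h3

/-- A slope that differs from `1 / 4` by `O(ε²)` does not affect the first order of the critical
delay. -/
theorem threshold_isBigO (hlam : 0 < P.lam) (hmu : 0 < P.mu)
    (hcrit : 2 * P.mu < P.lam * P.theta) {k : ℝ → ℝ}
    (hk : (fun ε => k ε - 1 / 4) =O[𝓝 0] fun ε => ε ^ 2) :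
    (fun ε => P.threshold (ε, k ε) - (P.deltaCr - ε * P.deltaCoeff)) =O[𝓝 0] fun ε => ε ^ 2 := by
  have hF := contDiffAt_threshold hmu hcrit
  set L := fderiv ℝ P.threshold (0, 1 / 4) with hL
  have hid : (fun ε : ℝ => ε ^ 2) =O[𝓝 0] fun ε : ℝ => ε := by
    simpa [sq] using (isBigO_refl (fun ε : ℝ => ε) (𝓝 0)).mul
      ((continuous_id.tendsto (0:ℝ)).isBigO_one ℝ)
  have hpath : (fun ε => ((ε, k ε) : ℝ × ℝ) - (0, 1 / 4)) =O[𝓝 0] fun ε => ε := by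
    simp only [Prod.mk_sub_mk, sub_zero]
    exact (isBigO_refl _ _).prod_left (hk.trans hid)
  have htend : Tendsto (fun ε => ((ε, k ε) : ℝ × ℝ)) (𝓝 0) (𝓝 (0, 1 / 4)) := by
    have := hpath.trans_tendsto tendsto_id
    simpa using this.add_const ((0, 1 / 4) : ℝ × ℝ)
  have h1 := ((isBigO_sub_fderiv hF).comp_tendsto htend).trans (hpath.norm_left.pow 2)
  have h10 : L (1, 0) = -P.deltaCoeff := by
    have hc : HasDerivAt (fun ε : ℝ => (ε, (1 / 4 : ℝ))) (1, 0) 0 :=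
      (hasDerivAt_id 0).prodMk (hasDerivAt_const _ _)
    have hd : HasFDerivAt P.threshold L ((fun ε : ℝ => (ε, (1 / 4 : ℝ))) 0) := (hF.differentiableAt (by simp)).hasFDerivAt
    have hd' : HasDerivAt (fun ε : ℝ => P.threshold (ε, 1 / 4)) (L (1, 0)) 0 :=
      HasFDerivAt.comp_hasDerivAt (l := P.threshold) (l' := L) (0:ℝ) hd hc
    exact hd'.unique (hasDerivAt_threshold hlam hmu hcrit)
  have h2 : (fun ε => (k ε - 1 / 4) * L (0, 1)) =O[𝓝 0] fun ε => ε ^ 2 := by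
    simpa [mul_comm] using hk.const_mul_left (L (0, 1))
  refine (h1.add h2).congr_left fun ε => ?_
  have e : L ((ε, k ε) - (0, 1 / 4)) = ε * L (1, 0) + (k ε - 1 / 4) * L (0, 1) := by
    rw [show ((ε, k ε) : ℝ × ℝ) - (0, 1 / 4) = ε • (1, 0) + (k ε - 1 / 4) • (0, 1) by
      ext <;> simp, map_add, map_smul, map_smul, smul_eq_mul, smul_eq_mul]
  simp only [Function.comp_apply]
  rw [← hL, e, h10, threshold_base hmu hcrit]
  ring

end Threshold

end QueueParams

end

theorem mainTheorem2 (P : QueueParams) (hlam : 0 < P.lam) (hmu : 0 < P.mu)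
    (hcrit : 2 * P.mu < P.lam * P.theta) :
    ∃ (ε₀ : ℝ) (C : ℝ) (Δmod : ℝ → ℝ), 0 < ε₀ ∧
      ∀ ε : ℝ, |ε| < ε₀ →
        |Δmod ε - (P.deltaCr - ε * P.deltaCoeff)| ≤ C * ε ^ 2 ∧
        0 < Δmod ε ∧
        ∃ p : ℝ × ℝ, P.IsEquilibrium ε p ∧ (∀ p', P.IsEquilibrium ε p' → p' = p) ∧
          (∀ Δ : ℝ, 0 ≤ Δ → Δ < Δmod ε → P.IsAsymptoticallyStable ε Δ p) ∧
          (∀ Δ : ℝ, Δmod ε < Δ → ¬ P.IsStable ε Δ p) := by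
  have hθ : 0 < P.theta := pos_of_mul_pos_right (by linarith) hlam.le
  obtain ⟨s, hs⟩ := P.exists_share
  have hsO := QueueParams.share_isBigO hlam hmu hθ hs
  -- `s (1 - s) - 1 / 4 = -(s - 1 / 2)²`
  have hk : (fun ε => s ε * (1 - s ε) - 1 / 4) =O[𝓝 0] fun ε => ε ^ 2 :=
    (hsO.pow 2).neg_left.congr_left fun ε => by ring
  obtain ⟨C, hC⟩ := (QueueParams.threshold_isBigO hlam hmu hcrit hk).bound
  have hst : Tendsto (fun ε => (ε, s ε)) (𝓝 0) (𝓝 (0, 1 / 2)) := by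
    refine tendsto_id.prodMk_nhds ?_
    have h := (hsO.trans_tendsto tendsto_id).add_const (1 / 2)
    rw [zero_add] at h
    exact h.congr fun ε => sub_add_cancel _ _
  have hr : ∀ᶠ ε in 𝓝 0, (P.mu₁ ε - P.mu) ^ 2 < 4 * (P.mu₁ ε * P.mu) := by
    unfold QueueParams.mu₁
    exact ContinuousAt.eventually_lt (by fun_prop) (by fun_prop) (by simp; positivity)
  have hc : ∀ᶠ ε in 𝓝 0, P.mu₁ ε * P.mu < s ε * (1 - s ε) * P.theta₁ ε * P.lam₁ ε * P.mu
      + s ε * (1 - s ε) * P.theta * P.lam * P.mu₁ ε := by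
    refine hst.eventually (p := fun x : ℝ × ℝ => P.mu₁ x.1 * P.mu
      < x.2 * (1 - x.2) * P.theta₁ x.1 * P.lam₁ x.1 * P.mu
        + x.2 * (1 - x.2) * P.theta * P.lam * P.mu₁ x.1) ?_
    unfold QueueParams.mu₁ QueueParams.theta₁ QueueParams.lam₁
    refine ContinuousAt.eventually_lt (by fun_prop) (by fun_prop) ?_
    simp only [zero_mul, add_zero]
    nlinarith
  obtain ⟨ε₀, hε₀, hall⟩ := Metric.eventually_nhds_iff.1
    (((QueueParams.eventually_isAdmissible hlam hmu hθ).and hC).and (hr.and hc))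
  refine ⟨ε₀, C, fun ε => P.threshold (ε, s ε * (1 - s ε)), hε₀, fun ε hε => ?_⟩
  obtain ⟨⟨h1, h2⟩, h3, h4⟩ := hall (by simpa [Real.dist_eq] using hε)
  refine ⟨?_, QueueParams.stability_switch h1 (hs ε) h3.le h4⟩
  simpa using h2
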